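/- Let $n = 2^{k_n}$ with an integer $k_n \ge 0$. For $s \in \mathbb{R}^n$, $\sigma \in (0,\infty)^n$ let $P_{s,\sigma}$ be the Gaussian law on $\mathbb{R}^n$ with mean $s$ and diagonal covariance matrix with diagonal $\sigma$, and let $$\mathcal{K}_n(P_{s,\sigma},P_{t,\tau}) = \frac{1}{2n} \sum_{i=1}^n \Big[ \frac{(s_i-t_i)^2}{\tau_i} + \phi\Big(\frac{\tau_i}{\sigma_i}\Big) \Big], \qquad \phi(u) = \log u + \frac1u - 1,$$ be the normalized Kullback-Leibler divergence. One observes two independent vectors $Y^{[1]}, Y^{[2]}$ with law $P_{s,\sigma}$, where $s_i = s_r(i/n)$ and $\sigma_i = \sigma_r(i/n)$ for functions $s_r, \sigma_r : [0,1] \to \mathbb{R}$. *Models.* For integers $k, j \ge 0$ with $k + j \le k_n$, let $m = (k,j)$, $|p_m| = 2^k$, $d_m = 2^j$; let $p_m$ be the partition of $\{1,\dots,n\}$ into $|p_m|$ consecutive blocks of equal size and $p'_m$ the one into $|p_m| d_m$ consecutive blocks of equal size. Let $S_m$ (resp. $\Sigma_m$) be the space of the vectors of $\mathbb{R}^n$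 that are constant on the blocks of $p'_m$ (resp. $p_m$), and let $D_m = |p_m|(d_m+1)$ be the dimension of $S_m \times \Sigma_m$. Let $\theta > 1$, $\gamma \ge 1$, $\delta, \epsilon > 0$, and let $\mathcal{M}$ be the set of all such pairs $m$ that satisfy $$(\mathbf{H}_\theta)\quad n \ge \frac{\theta}{\theta-1}(\gamma+2) D_m \qquad\text{and}\qquad D_m \le \frac{5\delta\gamma n}{\log^{1+\epsilon} n};$$ it is assumed to be non-empty, and $\mathcal{F}^{PC} = \{S_m \times \Sigma_m,\ m \in \mathcal{M}\}$. *Estimators.* With $\pi_m$ the orthogonal projection on $S_m$, let $\hat s_m = \pi_m Y^{[1]}$ and let $\hat\sigma_m \in \Sigma_m$ be equal to $\frac{1}{|I|}\sum_{i \in I} (Y^{[2]}_i - (\pi_m Y^{[2]})_i)^2$ on each block $I \in p_m$. Let $\hat m = \hat m(Y^{[1]}, Y^{[2]})$ be any (measurable) minimizer over $m \in \mathcal{M}$ of $$\frac12 \sum_{i=1}^n \Big[ \frac{(Y^{[1]}_i - \hat s_{m,i})^2}{\hat\sigma_{m,i}} + \log \hat\sigma_{m,i} \Big] + \big(\gamma\theta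 + \log^{1+\epsilon} D_m\big) D_m ,$$ and let $(\tilde s, \tilde\sigma) = (\hat s_{\hat m}, \hat\sigma_{\hat m})$. *Claim.* For $\alpha \in (0,1]$ and $L > 0$ let $\mathcal{H}_\alpha(L)$ be the set of the functions $f : [0,1] \to \mathbb{R}$ with $|f(x)-f(y)| \le L|x-y|^\alpha$ for all $x, y$. Let $\alpha_1, \alpha_2 \in (0,1]$, $L_1, L_2 > 0$, $\sigma_* > 0$ and $\alpha = \min\{\alpha_1,\alpha_2\}$. There is a constant $C$, which depends only on $\alpha_1, \alpha_2, L_1, L_2, \theta, \gamma, \sigma_*, \delta, \epsilon$, such that, whenever $$n \ge \Big( \frac{2\sigma_*^2}{L_1^2\sigma_* + L_2^2} \Big)^2 \vee e^{4(1+\epsilon)^2},$$ the loss $\mathcal{K}_n(P_{s,\sigma}, P_{\tilde s,\tilde\sigma})$ is integrable and $$\sup_{(s_r,\sigma_r)} \mathbb{E}\big[\mathcal{K}_n(P_{s,\sigma}, P_{\tilde s,\tilde\sigma})\big] \le C \Big( \frac{n}{\log^{1+\epsilon} n} \Big)^{-2\alpha/(2\alpha+1)},$$ where the supremum is over the pairs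 $(s_r,\sigma_r) \in \mathcal{H}_{\alpha_1}(L_1) \times \mathcal{H}_{\alpha_2}(L_2)$ with $\min_i \sigma_i \ge \sigma_*$ and $\max_i \sigma_i \le \gamma \min_i \sigma_i$. -/

import Mathlib

open MeasureTheory ProbabilityTheory

noncomputable section

namespace HeteroReg

/-! Vectors of `ℝ ^ n`, with `n = 2 ^ K`, are functions `Fin (2 ^ K) → ℝ`; the coordinate written
`i` in `{1, …, n}` is the element `i - 1` of `Fin n`. -/

/-- The number of the block that contains `i`, in the regular partition of the `2 ^ K` indices
into `2 ^ k` consecutive blocks of size `2 ^ (K - k)` (for `k ≤ K`). -/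
def blockIndex (K k : ℕ) (i : Fin (2 ^ K)) : ℕ := (i : ℕ) / 2 ^ (K - k)

/-- The block that contains `i`, in the regular partition into `2 ^ k` blocks. -/
def block (K k : ℕ) (i : Fin (2 ^ K)) : Finset (Fin (2 ^ K)) :=
  Finset.univ.filter fun j => blockIndex K k j = blockIndex K k i

/-- The linear space of the vectors `∑ I, f_I 1_I`, where `I` runs through the `2 ^ k` blocks. -/
def pcSpace (K k : ℕ) : Submodule ℝ (EuclideanSpace ℝ (Fin (2 ^ K))) where
  carrier := {x | ∃ f : ℕ → ℝ, ∀ i, x i = f (blockIndex K k i)}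
  zero_mem' := ⟨fun _ => 0, fun _ => rfl⟩
  add_mem' := by
    rintro x y ⟨f, hf⟩ ⟨g, hg⟩
    exact ⟨fun b => f b + g b, fun i => by simp [hf i, hg i]⟩
  smul_mem' := by
    rintro c x ⟨f, hf⟩
    exact ⟨fun b => c * f b, fun i => by simp [hf i]⟩

/-- A model is coded by a pair `m = (k, j)`: the partition `p_m` has `|p_m| = 2 ^ k` blocks, each of
them is cut into `d_m = 2 ^ j` blocks, which gives the partition `p'_m` into `2 ^ (k + j)` blocks.
Then `S_m = pcSpace K (k + j)` and `Σ_m = pcSpace K k`. This is the dimension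
`D_m = |p_m| (d_m + 1)` of `S_m × Σ_m`. -/
def modelDim (m : ℕ × ℕ) : ℕ := 2 ^ m.1 * (2 ^ m.2 + 1)

/-- The condition `n ≥ θ / (θ - 1) * (γ + 2) * D_m` of the hypothesis `(H_θ)`. -/
def HTheta (K : ℕ) (θ γ : ℝ) (m : ℕ × ℕ) : Prop :=
  θ / (θ - 1) * (γ + 2) * (modelDim m : ℝ) ≤ (2 : ℝ) ^ K

/-- The dimension constraint `D_m ≤ 5 δ γ n / log ^ (1 + ε) n`. -/
def DimBound (K : ℕ) (γ δ ε : ℝ) (m : ℕ × ℕ) : Prop :=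
  (modelDim m : ℝ) ≤ 5 * δ * γ * (2 : ℝ) ^ K / Real.log ((2 : ℝ) ^ K) ^ (1 + ε)

/-- The (indices of the) collection of dyadic piecewise constant models: all the dyadic pairs that
fulfil `(H_θ)` and the dimension constraint. -/
def models (K : ℕ) (θ γ δ ε : ℝ) : Set (ℕ × ℕ) :=
  {m | m.1 + m.2 ≤ K ∧ HTheta K θ γ m ∧ DimBound K γ δ ε m}

/-- `π_m y`, the orthogonal projection of `y` on `S_m`. -/
def proj (K : ℕ) (m : ℕ × ℕ) (y : Fin (2 ^ K) → ℝ) : Fin (2 ^ K) → ℝ :=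
  fun i => (pcSpace K (m.1 + m.2)).starProjection (WithLp.toLp 2 y) i

/-- The estimator of the mean, from the first observation. -/
def meanEst (K : ℕ) (m : ℕ × ℕ) (y₁ : Fin (2 ^ K) → ℝ) : Fin (2 ^ K) → ℝ := proj K m y₁

/-- The estimator of the variances, from the second observation: on each block of `p_m`,
the mean of the squared residuals. -/
def varEst (K : ℕ) (m : ℕ × ℕ) (y₂ : Fin (2 ^ K) → ℝ) : Fin (2 ^ K) → ℝ :=
  fun i => (1 / ((block K m.1 i).card : ℝ)) *
    ∑ j ∈ block K m.1 i, (y₂ j - proj K m y₂ j) ^ 2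

/-- The likelihood function with respect to the first observation. -/
def likelihood {n : ℕ} (y₁ t τ : Fin n → ℝ) : ℝ :=
  (1 / 2) * ∑ i, ((y₁ i - t i) ^ 2 / τ i + Real.log (τ i))

/-- The penalty `(γ θ + log ^ (1 + ε) D_m) D_m`. -/
def pen (θ γ ε : ℝ) (m : ℕ × ℕ) : ℝ :=
  (γ * θ + Real.log (modelDim m : ℝ) ^ (1 + ε)) * (modelDim m : ℝ)

/-- The penalized likelihood criterion. -/
def crit (K : ℕ) (θ γ ε : ℝ) (m : ℕ × ℕ) (y : (Fin (2 ^ K) → ℝ) × (Fin (2 ^ K) → ℝ)) : ℝ :=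
  likelihood y.1 (meanEst K m y.1) (varEst K m y.2) + pen θ γ ε m

/-- `mhat` is a (measurable) rule that selects from the data a minimizer of the criterion over the
collection. Minimality is asked for at the data where the criterion is well defined, that is where
the variance estimators of the collection do not vanish (almost every data). -/
structure IsSelector (K : ℕ) (θ γ δ ε : ℝ)
    (mhat : (Fin (2 ^ K) → ℝ) × (Fin (2 ^ K) → ℝ) → ℕ × ℕ) : Prop where
  measurable : Measurable mhat
  mem : ∀ y, mhat y ∈ models K θ γ δ ε
  minimal : ∀ y : (Fin (2 ^ K) → ℝ) × (Fin (2 ^ K) → ℝ),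
    (∀ m ∈ models K θ γ δ ε, ∀ i, 0 < varEst K m y.2 i) →
    ∀ m ∈ models K θ γ δ ε, crit K θ γ ε (mhat y) y ≤ crit K θ γ ε m y

/-- `φ u = log u + 1 / u - 1`. -/
def phi (u : ℝ) : ℝ := Real.log u + 1 / u - 1

/-- The Kullback-Leibler divergence between the Gaussian laws with independent coordinates,
means `s`, `t` and variances `σ`, `τ`. -/
def kullback {n : ℕ} (s σ t τ : Fin n → ℝ) : ℝ :=
  (1 / 2) * ∑ i, ((s i - t i) ^ 2 / τ i + phi (τ i / σ i))

/-- The normalized Kullback-Leibler divergence. -/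
def kullbackN {n : ℕ} (s σ t τ : Fin n → ℝ) : ℝ := (1 / (n : ℝ)) * kullback s σ t τ

/-- The law of a Gaussian vector with mean `s` and diagonal covariance matrix with entries `σ`. -/
def gaussLaw {n : ℕ} (s σ : Fin n → ℝ) : Measure (Fin n → ℝ) :=
  Measure.pi fun i => gaussianReal (s i) (σ i).toNNReal

/-- The vector of the values of `f` at the design points `1 / n, 2 / n, …, n / n`. -/
def design (n : ℕ) (f : ℝ → ℝ) : Fin n → ℝ := fun i => f (((i : ℕ) + 1 : ℝ) / (n : ℝ))

/-- The `α`-Hölderian functions with constant `L` on `[0, 1]` (the values elsewhere are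
irrelevant). -/
def holderBall (α L : ℝ) : Set (ℝ → ℝ) :=
  {f | ∀ x ∈ Set.Icc (0 : ℝ) 1, ∀ y ∈ Set.Icc (0 : ℝ) 1, |f x - f y| ≤ L * |x - y| ^ α}

/-- The normalized loss of the selected pair of estimators at the data `y`. -/
def selectedLoss (K : ℕ) (mhat : (Fin (2 ^ K) → ℝ) × (Fin (2 ^ K) → ℝ) → ℕ × ℕ)
    (s σ : Fin (2 ^ K) → ℝ) (y : (Fin (2 ^ K) → ℝ) × (Fin (2 ^ K) → ℝ)) : ℝ :=
  kullbackN s σ (meanEst K (mhat y) y.1) (varEst K (mhat y) y.2)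


/-- The log-density of `gaussianReal a v` with respect to `gaussianReal b w`. -/
def logRatio (a v b w x : ℝ) : ℝ :=
  (Real.log w - Real.log v) / 2 - (x - a) ^ 2 / (2 * v) + (x - b) ^ 2 / (2 * w)

lemma measurable_logRatio (a v b w : ℝ) : Measurable (logRatio a v b w) := by
  unfold logRatio; fun_prop

lemma gaussianReal_eq_withDensity {a v b w : ℝ} (hv : 0 < v) (hw : 0 < w) :
    gaussianReal a v.toNNReal = (gaussianReal b w.toNNReal).withDensity
      fun x => ENNReal.ofReal (Real.exp (logRatio a v b w x)) := by
  have hm := measurable_logRatio a v b w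
  rw [gaussianReal_of_var_ne_zero _ (by simpa using hv),
    gaussianReal_of_var_ne_zero _ (by simpa using hw),
    ← withDensity_mul _ (measurable_gaussianPDF _ _) (by fun_prop)]
  congr 1
  ext x
  simp only [Pi.mul_apply, gaussianPDF]
  rw [← ENNReal.ofReal_mul (gaussianPDFReal_nonneg _ _ _)]
  congr 1
  simp only [gaussianPDFReal, Real.coe_toNNReal _ hv.le, Real.coe_toNNReal _ hw.le]
  have h2 : (0 : ℝ) < 2 * Real.pi := by positivity
  have key : ∀ u : ℝ, 0 < u → (Real.sqrt (2 * Real.pi * u))⁻¹ =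
      Real.exp (- (Real.log (2 * Real.pi) + Real.log u) / 2) := by
    intro u hu
    rw [← Real.log_mul h2.ne' hu.ne', neg_div, Real.exp_neg, ← Real.log_sqrt (by positivity),
      Real.exp_log (by positivity)]
  rw [key v hv, key w hw, ← Real.exp_add, ← Real.exp_add, ← Real.exp_add]
  congr 1
  unfold logRatio
  ring

lemma integral_logRatio {a v b w : ℝ} (hv : 0 < v) (hw : 0 < w) :
    Integrable (logRatio a v b w) (gaussianReal a v.toNNReal) ∧
    ∫ x, logRatio a v b w x ∂(gaussianReal a v.toNNReal) =
      (1 / 2) * ((a - b) ^ 2 / w + phi (w / v)) := by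
  set μ := gaussianReal a v.toNNReal
  have h2 : MemLp (fun x : ℝ => x - a) 2 μ :=
    (memLp_id_gaussianReal' 2 (by simp)).sub (memLp_const a)
  have hi2 : Integrable (fun x : ℝ => (x - a) ^ 2) μ := h2.integrable_sq
  have hi1 : Integrable (fun x : ℝ => x - a) μ := h2.integrable (by simp)
  have e1 : ∫ x, (x - a) ∂μ = 0 := by
    have hid : Integrable (fun x : ℝ => x) μ :=
      (memLp_id_gaussianReal' 1 (by simp)).integrable le_rfl
    rw [integral_sub hid (integrable_const _)]
    simp [μ, integral_id_gaussianReal]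
  have e2 : ∫ x, (x - a) ^ 2 ∂μ = v := by
    have := variance_id_gaussianReal (μ := a) (v := v.toNNReal)
    rw [variance_eq_integral (by fun_prop)] at this
    simpa [integral_id_gaussianReal, hv.le] using this
  have hg : logRatio a v b w = fun x =>
      (1 / (2 * w) - 1 / (2 * v)) * (x - a) ^ 2 + ((a - b) / w) * (x - a) +
        ((Real.log w - Real.log v) / 2 + (a - b) ^ 2 / (2 * w)) := by
    ext x; unfold logRatio; field_simp; ring
  have i1 := hi2.const_mul (1 / (2 * w) - 1 / (2 * v))
  have i2 := hi1.const_mul ((a - b) / w)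
  have i3 : Integrable (fun x => (1 / (2 * w) - 1 / (2 * v)) * (x - a) ^ 2 +
      ((a - b) / w) * (x - a)) μ := i1.add i2
  rw [hg]
  refine ⟨i3.add (integrable_const _), ?_⟩
  rw [integral_add i3 (integrable_const _), integral_add i1 i2, integral_const_mul,
    integral_const_mul, e1, e2]
  simp only [integral_const, probReal_univ, smul_eq_mul, phi, Real.log_div hw.ne' hv.ne']
  field_simp
  ring

/-- For positive variances, `kullback s σ t τ` is the Kullback-Leibler divergence of
`gaussLaw s σ` from `gaussLaw t τ`. -/
theorem klDiv_gaussLaw {n : ℕ} {s σ t τ : Fin n → ℝ} (hσ : ∀ i, 0 < σ i) (hτ : ∀ i, 0 < τ i) :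
    (InformationTheory.klDiv (gaussLaw s σ) (gaussLaw t τ)).toReal = kullback s σ t τ := by
  set g : Fin n → ℝ → ℝ := fun i => logRatio (s i) (σ i) (t i) (τ i)
  have hgm : ∀ i, Measurable (g i) := fun i => measurable_logRatio _ _ _ _
  have hm : Measurable fun y : Fin n → ℝ => ENNReal.ofReal (Real.exp (∑ i, g i (y i))) := by
    fun_prop
  have hd : gaussLaw s σ = (gaussLaw t τ).withDensity
      fun y => ENNReal.ofReal (Real.exp (∑ i, g i (y i))) := by
    unfold gaussLaw
    refine (Measure.pi_eq fun A hA => ?_)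
    rw [withDensity_apply _ (MeasurableSet.univ_pi hA),
      ← lintegral_indicator (MeasurableSet.univ_pi hA)]
    have hm' : ∀ i, Measurable
        ((A i).indicator fun x => ENNReal.ofReal (Real.exp (g i x))) := fun i =>
      Measurable.indicator (by fun_prop) (hA i)
    have : (Set.univ.pi A).indicator
        (fun y : Fin n → ℝ => ENNReal.ofReal (Real.exp (∑ i, g i (y i)))) =
        fun y => ∏ i, (A i).indicator (fun x => ENNReal.ofReal (Real.exp (g i x))) (y i) := by
      ext y
      by_cases hy : y ∈ Set.univ.pi A
      · rw [Set.indicator_of_mem hy, Real.exp_sum,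
          ENNReal.ofReal_prod_of_nonneg fun i _ => (Real.exp_pos _).le]
        exact Finset.prod_congr rfl fun i _ => by rw [Set.indicator_of_mem (hy i trivial)]
      · rw [Set.indicator_of_notMem hy]
        simp only [Set.mem_pi, Set.mem_univ, true_implies, not_forall] at hy
        obtain ⟨i, hi⟩ := hy
        exact (Finset.prod_eq_zero (Finset.mem_univ i) (Set.indicator_of_notMem hi _)).symm
    rw [this]
    have hind := iIndepFun_pi (μ := fun i => gaussianReal (t i) (τ i).toNNReal)
      (X := fun i => (A i).indicator fun x => ENNReal.ofReal (Real.exp (g i x)))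
      (fun i => (hm' i).aemeasurable)
    rw [lintegral_prod_eq_prod_lintegral_of_indepFun Finset.univ _ hind
      (fun i => (hm' i).comp (measurable_pi_apply i))]
    refine Finset.prod_congr rfl fun i _ => ?_
    rw [gaussianReal_eq_withDensity (b := t i) (hσ i) (hτ i), withDensity_apply _ (hA i),
      ← lintegral_indicator (hA i)]
    exact (measurePreserving_eval (fun i => gaussianReal (t i) (τ i).toNNReal) i).lintegral_comp
      (hm' i)
  have hp : IsProbabilityMeasure (gaussLaw s σ) := by unfold gaussLaw; infer_instance
  have hq : IsProbabilityMeasure (gaussLaw t τ) := by unfold gaussLaw; infer_instance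
  have hac : gaussLaw s σ ≪ gaussLaw t τ := by
    rw [hd]; exact withDensity_absolutelyContinuous _ _
  have hl : llr (gaussLaw s σ) (gaussLaw t τ) =ᵐ[gaussLaw s σ] fun y => ∑ i, g i (y i) := by
    have h0 := Measure.rnDeriv_withDensity (gaussLaw t τ) hm
    rw [← hd] at h0
    filter_upwards [hac.ae_le h0] with y hy
    rw [llr, hy, ENNReal.toReal_ofReal (Real.exp_pos _).le, Real.log_exp]
  rw [InformationTheory.toReal_klDiv_of_measure_eq hac (by simp), integral_congr_ae hl,
    integral_finsetSum, kullback, Finset.mul_sum]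
  · refine Finset.sum_congr rfl fun i _ => ?_
    rw [← (integral_logRatio (a := s i) (b := t i) (hσ i) (hτ i)).2]
    exact integral_comp_eval (μ := fun i => gaussianReal (s i) (σ i).toNNReal)
      (hgm i).aestronglyMeasurable
  · intro i _
    exact integrable_comp_eval (μ := fun i => gaussianReal (s i) (σ i).toNNReal)
      (integral_logRatio (hσ i) (hτ i)).1

end HeteroReg

end

noncomputable section

namespace HeteroReg

/-! Given the second observation, every variance estimator is a fixed vector `v`, so the argument is
conditional. By `kullback_meanEst_eq` and `likelihood_meanEst_eq`, the loss of a model is a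
deterministic part `biasLoss` plus half of `noiseProj`, the weighted squared norm of the projected
noise. The likelihood is that loss, plus a term common to all models, minus `noiseProj`, plus a
linear and a centered quadratic form in the noise. If the ratios `σ i / v i` are bounded, these two
forms have variances of the order of `biasLoss`. Hence they are absorbed by half of `biasLoss + 1`,
up to a remainder of bounded mean. The excess of `noiseProj` over the penalty also has bounded mean:
an exponential moment of fixed small rate suffices, because `D * exp (-(log D) ^ (1 + ε) / κ)` is
bounded for every `κ > 0`. Bounding the noise of the selected model by the sum over the at most `(K
+ 1) ^ 2` models gives the conditional oracle inequality `IntegralLE.modelLoss_selected_of_good`.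

The variance estimators must then be bounded below. Two neighbours in the same fine block have the
same fitted value, so the difference of their residuals is the difference of the observations
(`sum_pair_sq_le_varEst`). The differences over disjoint couples are independent Gaussian variables
whose normalized densities are at most 1, whatever their means. A Chernoff bound shows that all
estimators exceed a fixed fraction of the minimal variance, except on an event of probability at
most `n ^ (-7)`. On that event the loss is summed over all models and controlled by moments of order
`-3/2` and `2` of the estimators.

For the rate, the oracle inequality is applied to a model `(k, 0)`. With `X = n / log ^ (1 + ε) n`,
the squared bias and the error of the variance estimators are of order at most `2 ^ (-2 k α) + 2 ^ k
/ X`, and the penalty divided by `n` is of order at most `2 ^ k / X`. The choice `2 ^ k ≈ X ^ (1 /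
(2 α + 1))` balances the two, and the remainder `log ^ 2 n / n` is smaller because `2 α / (2 α + 1)
≤ 2 / 3`. -/

/-- `f` is integrable with integral at most `R`. -/
structure IntegralLE {Ω : Type*} [MeasurableSpace Ω] (μ : Measure Ω) (f : Ω → ℝ) (R : ℝ) :
    Prop where
  integrable : Integrable f μ
  le : ∫ x, f x ∂μ ≤ R

/-! ### Calculus of upper bounds for integrals. -/

namespace IntegralLE

variable {Ω : Type*} [MeasurableSpace Ω] {μ : Measure Ω} {f g : Ω → ℝ} {R S : ℝ}

lemma weaken (h : IntegralLE μ f R) (hRS : R ≤ S) : IntegralLE μ f S :=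
  ⟨h.1, h.2.trans hRS⟩

lemma add (hf : IntegralLE μ f R) (hg : IntegralLE μ g S) :
    IntegralLE μ (fun x => f x + g x) (R + S) :=
  ⟨hf.1.add hg.1, by rw [integral_add hf.1 hg.1]; exact add_le_add hf.2 hg.2⟩

lemma const_mul (hf : IntegralLE μ f R) {c : ℝ} (hc : 0 ≤ c) :
    IntegralLE μ (fun x => c * f x) (c * R) :=
  ⟨hf.1.const_mul c, by rw [integral_const_mul]; exact mul_le_mul_of_nonneg_left hf.2 hc⟩

lemma const [IsProbabilityMeasure μ] (c : ℝ) : IntegralLE μ (fun _ => c) c :=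
  ⟨integrable_const c, by simp⟩

lemma sum {ι : Type*} {t : Finset ι} {F : ι → Ω → ℝ} {Q : ι → ℝ}
    (h : ∀ i ∈ t, IntegralLE μ (F i) (Q i)) :
    IntegralLE μ (fun x => ∑ i ∈ t, F i x) (∑ i ∈ t, Q i) :=
  ⟨integrable_finsetSum t fun i hi => (h i hi).1, by
    rw [integral_finsetSum t fun i hi => (h i hi).1]
    exact Finset.sum_le_sum fun i hi => (h i hi).2⟩

lemma mono (hg : IntegralLE μ g R) (hf : AEStronglyMeasurable f μ) (h0 : ∀ᵐ x ∂μ, 0 ≤ f x)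
    (h : ∀ᵐ x ∂μ, f x ≤ g x) : IntegralLE μ f R := by
  have hi : Integrable f μ := hg.1.mono' hf (by
    filter_upwards [h0, h] with x h1 h2
    rwa [Real.norm_of_nonneg h1])
  exact ⟨hi, (integral_mono_ae hi hg.1 h).trans hg.2⟩

/-- Tonelli with the first coordinate integrated inside, so that `y` can be the second observation
on which one conditions. Since `F ≥ 0`, the inner integral of the norm gives both integrability and
the bound. -/
lemma prod {Ω' : Type*} [MeasurableSpace Ω'] {ν : Measure Ω'} [SFinite μ] [SFinite ν]
    {F : Ω × Ω' → ℝ} {H : Ω' → ℝ}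
    (hF : Measurable F) (h0 : ∀ᵐ y ∂ν, ∀ᵐ x ∂μ, 0 ≤ F (x, y))
    (h : ∀ᵐ y ∂ν, IntegralLE μ (fun x => F (x, y)) (H y)) (hH : IntegralLE ν H R) :
    IntegralLE (μ.prod ν) F R := by
  have e : ∀ᵐ y ∂ν, ∫ x, ‖F (x, y)‖ ∂μ = ∫ x, F (x, y) ∂μ := by
    filter_upwards [h0] with y hy
    exact integral_congr_ae (by filter_upwards [hy] with x hx using Real.norm_of_nonneg hx)
  have key : IntegralLE ν (fun y => ∫ x, ‖F (x, y)‖ ∂μ) R := by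
    refine hH.mono ?_ (Filter.Eventually.of_forall fun y =>
      integral_nonneg fun x => norm_nonneg _) ?_
    · exact (hF.norm.stronglyMeasurable.integral_prod_left').aestronglyMeasurable
    · filter_upwards [e, h] with y h1 h2
      rw [h1]
      exact h2.2
  have hi : Integrable F (μ.prod ν) := (integrable_prod_iff' hF.aestronglyMeasurable).2
    ⟨h.mono fun y hy => hy.1, key.1⟩
  refine ⟨hi, ?_⟩
  rw [integral_prod_symm _ hi]
  rw [← integral_congr_ae e]
  exact key.2

end IntegralLE

instance isProbabilityMeasure_gaussLaw {n : ℕ} (s σ : Fin n → ℝ) :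
    IsProbabilityMeasure (gaussLaw s σ) := by
  unfold gaussLaw; infer_instance

/-! ### Moments of linear and quadratic forms of a Gaussian vector. -/

section Gaussian

variable {n : ℕ} {s σ : Fin n → ℝ}

lemma map_eval_gaussLaw (i : Fin n) :
    (gaussLaw s σ).map (fun y => y i) = gaussianReal (s i) (σ i).toNNReal :=
  (measurePreserving_eval (fun i => gaussianReal (s i) (σ i).toNNReal) i).map_eq

lemma hasGaussianLaw_eval (i : Fin n) : HasGaussianLaw (fun y : Fin n → ℝ => y i) (gaussLaw s σ) :=
  ⟨by rw [map_eval_gaussLaw]; infer_instance⟩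

lemma iIndepFun_eval : iIndepFun (fun (i : Fin n) (y : Fin n → ℝ) => y i) (gaussLaw s σ) :=
  iIndepFun_pi (X := fun _ => id) fun _ => aemeasurable_id

lemma hasGaussianLaw_gaussLaw :
    HasGaussianLaw (fun (y : Fin n → ℝ) (i : Fin n) => y i) (gaussLaw s σ) :=
  iIndepFun.hasGaussianLaw hasGaussianLaw_eval iIndepFun_eval

lemma integral_linear (a : Fin n → ℝ) :
    ∫ y, ∑ i, a i * (y i - s i) ∂(gaussLaw s σ) = 0 := by
  have hi : ∀ i, Integrable (fun y : Fin n → ℝ => y i) (gaussLaw s σ) := fun i =>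
    (hasGaussianLaw_eval i).integrable
  have hj : ∀ i, Integrable (fun y : Fin n → ℝ => a i * (y i - s i)) (gaussLaw s σ) := fun i =>
    ((hi i).sub (integrable_const (s i))).const_mul (a i)
  rw [integral_finsetSum _ fun i _ => hj i]
  refine Finset.sum_eq_zero fun i _ => ?_
  rw [integral_const_mul, integral_sub (hi i) (integrable_const _)]
  have : ∫ y : Fin n → ℝ, y i ∂(gaussLaw s σ) = s i := by
    rw [← integral_id_gaussianReal (μ := s i) (v := (σ i).toNNReal), ← map_eval_gaussLaw (s := s),
      integral_map (measurable_pi_apply i).aemeasurable (by fun_prop)]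
  simp [this]

lemma variance_linear (hσ : ∀ i, 0 ≤ σ i) (a : Fin n → ℝ) :
    Var[fun y : Fin n → ℝ => ∑ i, a i * (y i - s i); gaussLaw s σ] = ∑ i, a i ^ 2 * σ i := by
  have h := variance_sum_pi (μ := fun i => gaussianReal (s i) (σ i).toNNReal)
    (X := fun i x => a i * (x - s i))
    (fun i => ((memLp_id_gaussianReal' 2 (by simp)).sub (memLp_const _)).const_mul (a i))
  have e : (∑ i, fun ω : Fin n → ℝ => a i * (ω i - s i)) =
      fun y : Fin n → ℝ => ∑ i, a i * (y i - s i) := by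
    ext y; simp
  rw [e] at h
  rw [gaussLaw, h]
  refine Finset.sum_congr rfl fun i _ => ?_
  rw [variance_const_mul, variance_sub_const (by fun_prop), variance_fun_id_gaussianReal,
    Real.coe_toNNReal _ (hσ i)]

lemma map_linear (hσ : ∀ i, 0 ≤ σ i) (a : Fin n → ℝ) :
    (gaussLaw s σ).map (fun y => ∑ i, a i * (y i - s i)) =
      gaussianReal 0 (∑ i, a i ^ 2 * σ i).toNNReal := by
  have hg : HasGaussianLaw (fun y : Fin n → ℝ => ∑ i, a i * (y i - s i)) (gaussLaw s σ) := by
    refine HasGaussianLaw.fun_sum ?_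
    have hind : iIndepFun (fun (i : Fin n) (y : Fin n → ℝ) => a i * (y i - s i)) (gaussLaw s σ) :=
      iIndepFun_eval.comp (fun i x => a i * (x - s i)) fun i => by fun_prop
    refine iIndepFun.hasGaussianLaw (fun i => ⟨?_⟩) hind
    have e : (fun y : Fin n → ℝ => a i * (y i - s i)) =
      ((fun x => a i * x) ∘ fun x => x - s i) ∘ fun y : Fin n → ℝ => y i := rfl
    rw [e, ← Measure.map_map (by fun_prop) (by fun_prop), map_eval_gaussLaw,
      ← Measure.map_map (g := fun x => a i * x) (f := fun x => x - s i) (by fun_prop) (by fun_prop),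
      gaussianReal_map_sub_const, gaussianReal_map_const_mul]
    infer_instance
  rw [hg.map_eq_gaussianReal, integral_linear, variance_linear hσ]

lemma IntegralLE.linear_sq (hσ : ∀ i, 0 ≤ σ i) (a : Fin n → ℝ) :
    IntegralLE (gaussLaw s σ) (fun y => (∑ i, a i * (y i - s i)) ^ 2) (∑ i, a i ^ 2 * σ i) := by
  have hm : MemLp (fun y : Fin n → ℝ => ∑ i, a i * (y i - s i)) 2 (gaussLaw s σ) :=
    memLp_finsetSum _ fun i _ =>
      ((hasGaussianLaw_eval i).memLp_two.sub (memLp_const _)).const_mul _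
  refine ⟨hm.integrable_sq, ?_⟩
  rw [← variance_linear (s := s) hσ, variance_of_integral_eq_zero (Measurable.aemeasurable (by fun_prop)) (integral_linear a)]

/-- For `w = v` the factor doubles the variance in the Gaussian exponent, and the integral is `√2`.
The Dirac case `v = 0` has to be covered as well. -/
lemma IntegralLE.exp_sq_gaussianReal {v : NNReal} {w : ℝ} (hv : (v : ℝ) ≤ w) :
    IntegralLE (gaussianReal 0 v) (fun x => Real.exp (x ^ 2 / (4 * w))) 2 := by
  rcases eq_or_ne v 0 with rfl | hv0
  · rw [gaussianReal_zero_var]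
    exact ⟨integrable_dirac (by simp), by simp⟩
  have hvp : (0 : ℝ) < v := by positivity
  suffices h : IntegralLE (gaussianReal 0 v) (fun x => Real.exp (x ^ 2 / (4 * v))) 2 by
    refine h.mono (by fun_prop) (Filter.Eventually.of_forall fun x => (Real.exp_pos _).le)
      (Filter.Eventually.of_forall fun x => ?_)
    gcongr
  have e : ∀ x : ℝ, gaussianPDFReal 0 v x • Real.exp (x ^ 2 / (4 * v)) =
      (√(2 * Real.pi * v))⁻¹ * Real.exp (-(1 / (4 * v)) * x ^ 2) := by
    intro x
    rw [gaussianPDFReal, smul_eq_mul, mul_assoc, ← Real.exp_add]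
    congr 2
    field_simp
    ring
  constructor
  · rw [gaussianReal_of_var_ne_zero _ hv0, integrable_withDensity_iff_integrable_smul'
      (measurable_gaussianPDF _ _) (Filter.Eventually.of_forall fun x => gaussianPDF_lt_top)]
    simp only [toReal_gaussianPDF, e]
    exact (integrable_exp_neg_mul_sq (by positivity)).const_mul _
  · rw [integral_gaussianReal_eq_integral_smul hv0]
    simp only [e]
    rw [integral_const_mul, integral_gaussian, ← Real.sqrt_inv, ← Real.sqrt_mul (by positivity)]
    rw [Real.sqrt_le_left (by norm_num)]
    have : Real.pi ≠ 0 := Real.pi_ne_zero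
    field_simp
    norm_num

lemma IntegralLE.linear_exp_sq (hσ : ∀ i, 0 ≤ σ i) (a : Fin n → ℝ) {w : ℝ}
    (h : ∑ i, a i ^ 2 * σ i ≤ w) :
    IntegralLE (gaussLaw s σ)
      (fun y => Real.exp ((∑ i, a i * (y i - s i)) ^ 2 / (4 * w))) 2 := by
  have h1 := IntegralLE.exp_sq_gaussianReal (v := (∑ i, a i ^ 2 * σ i).toNNReal) (w := w)
    (by rw [Real.coe_toNNReal _ (Finset.sum_nonneg fun i _ => mul_nonneg (sq_nonneg _) (hσ i))]
        exact h)
  rw [← map_linear (s := s) hσ] at h1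
  refine ⟨h1.1.comp_measurable (by fun_prop), ?_⟩
  have := h1.2
  rwa [integral_map (Measurable.aemeasurable (by fun_prop)) (by fun_prop)] at this

lemma sq_le_two_mul_exp {z : ℝ} (hz : 0 ≤ z) : z ^ 2 ≤ 2 * Real.exp z := by
  have := Real.quadratic_le_exp_of_nonneg hz
  nlinarith

/-- With `z = x ^ 2 / (4 w)`, one has `x ^ 4 = 16 w ^ 2 z ^ 2 ≤ 32 w ^ 2 exp z`, and `exp z` has
mean at most 2. -/
lemma IntegralLE.linear_pow_four (hσ : ∀ i, 0 ≤ σ i) (a : Fin n → ℝ) {w : ℝ} (hw : 0 < w)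
    (h : ∑ i, a i ^ 2 * σ i ≤ w) :
    IntegralLE (gaussLaw s σ) (fun y => (∑ i, a i * (y i - s i)) ^ 4) (64 * w ^ 2) := by
  refine (((IntegralLE.linear_exp_sq (s := s) hσ a h).const_mul
    (c := 32 * w ^ 2) (by positivity)).mono (Measurable.aestronglyMeasurable (by fun_prop))
    (Filter.Eventually.of_forall fun x => by positivity)
    (Filter.Eventually.of_forall fun y => ?_)).weaken (by linarith)
  set x := ∑ i, a i * (y i - s i)
  have h1 := sq_le_two_mul_exp (z := x ^ 2 / (4 * w)) (by positivity)
  have : x ^ 4 = 16 * w ^ 2 * (x ^ 2 / (4 * w)) ^ 2 := by field_simp; ring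
  rw [this]
  nlinarith [sq_nonneg w]

/-- The variance of a square is at most the fourth moment, which the exponential moment controls; 64
is not sharp, and its size does not matter for the rate. -/
lemma integral_centered_sq (v : NNReal) (m : ℝ) :
    MemLp (fun x : ℝ => (x - m) ^ 2 - v) 2 (gaussianReal m v) ∧
    ∫ x, ((x - m) ^ 2 - v) ∂(gaussianReal m v) = 0 ∧
    Var[fun x : ℝ => (x - m) ^ 2 - v; gaussianReal m v] ≤ 64 * (v : ℝ) ^ 2 := by
  rcases eq_or_ne v 0 with rfl | hv0
  · rw [gaussianReal_zero_var]
    refine ⟨?_, by simp, by simp⟩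
    rw [memLp_two_iff_integrable_sq (by fun_prop)]
    exact integrable_dirac (by simp)
  have hvp : (0 : ℝ) < v := by positivity
  have hm : MemLp (fun x : ℝ => x - m) 2 (gaussianReal m v) :=
    (memLp_id_gaussianReal' 2 (by simp)).sub (memLp_const m)
  have e2 : ∫ x, (x - m) ^ 2 ∂(gaussianReal m v) = v := by
    have := variance_id_gaussianReal (μ := m) (v := v)
    rw [variance_eq_integral (by fun_prop)] at this
    simpa [integral_id_gaussianReal] using this
  have h4 : IntegralLE (gaussianReal m v) (fun x => (x - m) ^ 4) (64 * (v : ℝ) ^ 2) := by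
    have h0 := IntegralLE.exp_sq_gaussianReal (v := v) le_rfl
    have hmap := gaussianReal_map_sub_const (μ := m) (v := v) m
    rw [sub_self] at hmap
    rw [← hmap] at h0
    have h0' : IntegralLE (gaussianReal m v) (fun x => Real.exp ((x - m) ^ 2 / (4 * v))) 2 := by
      refine ⟨h0.1.comp_measurable (by fun_prop), ?_⟩
      have := h0.2
      rwa [integral_map (by fun_prop) (by fun_prop)] at this
    refine ((h0'.const_mul (c := 32 * (v : ℝ) ^ 2) (by positivity)).mono (by fun_prop)
      (Filter.Eventually.of_forall fun x => by positivity)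
      (Filter.Eventually.of_forall fun x => ?_)).weaken (by linarith)
    have h1 := sq_le_two_mul_exp (z := (x - m) ^ 2 / (4 * v)) (by positivity)
    have : (x - m) ^ 4 = 16 * (v : ℝ) ^ 2 * ((x - m) ^ 2 / (4 * v)) ^ 2 := by field_simp; ring
    rw [this]
    nlinarith [sq_nonneg (v : ℝ)]
  have hsq : MemLp (fun x : ℝ => (x - m) ^ 2) 2 (gaussianReal m v) := by
    rw [memLp_two_iff_integrable_sq (by fun_prop)]
    simpa only [← pow_mul] using h4.1
  refine ⟨hsq.sub (memLp_const _), ?_, ?_⟩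
  · rw [integral_sub hm.integrable_sq (integrable_const _), e2]
    simp
  · rw [variance_sub_const (by fun_prop)]
    refine (variance_le_expectation_sq (by fun_prop)).trans ?_
    simpa only [Pi.pow_apply, ← pow_mul] using h4.2

lemma IntegralLE.quadratic_sq (hσ : ∀ i, 0 ≤ σ i) (c : Fin n → ℝ) :
    IntegralLE (gaussLaw s σ) (fun y => (∑ i, c i * ((y i - s i) ^ 2 - σ i)) ^ 2)
      (64 * ∑ i, c i ^ 2 * σ i ^ 2) := by
  have h0 : ∀ i, MemLp (fun x : ℝ => (x - s i) ^ 2 - σ i) 2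
        (gaussianReal (s i) (σ i).toNNReal) ∧
      ∫ x, ((x - s i) ^ 2 - σ i) ∂(gaussianReal (s i) (σ i).toNNReal) = 0 ∧
      Var[fun x : ℝ => (x - s i) ^ 2 - σ i; gaussianReal (s i) (σ i).toNNReal]
        ≤ 64 * (σ i) ^ 2 := by
    intro i
    have := integral_centered_sq (σ i).toNNReal (s i)
    rwa [Real.coe_toNNReal _ (hσ i)] at this
  have h := variance_sum_pi (μ := fun i => gaussianReal (s i) (σ i).toNNReal)
    (X := fun i x => c i * ((x - s i) ^ 2 - σ i)) (fun i => (h0 i).1.const_mul (c i))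
  have e : (∑ i, fun ω : Fin n → ℝ => c i * ((ω i - s i) ^ 2 - σ i)) =
      fun y : Fin n → ℝ => ∑ i, c i * ((y i - s i) ^ 2 - σ i) := by
    ext y; simp
  have hmem : ∀ i, MemLp (fun y : Fin n → ℝ => c i * ((y i - s i) ^ 2 - σ i)) 2 (gaussLaw s σ) :=
    fun i => ((h0 i).1.comp_measurePreserving (measurePreserving_eval
      (fun i => gaussianReal (s i) (σ i).toNNReal) i)).const_mul (c i)
  have hm : MemLp (fun y : Fin n → ℝ => ∑ i, c i * ((y i - s i) ^ 2 - σ i)) 2 (gaussLaw s σ) :=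
    memLp_finsetSum _ fun i _ => hmem i
  have hz : ∫ y, ∑ i, c i * ((y i - s i) ^ 2 - σ i) ∂(gaussLaw s σ) = 0 := by
    rw [integral_finsetSum _ fun i _ => (hmem i).integrable (by simp)]
    refine Finset.sum_eq_zero fun i _ => ?_
    have := (h0 i).2.1
    rw [← map_eval_gaussLaw (s := s) (σ := σ), integral_map (by exact (measurable_pi_apply i).aemeasurable) (by fun_prop)] at this
    rw [integral_const_mul, this, mul_zero]
  refine ⟨hm.integrable_sq, ?_⟩
  rw [← variance_of_integral_eq_zero (Measurable.aemeasurable (by fun_prop)) hz]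
  rw [e] at h
  rw [gaussLaw, h, Finset.mul_sum]
  refine Finset.sum_le_sum fun i _ => ?_
  rw [variance_const_mul]
  nlinarith [(h0 i).2.2, sq_nonneg (c i)]

end Gaussian

/-! ### Block averages, and couples of neighbours inside a block. -/

section Blocks

variable {K k l : ℕ}

lemma mem_block {i j : Fin (2 ^ K)} : j ∈ block K k i ↔ blockIndex K k j = blockIndex K k i := by
  simp [block]

lemma block_congr {i j : Fin (2 ^ K)} (h : blockIndex K k j = blockIndex K k i) :
    block K k j = block K k i := by
  ext; simp [mem_block, h]

lemma blockIndex_eq_of_le (hkl : k ≤ l) (hl : l ≤ K) {i j : Fin (2 ^ K)}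
    (h : blockIndex K l j = blockIndex K l i) : blockIndex K k j = blockIndex K k i := by
  have e : 2 ^ (K - k) = 2 ^ (K - l) * 2 ^ (l - k) := by rw [← pow_add]; congr 1; omega
  unfold blockIndex at *
  rw [e, ← Nat.div_div_eq_div_mul, ← Nat.div_div_eq_div_mul, h]

lemma blockElt_lt (hk : k ≤ K) (i : Fin (2 ^ K)) {u : ℕ} (hu : u < 2 ^ (K - k)) :
    blockIndex K k i * 2 ^ (K - k) + u < 2 ^ K := by
  have e : 2 ^ K = 2 ^ k * 2 ^ (K - k) := by rw [← pow_add]; congr 1; omega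
  have h1 : blockIndex K k i < 2 ^ k := by
    unfold blockIndex
    rw [Nat.div_lt_iff_lt_mul (by positivity), ← e]
    exact i.2
  calc _ < (blockIndex K k i + 1) * 2 ^ (K - k) := by linarith
    _ ≤ 2 ^ k * 2 ^ (K - k) := Nat.mul_le_mul_right _ h1
    _ = _ := e.symm

lemma blockIndex_blockElt {b u : ℕ} (hu : u < 2 ^ (K - k)) (h : b * 2 ^ (K - k) + u < 2 ^ K) :
    blockIndex K k ⟨b * 2 ^ (K - k) + u, h⟩ = b := by
  unfold blockIndex
  dsimp only
  rw [Nat.mul_comm, Nat.mul_add_div (by positivity), Nat.div_eq_of_lt hu, add_zero]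

lemma card_block (hk : k ≤ K) (i : Fin (2 ^ K)) : (block K k i).card = 2 ^ (K - k) := by
  rw [← Finset.card_range (2 ^ (K - k))]
  symm
  refine Finset.card_bij (fun u hu => ⟨blockIndex K k i * 2 ^ (K - k) + u,
    blockElt_lt hk i (Finset.mem_range.1 hu)⟩) ?_ ?_ ?_
  · intro u hu
    rw [mem_block, blockIndex_blockElt (Finset.mem_range.1 hu)]
  · intro u hu v hv h
    simpa using h
  · intro j hj
    rw [mem_block] at hj
    refine ⟨(j : ℕ) % 2 ^ (K - k), Finset.mem_range.2 (Nat.mod_lt _ (by positivity)), ?_⟩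
    ext
    dsimp only
    rw [← hj]
    exact Nat.div_add_mod' _ _

/-- The mean of `y` on the block that contains `i`. -/
def blockAvg (K k : ℕ) (y : Fin (2 ^ K) → ℝ) (i : Fin (2 ^ K)) : ℝ :=
  (2 ^ (K - k))⁻¹ * ∑ j ∈ block K k i, y j

lemma blockAvg_congr {i j : Fin (2 ^ K)} (h : blockIndex K k j = blockIndex K k i)
    (y : Fin (2 ^ K) → ℝ) : blockAvg K k y j = blockAvg K k y i := by
  rw [blockAvg, block_congr h, blockAvg]

lemma blockAvg_add (y z : Fin (2 ^ K) → ℝ) (i : Fin (2 ^ K)) :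
    blockAvg K k (fun j => y j + z j) i = blockAvg K k y i + blockAvg K k z i := by
  simp only [blockAvg, Finset.sum_add_distrib, mul_add]

lemma blockAvg_sub (y z : Fin (2 ^ K) → ℝ) (i : Fin (2 ^ K)) :
    blockAvg K k (fun j => y j - z j) i = blockAvg K k y i - blockAvg K k z i := by
  simp only [blockAvg, Finset.sum_sub_distrib, mul_sub]

lemma blockAvg_const_mul (c : ℝ) (y : Fin (2 ^ K) → ℝ) (i : Fin (2 ^ K)) :
    blockAvg K k (fun j => c * y j) i = c * blockAvg K k y i := by
  simp only [blockAvg, ← Finset.mul_sum]; ring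

lemma blockAvg_const (hk : k ≤ K) (c : ℝ) (i : Fin (2 ^ K)) :
    blockAvg K k (fun _ => c) i = c := by
  simp [blockAvg, card_block hk]

lemma blockAvg_le_of_le (hk : k ≤ K) {y : Fin (2 ^ K) → ℝ} {c : ℝ} {i : Fin (2 ^ K)}
    (h : ∀ j, blockIndex K k j = blockIndex K k i → y j ≤ c) : blockAvg K k y i ≤ c := by
  rw [← blockAvg_const hk c i]
  exact mul_le_mul_of_nonneg_left (Finset.sum_le_sum fun j hj => h j (mem_block.1 hj))
    (by positivity)

lemma blockAvg_nonneg {y : Fin (2 ^ K) → ℝ} (h : ∀ j, 0 ≤ y j) (i : Fin (2 ^ K)) :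
    0 ≤ blockAvg K k y i :=
  mul_nonneg (by positivity) (Finset.sum_nonneg fun j _ => h j)

lemma blockAvg_sq_le (hk : k ≤ K) (y : Fin (2 ^ K) → ℝ) (i : Fin (2 ^ K)) :
    blockAvg K k y i ^ 2 ≤ blockAvg K k (fun j => y j ^ 2) i := by
  have h := sq_sum_le_card_mul_sum_sq (s := block K k i) (f := y)
  rw [card_block hk] at h
  push_cast at h
  unfold blockAvg
  rw [mul_pow]
  calc _ ≤ ((2 ^ (K - k))⁻¹ : ℝ) ^ 2 * (2 ^ (K - k) * ∑ j ∈ block K k i, y j ^ 2) := by gcongr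
    _ = _ := by field_simp

lemma abs_sub_blockAvg_le (hk : k ≤ K) {y : Fin (2 ^ K) → ℝ} {A : ℝ} {i : Fin (2 ^ K)}
    (h : ∀ j, blockIndex K k j = blockIndex K k i → |y i - y j| ≤ A) :
    |y i - blockAvg K k y i| ≤ A := by
  rw [abs_le]
  constructor
  · have := blockAvg_le_of_le (y := y) (c := y i + A) hk
      (fun j hj => by linarith [(abs_le.1 (h j hj)).1])
    linarith
  · have := blockAvg_le_of_le (y := fun j => (-1) * y j) (c := -(y i - A)) hk
      (fun j hj => by linarith [(abs_le.1 (h j hj)).2])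
    rw [blockAvg_const_mul] at this
    linarith

/-- Double counting: each `z j` enters the averages of the `2 ^ (K - k)` indices of its block,
always with the same weight `g j`. -/
lemma sum_mul_blockAvg_of_const (hk : k ≤ K) {g : Fin (2 ^ K) → ℝ}
    (hg : ∀ i j, blockIndex K k j = blockIndex K k i → g j = g i) (z : Fin (2 ^ K) → ℝ) :
    ∑ i, g i * blockAvg K k z i = ∑ i, g i * z i := by
  have h1 : ∀ i, g i * blockAvg K k z i = ∑ j, (2 ^ (K - k))⁻¹ *
      (if blockIndex K k j = blockIndex K k i then g j * z j else 0) := by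
    intro i
    rw [← Finset.mul_sum, ← Finset.sum_filter, blockAvg, mul_left_comm, Finset.mul_sum]
    congr 1
    refine Finset.sum_congr rfl fun j hj => ?_
    rw [hg i j (mem_block.1 hj)]
  simp only [h1]
  rw [Finset.sum_comm]
  refine Finset.sum_congr rfl fun j _ => ?_
  have h2 : ∑ i, (if blockIndex K k j = blockIndex K k i then g j * z j else 0) =
      2 ^ (K - k) * (g j * z j) := by
    rw [← Finset.sum_filter, Finset.sum_const, nsmul_eq_mul]
    congr 1
    have := card_block hk j
    rw [block] at this
    simp only [eq_comm (a := blockIndex K k j)]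
    rw [this]; push_cast; rfl
  rw [← Finset.mul_sum, h2]
  field_simp

/-- `blockAvg` is self-adjoint and idempotent for the weights that are constant on the blocks. -/
lemma sum_mul_mul_blockAvg (hk : k ≤ K) {w : Fin (2 ^ K) → ℝ}
    (hw : ∀ i j, blockIndex K k j = blockIndex K k i → w j = w i) (x z : Fin (2 ^ K) → ℝ) :
    ∑ i, w i * (x i * blockAvg K k z i) =
      ∑ i, w i * (blockAvg K k x i * blockAvg K k z i) := by
  have := sum_mul_blockAvg_of_const hk (g := fun i => w i * blockAvg K k z i)
    (fun i j h => by rw [hw i j h, blockAvg_congr h]) x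
  simp only [mul_assoc] at this
  rw [Finset.sum_congr rfl fun i _ => by rw [mul_comm (x i)], ← this]
  exact Finset.sum_congr rfl fun i _ => by ring

lemma blockAvg_sub_blockAvg (hk : k ≤ K) (y : Fin (2 ^ K) → ℝ) (i : Fin (2 ^ K)) :
    blockAvg K k (fun j => y j - blockAvg K k y j) i = 0 := by
  rw [blockAvg_sub, sub_eq_zero]
  conv_rhs => rw [blockAvg, Finset.sum_congr rfl fun j hj => blockAvg_congr (mem_block.1 hj) y]
  simp [card_block hk]

lemma proj_eq_blockAvg (m : ℕ × ℕ) (hm : m.1 + m.2 ≤ K) (y : Fin (2 ^ K) → ℝ) :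
    proj K m y = blockAvg K (m.1 + m.2) y := by
  have h : (pcSpace K (m.1 + m.2)).starProjection (WithLp.toLp 2 y) =
      WithLp.toLp 2 (blockAvg K (m.1 + m.2) y) := by
    refine Submodule.eq_starProjection_of_mem_of_inner_eq_zero ?_ ?_
    -- The average depends on the block number only; its extension by 0 to all naturals provides the
    -- coefficients.
    · refine ⟨Function.extend (blockIndex K (m.1 + m.2)) (blockAvg K (m.1 + m.2) y) 0, fun i => ?_⟩
      have hft : Function.FactorsThrough (blockAvg K (m.1 + m.2) y)
        (blockIndex K (m.1 + m.2)) := fun i j h => blockAvg_congr h y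
      exact (hft.extend_apply 0 i).symm
    · rintro w ⟨f, hf⟩
      have := sum_mul_blockAvg_of_const hm (g := fun i => w i)
        (fun i j h => by rw [hf, hf, h]) y
      simp only [PiLp.inner_apply, PiLp.sub_apply, RCLike.inner_apply, conj_trivial, mul_sub,
        Finset.sum_sub_distrib]
      rw [this, sub_self]
  ext i
  rw [proj, h]

lemma varEst_eq (m : ℕ × ℕ) (hm : m.1 + m.2 ≤ K) (y : Fin (2 ^ K) → ℝ) (i : Fin (2 ^ K)) :
    varEst K m y i =
      blockAvg K m.1 (fun j => (y j - blockAvg K (m.1 + m.2) y j) ^ 2) i := by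
  rw [varEst, card_block (by omega), blockAvg, proj_eq_blockAvg m hm]
  simp

lemma varEst_congr {m : ℕ × ℕ} {i j : Fin (2 ^ K)}
    (h : blockIndex K m.1 j = blockIndex K m.1 i) (y : Fin (2 ^ K) → ℝ) :
    varEst K m y j = varEst K m y i := by
  rw [varEst, varEst, block_congr h]

lemma varEst_nonneg (m : ℕ × ℕ) (y : Fin (2 ^ K) → ℝ) (i : Fin (2 ^ K)) : 0 ≤ varEst K m y i := by
  unfold varEst
  exact mul_nonneg (by positivity) (Finset.sum_nonneg fun j _ => sq_nonneg _)

lemma measurable_blockAvg_apply (i : Fin (2 ^ K)) : Measurable fun y => blockAvg K k y i := by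
  unfold blockAvg; fun_prop

lemma measurable_proj (m : ℕ × ℕ) : Measurable (proj K m) := by
  unfold proj
  refine measurable_pi_lambda _ fun i => ?_
  have : Continuous fun y : Fin (2 ^ K) → ℝ =>
      (pcSpace K (m.1 + m.2)).starProjection (WithLp.toLp 2 y) i := by fun_prop
  exact this.measurable

lemma measurable_varEst (m : ℕ × ℕ) : Measurable (varEst K m) := by
  unfold varEst
  have h := measurable_proj (K := K) m
  refine measurable_pi_lambda _ fun i => ?_
  refine Measurable.const_mul (Finset.measurable_fun_sum _ fun j _ => ?_) _
  exact ((measurable_pi_apply j).sub ((measurable_pi_apply j).comp h)).pow_const 2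

/-- Inside a block, the couples of neighbours `(2 u, 2 u + 1)`. -/
def pairElt (hk : k < K) (i : Fin (2 ^ K)) : Fin (2 ^ (K - k - 1)) ⊕ Fin (2 ^ (K - k - 1)) →
    Fin (2 ^ K) :=
  have h (u : Fin (2 ^ (K - k - 1))) (e : ℕ) (he : e ≤ 1) : 2 * (u : ℕ) + e < 2 ^ (K - k) := by
    have : 2 ^ (K - k) = 2 * 2 ^ (K - k - 1) := by rw [← pow_succ']; congr 1; omega
    omega
  Sum.elim (fun u => ⟨_, blockElt_lt hk.le i (h u 0 (by omega))⟩)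
    (fun u => ⟨_, blockElt_lt hk.le i (h u 1 le_rfl)⟩)

lemma pairElt_injective (hk : k < K) (i : Fin (2 ^ K)) : Function.Injective (pairElt hk i) := by
  rintro (u | u) (v | v) h <;> simp only [pairElt, Sum.elim_inl, Sum.elim_inr, Fin.mk.injEq] at h
  · congr 1; ext; omega
  · omega
  · omega
  · congr 1; ext; omega

lemma pairElt_mem_block (hk : k < K) (i : Fin (2 ^ K))
    (u : Fin (2 ^ (K - k - 1)) ⊕ Fin (2 ^ (K - k - 1))) : pairElt hk i u ∈ block K k i := by
  have : 2 ^ (K - k) = 2 * 2 ^ (K - k - 1) := by rw [← pow_succ']; congr 1; omega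
  rw [mem_block]
  rcases u with u | u
  · exact blockIndex_blockElt (by have := u.2; omega) _
  · exact blockIndex_blockElt (by have := u.2; omega) _

/-- In zero-based numbering, blocks of even size start at even positions, so no block cuts a couple
`(2 u, 2 u + 1)`. -/
lemma blockIndex_pairElt (hk : k < K) (hl : l < K) (i : Fin (2 ^ K))
    (u : Fin (2 ^ (K - k - 1))) :
    blockIndex K l (pairElt hk i (Sum.inr u)) = blockIndex K l (pairElt hk i (Sum.inl u)) := by
  have h1 : 2 ^ (K - k) = 2 * 2 ^ (K - k - 1) := by rw [← pow_succ']; congr 1; omega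
  have h2 : 2 ^ (K - l) = 2 * 2 ^ (K - l - 1) := by rw [← pow_succ']; congr 1; omega
  simp only [pairElt, blockIndex, Sum.elim_inl, Sum.elim_inr]
  rw [h2, ← Nat.div_div_eq_div_mul, ← Nat.div_div_eq_div_mul, h1]
  congr 1
  rw [mul_left_comm]
  omega

/-- The fitted value is the same at both ends of a couple and cancels in the difference of the
residuals. This minorant involves neither the fit nor the law of a noncentral quadratic form, only
independent Gaussian differences. -/
lemma sum_pair_sq_le_varEst (m : ℕ × ℕ) (hm : m.1 + m.2 < K) (y : Fin (2 ^ K) → ℝ)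
    (i : Fin (2 ^ K)) :
    (4 * 2 ^ (K - m.1 - 1))⁻¹ * ∑ u : Fin (2 ^ (K - m.1 - 1)),
      (y (pairElt (k := m.1) (by omega) i (Sum.inl u)) -
        y (pairElt (k := m.1) (by omega) i (Sum.inr u))) ^ 2 ≤ varEst K m y i := by
  have hk : m.1 < K := by omega
  rw [varEst_eq m hm.le, blockAvg]
  set f : Fin (2 ^ K) → ℝ := fun j => (y j - blockAvg K (m.1 + m.2) y j) ^ 2 with hf
  have h1 : ∑ u, f (pairElt hk i u) ≤ ∑ j ∈ block K m.1 i, f j := by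
    rw [← Finset.sum_image (f := f) (s := Finset.univ) (g := pairElt hk i)
      (fun a _ b _ h => pairElt_injective hk i h)]
    refine Finset.sum_le_sum_of_subset_of_nonneg ?_ fun j _ _ => sq_nonneg _
    intro j hj
    obtain ⟨u, _, rfl⟩ := Finset.mem_image.1 hj
    exact pairElt_mem_block hk i u
  rw [Fintype.sum_sum_type, ← Finset.sum_add_distrib] at h1
  have h2 : (2 : ℝ) ^ (K - m.1) = 2 * 2 ^ (K - m.1 - 1) := by rw [← pow_succ']; congr 1; omega
  have h3 : ∑ u : Fin (2 ^ (K - m.1 - 1)),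
      (y (pairElt hk i (Sum.inl u)) - y (pairElt hk i (Sum.inr u))) ^ 2 ≤
      2 * ∑ j ∈ block K m.1 i, f j := by
    refine le_trans ?_ (mul_le_mul_of_nonneg_left h1 (by norm_num))
    rw [Finset.mul_sum]
    refine Finset.sum_le_sum fun u _ => ?_
    simp only [hf]
    rw [blockAvg_congr (blockIndex_pairElt hk hm i u) y]
    set a := blockAvg K (m.1 + m.2) y (pairElt hk i (Sum.inl u))
    -- For residuals `p` and `q`, `(p - q) ^ 2 ≤ 2 (p ^ 2 + q ^ 2)`.
    nlinarith [sq_nonneg ((y (pairElt hk i (Sum.inl u)) - a) +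
      (y (pairElt hk i (Sum.inr u)) - a))]
  rw [h2]
  calc _ ≤ ((4 * 2 ^ (K - m.1 - 1))⁻¹ : ℝ) * (2 * ∑ j ∈ block K m.1 i, f j) := by gcongr
    _ = _ := by field_simp; ring

end Blocks

/-! ### Small values of sums of squared differences of disjoint couples. -/

section Pairs

variable {n : ℕ} {s σ : Fin n → ℝ} {τ : ℝ}

lemma variance_eval (hσ : ∀ i, 0 ≤ σ i) (i : Fin n) :
    Var[fun y : Fin n → ℝ => y i; gaussLaw s σ] = σ i := by
  have h := variance_map (μ := gaussLaw s σ) (X := id) (Y := fun y : Fin n → ℝ => y i)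
    aemeasurable_id (measurable_pi_apply i).aemeasurable
  rw [map_eval_gaussLaw, variance_id_gaussianReal, Real.coe_toNNReal _ (hσ i)] at h
  exact h.symm

lemma covariance_eval {i j : Fin n} (hij : i ≠ j) :
    cov[fun y : Fin n → ℝ => y i, fun y => y j; gaussLaw s σ] = 0 :=
  (iIndepFun_eval.indepFun hij).covariance_eq_zero (hasGaussianLaw_eval i).memLp_two
    (hasGaussianLaw_eval j).memLp_two

/-- A Gaussian density of variance at least 2 is bounded by 1, whatever the mean; this removes the
unknown bias from the later bounds. -/
lemma lintegral_gaussianReal_le {v : NNReal} (hv : 2 ≤ v) (m : ℝ) (f : ℝ → ENNReal)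
    (hf : Measurable f) : ∫⁻ x, f x ∂(gaussianReal m v) ≤ ∫⁻ x, f x := by
  have hv0 : v ≠ 0 := by rintro rfl; simp at hv
  rw [gaussianReal_of_var_ne_zero _ hv0, lintegral_withDensity_eq_lintegral_mul _
    (measurable_gaussianPDF _ _) hf]
  refine lintegral_mono fun x => ?_
  rw [Pi.mul_apply]
  refine mul_le_of_le_one_left zero_le ?_
  rw [gaussianPDF, ENNReal.ofReal_le_one, gaussianPDFReal]
  have hv' : (2 : ℝ) ≤ v := by exact_mod_cast hv
  refine mul_le_one₀ (inv_le_one_of_one_le₀ ?_) (Real.exp_pos _).le ?_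
  · rw [Real.one_le_sqrt]
    nlinarith [Real.pi_gt_three]
  · rw [Real.exp_le_one_iff]
    exact div_nonpos_of_nonpos_of_nonneg (neg_nonpos.2 (sq_nonneg _)) (by positivity)

/-- The normalized difference has variance `(σ a + σ b) / τ ≥ 2`. Its mean is left unspecified
because only the bound on the density is used. -/
lemma exists_map_pair (hτ : 0 < τ) (hσ : ∀ i, τ ≤ σ i) {a b : Fin n} (hab : a ≠ b) :
    ∃ (m : ℝ) (v : NNReal), 2 ≤ v ∧
      (gaussLaw s σ).map (fun y => (√τ)⁻¹ * (y a - y b)) = gaussianReal m v := by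
  have hg : HasGaussianLaw (fun y : Fin n → ℝ => (√τ)⁻¹ * (y a - y b)) (gaussLaw s σ) :=
    hasGaussianLaw_gaussLaw.map_fun ((√τ)⁻¹ •
      (ContinuousLinearMap.proj (R := ℝ) (φ := fun _ : Fin n => ℝ) a -
        ContinuousLinearMap.proj (R := ℝ) b))
  refine ⟨_, _, ?_, hg.map_eq_gaussianReal⟩
  rw [variance_const_mul, variance_fun_sub (hasGaussianLaw_eval a).memLp_two
    (hasGaussianLaw_eval b).memLp_two, covariance_eval hab,
    variance_eval fun i => hτ.le.trans (hσ i), variance_eval fun i => hτ.le.trans (hσ i),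
    inv_pow, Real.sq_sqrt hτ.le]
  refine NNReal.le_toNNReal_of_coe_le ?_
  rw [inv_mul_eq_div, le_div_iff₀ hτ]
  push_cast
  linarith [hσ a, hσ b]

lemma lintegral_pair_le (hτ : 0 < τ) (hσ : ∀ i, τ ≤ σ i) {a b : Fin n} (hab : a ≠ b)
    {f g : ℝ → ENNReal} (hf : Measurable f) (hg : Measurable g) (hfg : ∀ x, f x ≤ 1 + g x) :
    ∫⁻ y, f ((√τ)⁻¹ * (y a - y b)) ∂(gaussLaw s σ) ≤ 1 + ∫⁻ x, g x := by
  obtain ⟨m, v, hv, h⟩ := exists_map_pair (s := s) hτ hσ hab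
  calc _ = ∫⁻ x, f x ∂(gaussianReal m v) := by
        rw [← h, lintegral_map hf (by fun_prop)]
    _ ≤ ∫⁻ x, 1 + g x ∂(gaussianReal m v) := lintegral_mono hfg
    _ = 1 + ∫⁻ x, g x ∂(gaussianReal m v) := by
        rw [lintegral_add_left measurable_const]; simp
    _ ≤ _ := by exact add_le_add le_rfl (lintegral_gaussianReal_le hv m g hg)

lemma lintegral_pair_le' (hτ : 0 < τ) (hσ : ∀ i, τ ≤ σ i) {a b : Fin n} (hab : a ≠ b)
    {f : ℝ → ENNReal} (hf : Measurable f) :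
    ∫⁻ y, f ((√τ)⁻¹ * (y a - y b)) ∂(gaussLaw s σ) ≤ ∫⁻ x, f x := by
  obtain ⟨m, v, hv, h⟩ := exists_map_pair (s := s) hτ hσ hab
  calc _ = ∫⁻ x, f x ∂(gaussianReal m v) := by
        rw [← h, lintegral_map hf (by fun_prop)]
    _ ≤ _ := lintegral_gaussianReal_le hv m f hf

/-- The differences are jointly Gaussian, and they are uncorrelated because injectivity of `p` makes
the couples disjoint. -/
lemma iIndepFun_pairs {M : ℕ} {p : Fin M ⊕ Fin M → Fin n} (hp : Function.Injective p) (c : ℝ) :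
    iIndepFun (fun (u : Fin M) (y : Fin n → ℝ) => c * (y (p (Sum.inl u)) - y (p (Sum.inr u))))
      (gaussLaw s σ) := by
  have hg : HasGaussianLaw (fun (y : Fin n → ℝ) (u : Fin M) =>
      c * (y (p (Sum.inl u)) - y (p (Sum.inr u)))) (gaussLaw s σ) :=
    hasGaussianLaw_gaussLaw.map_fun (ContinuousLinearMap.pi fun u : Fin M => c •
      (ContinuousLinearMap.proj (R := ℝ) (φ := fun _ : Fin n => ℝ) (p (Sum.inl u)) -
        ContinuousLinearMap.proj (R := ℝ) (p (Sum.inr u))))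
  refine hg.iIndepFun_of_covariance_eq_zero fun u v huv => ?_
  have h2 : ∀ i, MemLp (fun y : Fin n → ℝ => y i) 2 (gaussLaw s σ) :=
    fun i => (hasGaussianLaw_eval i).memLp_two
  rw [covariance_const_mul_left, covariance_const_mul_right,
    covariance_fun_sub_fun_sub (h2 _) (h2 _) (h2 _) (h2 _)]
  rw [covariance_eval, covariance_eval, covariance_eval, covariance_eval]
  · ring
  all_goals
    intro h
    have := hp h
    simp_all

lemma lintegral_prod_pairs_le {M : ℕ} {p : Fin M ⊕ Fin M → Fin n} (hp : Function.Injective p)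
    {f : ℝ → ENNReal} (hf : Measurable f) {R : ENNReal}
    (hR : ∀ u : Fin M, ∫⁻ y, f ((√τ)⁻¹ * (y (p (Sum.inl u)) - y (p (Sum.inr u))))
      ∂(gaussLaw s σ) ≤ R) :
    ∫⁻ y, ∏ u : Fin M, f ((√τ)⁻¹ * (y (p (Sum.inl u)) - y (p (Sum.inr u))))
      ∂(gaussLaw s σ) ≤ R ^ M := by
  have h := lintegral_prod_eq_prod_lintegral_of_indepFun (μ := gaussLaw s σ) Finset.univ
    (fun (u : Fin M) (y : Fin n → ℝ) => f ((√τ)⁻¹ * (y (p (Sum.inl u)) - y (p (Sum.inr u)))))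
    ((iIndepFun_pairs hp _).comp (fun _ => f) fun _ => hf) (fun u => by fun_prop)
  rw [h]
  calc _ ≤ ∏ _u : Fin M, R := Finset.prod_le_prod' fun u _ => hR u
    _ = _ := by simp

/-- The squared differences of `M` disjoint couples have a small sum with small probability. -/
lemma measure_sum_pair_sq_lt_le {M : ℕ} (hτ : 0 < τ) (hσ : ∀ i, τ ≤ σ i)
    {p : Fin M ⊕ Fin M → Fin n} (hp : Function.Injective p) {x : ℝ} (hx : 0 < x) :
    gaussLaw s σ {y | ∑ u : Fin M, (y (p (Sum.inl u)) - y (p (Sum.inr u))) ^ 2 < x * M * τ} ≤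
      ENNReal.ofReal ((Real.exp 1 * √(Real.pi * x)) ^ M) := by
  -- Chernoff: on the event, the product of the `f` at the normalized differences is at least 1. Its
  -- mean is at most the `M`-th power of the Lebesgue integral of `f`, which is `exp 1 * √(π x)`.
  set f : ℝ → ENNReal := fun z => ENNReal.ofReal (Real.exp (1 - (1 / x) * z ^ 2)) with hf
  have hfm : Measurable f := by fun_prop
  have hfi : ∫⁻ z, f z = ENNReal.ofReal (Real.exp 1 * √(Real.pi * x)) := by
    have e : ∀ z : ℝ, Real.exp (1 - (1 / x) * z ^ 2) = Real.exp 1 * Real.exp (-(1 / x) * z ^ 2) := by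
      intro z; rw [← Real.exp_add]; ring_nf
    simp only [hf, e]
    rw [← ofReal_integral_eq_lintegral_ofReal
      ((integrable_exp_neg_mul_sq (by positivity)).const_mul _)
      (Filter.Eventually.of_forall fun z => by positivity), integral_const_mul, integral_gaussian]
    simp
  have h := lintegral_prod_pairs_le (s := s) (σ := σ) (τ := τ) hp hfm
    (fun u => lintegral_pair_le' hτ hσ (fun h => by simpa using hp h) hfm)
  rw [hfi, ← ENNReal.ofReal_pow (by positivity)] at h
  refine le_trans ?_ h
  rw [← lintegral_indicator_one (measurableSet_lt (by fun_prop) (by fun_prop))]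
  refine lintegral_mono fun y => ?_
  by_cases hy : ∑ u : Fin M, (y (p (Sum.inl u)) - y (p (Sum.inr u))) ^ 2 < x * M * τ
  swap
  · rw [Set.indicator_of_notMem (by exact hy)]
    exact bot_le
  rw [Set.indicator_of_mem (by exact hy)]
  simp only [hf, Pi.one_apply]
  rw [← ENNReal.ofReal_prod_of_nonneg fun i _ => (Real.exp_pos _).le, ← Real.exp_sum,
    ENNReal.one_le_ofReal, Real.one_le_exp_iff, Finset.sum_sub_distrib, ← Finset.mul_sum]
  simp only [mul_pow, ← Finset.mul_sum, inv_pow, Real.sq_sqrt hτ.le]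
  simp only [Finset.sum_const, Finset.card_univ, Fintype.card_fin, nsmul_eq_mul, mul_one]
  rw [sub_nonneg, one_div, ← mul_assoc, ← mul_inv, inv_mul_le_iff₀ (by positivity)]
  linarith

/-- The function `|x| ^ (-3/4)`, with the value `∞` at `0`. -/
def invRoot (x : ℝ) : ENNReal := ENNReal.ofReal |x| ^ (-(3 / 4) : ℝ)

lemma measurable_invRoot : Measurable invRoot := by unfold invRoot; fun_prop

/-- A bound of the moments `E |Z| ^ (-3/4)` for the Gaussian variables with a variance `≥ 2`. -/
def invRootBound : ENNReal := 1 + ∫⁻ x in Set.Icc (-1 : ℝ) 1, invRoot x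

lemma invRootBound_lt_top : invRootBound < ⊤ := by
  refine ENNReal.add_lt_top.2 ⟨ENNReal.one_lt_top, ?_⟩
  have h1 : IntervalIntegrable (fun x : ℝ => x ^ (-(3 / 4) : ℝ)) volume 0 1 :=
    intervalIntegral.intervalIntegrable_rpow' (by norm_num)
  have h3 : ∫⁻ x in Set.Ioc (0 : ℝ) 1, invRoot x < ⊤ := by
    have := ((intervalIntegrable_iff_integrableOn_Ioc_of_le zero_le_one).1 h1).2
    refine lt_of_le_of_lt (le_of_eq ?_) this
    refine setLIntegral_congr_fun measurableSet_Ioc fun x hx => ?_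
    dsimp only [invRoot]
    rw [abs_of_pos hx.1, ENNReal.ofReal_rpow_of_pos hx.1,
      Real.enorm_of_nonneg (Real.rpow_nonneg hx.1.le _)]
  have h4 : ∫⁻ x in Set.Ico (-1 : ℝ) 0, invRoot x < ⊤ := by
    have hmp : MeasurePreserving (fun x : ℝ => -x) volume volume :=
      Measure.measurePreserving_neg _
    have := hmp.setLIntegral_comp_preimage (s := Set.Ioc (0 : ℝ) 1) measurableSet_Ioc
      measurable_invRoot
    have e : (fun x : ℝ => -x) ⁻¹' Set.Ioc (0 : ℝ) 1 = Set.Ico (-1 : ℝ) 0 := by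
      ext x; simp [neg_le, and_comm]
    rw [e] at this
    simp only [invRoot, abs_neg] at this h3 ⊢
    rw [this]
    exact h3
  have hsub : (Set.Icc (-1 : ℝ) 1) ⊆ (Set.Ico (-1 : ℝ) 0 ∪ Set.Ioc (0 : ℝ) 1) ∪ {0} := by
    intro x hx
    rcases lt_trichotomy x 0 with h | h | h
    · exact Or.inl (Or.inl ⟨hx.1, h⟩)
    · exact Or.inr h
    · exact Or.inl (Or.inr ⟨h, hx.2⟩)
  calc _ ≤ _ := lintegral_mono_set hsub
    _ ≤ _ := lintegral_union_le _ _ _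
    _ ≤ _ := add_le_add (lintegral_union_le _ _ _) le_rfl
    _ < ⊤ := by
      simp only [Measure.restrict_singleton, Real.volume_singleton, zero_smul,
        lintegral_zero_measure, add_zero]
      exact ENNReal.add_lt_top.2 ⟨h4, h3⟩

/-- Outside `[-1, 1]` the function is at most 1; inside, the density is at most 1, and the exponent
`-3/4 > -1` is integrable. -/
lemma lintegral_invRoot_pair_le (hτ : 0 < τ) (hσ : ∀ i, τ ≤ σ i) {a b : Fin n} (hab : a ≠ b) :
    ∫⁻ y, invRoot ((√τ)⁻¹ * (y a - y b)) ∂(gaussLaw s σ) ≤ invRootBound := by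
  rw [invRootBound, ← lintegral_indicator measurableSet_Icc]
  refine lintegral_pair_le hτ hσ hab measurable_invRoot
    (measurable_invRoot.indicator measurableSet_Icc) fun x => ?_
  by_cases hx : x ∈ Set.Icc (-1 : ℝ) 1
  · rw [Set.indicator_of_mem hx]; exact le_add_self
  · rw [Set.indicator_of_notMem hx, add_zero, invRoot, ENNReal.rpow_neg]
    refine ENNReal.inv_le_one.2 (ENNReal.one_le_rpow ?_ (by norm_num))
    rw [ENNReal.one_le_ofReal]
    by_contra h
    exact hx (abs_le.1 (not_le.1 h).le)

/-- The moment of order `-3/2` of the sum of the squared differences of four couples. -/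
lemma lintegral_sum_pair_sq_rpow_le {M : ℕ} (hM : 4 ≤ M) (hτ : 0 < τ) (hσ : ∀ i, τ ≤ σ i)
    {p : Fin M ⊕ Fin M → Fin n} (hp : Function.Injective p) :
    ∫⁻ y, ENNReal.ofReal (τ⁻¹ * ∑ u : Fin M, (y (p (Sum.inl u)) - y (p (Sum.inr u))) ^ 2) ^
      (-(3 / 2) : ℝ) ∂(gaussLaw s σ) ≤ invRootBound ^ 4 := by
  -- Four couples suffice: `S ^ (-3/2) = (√S) ^ (-3)` is split into four factors `(√S) ^ (-3/4)`,
  -- each at most `|z u| ^ (-3/4)`.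
  set p' : Fin 4 ⊕ Fin 4 → Fin n := fun u => p (Sum.map (Fin.castLE hM) (Fin.castLE hM) u)
  have hp' : Function.Injective p' := hp.comp
    (Function.Injective.sumMap (Fin.castLE_injective hM) (Fin.castLE_injective hM))
  refine le_trans (lintegral_mono fun y => ?_) (lintegral_prod_pairs_le (s := s) (σ := σ) (τ := τ)
    hp' measurable_invRoot (fun u => lintegral_invRoot_pair_le hτ hσ fun h => by
      simpa using hp' h))
  set z : Fin 4 → ℝ := fun u => (√τ)⁻¹ * (y (p' (Sum.inl u)) - y (p' (Sum.inr u)))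
  set S : ℝ := τ⁻¹ * ∑ u : Fin M, (y (p (Sum.inl u)) - y (p (Sum.inr u))) ^ 2 with hS
  have hz : ∀ u, |z u| ≤ √S := by
    intro u
    refine Real.abs_le_sqrt ?_
    rw [hS, Finset.mul_sum]
    refine le_trans (le_of_eq ?_) (Finset.single_le_sum
      (f := fun u => τ⁻¹ * (y (p (Sum.inl u)) - y (p (Sum.inr u))) ^ 2)
      (fun v _ => by positivity) (Finset.mem_univ (Fin.castLE hM u)))
    simp only [z, mul_pow, inv_pow, Real.sq_sqrt hτ.le]
    rfl
  have h1 : ∀ u, ENNReal.ofReal (√S) ^ (-(3 / 4) : ℝ) ≤ invRoot (z u) := fun u => by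
    rw [invRoot, ENNReal.rpow_neg, ENNReal.rpow_neg, ENNReal.inv_le_inv]
    exact ENNReal.rpow_le_rpow (ENNReal.ofReal_le_ofReal (hz u)) (by norm_num)
  have h2 : ENNReal.ofReal S ^ (-(3 / 2) : ℝ) =
      ∏ _u : Fin 4, ENNReal.ofReal (√S) ^ (-(3 / 4) : ℝ) := by
    have hS0 : 0 ≤ S := by positivity
    rw [Finset.prod_const, Finset.card_univ, Fintype.card_fin, ← ENNReal.rpow_natCast,
      ← ENNReal.rpow_mul, Real.sqrt_eq_rpow,
      ← ENNReal.ofReal_rpow_of_nonneg hS0 (by norm_num), ← ENNReal.rpow_mul]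
    norm_num
  rw [h2]
  exact Finset.prod_le_prod' fun u _ => h1 u

end Pairs

/-! ### Quadratic risk and lower tail of the variance estimators. -/

section VarEst

variable {K k : ℕ} {s σ : Fin (2 ^ K) → ℝ} {τ γ : ℝ}

/-- The weights of the mean on the block that contains `i`. -/
def blockWeight (K k : ℕ) (i j : Fin (2 ^ K)) : ℝ :=
  if j ∈ block K k i then (2 ^ (K - k))⁻¹ else 0

lemma blockAvg_eq_sum (z : Fin (2 ^ K) → ℝ) (i : Fin (2 ^ K)) :
    blockAvg K k z i = ∑ j, blockWeight K k i j * z j := by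
  simp [blockAvg, blockWeight, Finset.mul_sum]

lemma blockWeight_nonneg (i j : Fin (2 ^ K)) : 0 ≤ blockWeight K k i j := by
  unfold blockWeight; positivity

lemma sum_blockWeight_sq (hk : k ≤ K) (i : Fin (2 ^ K)) :
    ∑ j, blockWeight K k i j ^ 2 = (2 ^ (K - k))⁻¹ := by
  have : ∀ j, blockWeight K k i j ^ 2 = (2 ^ (K - k))⁻¹ * blockWeight K k i j := by
    intro j; unfold blockWeight; split_ifs <;> ring
  simp only [this, ← Finset.mul_sum]
  have h := blockAvg_const hk 1 i
  rw [blockAvg_eq_sum] at h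
  simp only [mul_one] at h
  rw [h, mul_one]

lemma sum_blockWeight_sq_mul_le (hk : k ≤ K) {z : Fin (2 ^ K) → ℝ} {c : ℝ} (hz : ∀ j, z j ≤ c)
    (i : Fin (2 ^ K)) : ∑ j, blockWeight K k i j ^ 2 * z j ≤ c * (2 ^ (K - k))⁻¹ := by
  rw [← sum_blockWeight_sq hk i, Finset.mul_sum]
  exact Finset.sum_le_sum fun j _ => by nlinarith [hz j, sq_nonneg (blockWeight K k i j)]

/-- The coarse weights are constant on the fine blocks, hence commute with the fine projection. This
kills the product of the bias with the projected noise and turns that of the noise with its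
projection into a square. -/
lemma varEst_eq_sum (m : ℕ × ℕ) (hm : m.1 + m.2 ≤ K) (s y : Fin (2 ^ K) → ℝ) (i : Fin (2 ^ K)) :
    varEst K m y i =
      blockAvg K m.1 (fun j => (s j - blockAvg K (m.1 + m.2) s j) ^ 2) i +
      2 * ∑ j, blockWeight K m.1 i j * (s j - blockAvg K (m.1 + m.2) s j) * (y j - s j) +
      blockAvg K m.1 (fun j => (y j - s j) ^ 2) i -
      blockAvg K m.1 (fun j => blockAvg K (m.1 + m.2) (fun l => y l - s l) j ^ 2) i := by
  set w := blockWeight K m.1 i with hw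
  set P := blockAvg K (m.1 + m.2)
  set e : Fin (2 ^ K) → ℝ := fun j => y j - s j with he
  set b : Fin (2 ^ K) → ℝ := fun j => s j - P s j with hb
  have hwc : ∀ i j, blockIndex K (m.1 + m.2) j = blockIndex K (m.1 + m.2) i → w j = w i := by
    intro i' j h
    have := blockIndex_eq_of_le (Nat.le_add_right m.1 m.2) hm h
    simp only [hw, blockWeight, mem_block, this]
  have h1 := sum_mul_mul_blockAvg hm hwc e e
  have h2 := sum_mul_mul_blockAvg hm hwc b e
  have h3 : ∀ j, P b j = 0 := blockAvg_sub_blockAvg hm s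
  have h4 : ∀ j, P y j = P s j + P e j := fun j => by
    rw [← blockAvg_add]; simp only [he, add_sub_cancel]; rfl
  change ∑ j, w j * (b j * P e j) = ∑ j, w j * (P b j * P e j) at h2
  change ∑ j, w j * (e j * P e j) = ∑ j, w j * (P e j * P e j) at h1
  simp only [h3, zero_mul, mul_zero, Finset.sum_const_zero] at h2
  rw [varEst_eq m hm]
  simp only [blockAvg_eq_sum (k := m.1)]
  have h5 : ∀ j, w j * (y j - P y j) ^ 2 = w j * b j ^ 2 + 2 * (w j * b j * e j) +
      w j * e j ^ 2 - 2 * (w j * (e j * P e j)) - 2 * (w j * (b j * P e j)) +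
      w j * (P e j * P e j) := by
    intro j
    rw [h4]
    simp only [hb, he]
    ring
  change ∑ j, w j * (y j - P y j) ^ 2 = _
  simp only [h5, Finset.sum_add_distrib, Finset.sum_sub_distrib, ← Finset.mul_sum]
  rw [h1, h2]
  change _ = ∑ j, w j * b j ^ 2 + 2 * ∑ j, w j * b j * e j + ∑ j, w j * e j ^ 2 -
    ∑ j, w j * P e j ^ 2
  simp only [pow_two]
  ring

/-- The quadratic risk of the variance estimators. -/
lemma IntegralLE.varEst_sub_sq (m : ℕ × ℕ) (hm : m.1 + m.2 ≤ K) (hτ : 0 < τ) (hγ : 1 ≤ γ)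
    (hσ : ∀ i, τ ≤ σ i) (hσ' : ∀ i, σ i ≤ γ * τ) {A B : ℝ}
    (hA : ∀ i j, blockIndex K m.1 j = blockIndex K m.1 i → |s i - s j| ≤ A)
    (hB : ∀ i j, blockIndex K m.1 j = blockIndex K m.1 i → |σ i - σ j| ≤ B) (i : Fin (2 ^ K)) :
    IntegralLE (gaussLaw s σ) (fun y => (varEst K m y i - σ i) ^ 2)
      (5 * (B ^ 2 + A ^ 4 + 4 * (A ^ 2 * (γ * τ) * (2 ^ (K - m.1))⁻¹) +
        64 * ((γ * τ) ^ 2 * (2 ^ (K - m.1))⁻¹) +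
        64 * (γ * τ * (2 ^ (K - (m.1 + m.2)))⁻¹) ^ 2)) := by
  have hk : m.1 ≤ K := by omega
  have hγ0 : 0 < γ := by linarith
  have hσ0 : ∀ i, 0 ≤ σ i := fun i => hτ.le.trans (hσ i)
  set w := blockWeight K m.1 i with hw
  set b : Fin (2 ^ K) → ℝ := fun j => s j - blockAvg K (m.1 + m.2) s j with hb
  have hbA : ∀ j, b j ^ 2 ≤ A ^ 2 := by
    intro j
    have h := abs_sub_blockAvg_le (y := s) (A := A) (i := j) hm fun l hl =>
      hA j l (blockIndex_eq_of_le (Nat.le_add_right m.1 m.2) hm hl)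
    rw [← sq_abs]
    exact pow_le_pow_left₀ (abs_nonneg _) h 2
  have c1 : (blockAvg K m.1 σ i - σ i) ^ 2 ≤ B ^ 2 := by
    have h := abs_sub_blockAvg_le (y := σ) (A := B) (i := i) hk fun l hl => hB i l hl
    rw [← sq_abs, abs_sub_comm]
    exact pow_le_pow_left₀ (abs_nonneg _) h 2
  have c2 : blockAvg K m.1 (fun j => b j ^ 2) i ^ 2 ≤ A ^ 4 := by
    have h1 : blockAvg K m.1 (fun j => b j ^ 2) i ≤ A ^ 2 := blockAvg_le_of_le hk fun j _ => hbA j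
    have h2 := blockAvg_nonneg (k := m.1) (fun j => sq_nonneg (b j)) i
    calc _ ≤ (A ^ 2) ^ 2 := pow_le_pow_left₀ h2 h1 2
      _ = _ := by ring
  have c3 : IntegralLE (gaussLaw s σ) (fun y => (∑ j, w j * b j * (y j - s j)) ^ 2)
      (A ^ 2 * (γ * τ) * (2 ^ (K - m.1))⁻¹) := by
    refine (IntegralLE.linear_sq hσ0 _).weaken ?_
    simp only [mul_pow, mul_assoc (w _ ^ 2)]
    exact sum_blockWeight_sq_mul_le hk (fun j => mul_le_mul (hbA j) (hσ' j) (hσ0 j)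
      (sq_nonneg A)) i
  have c4 : IntegralLE (gaussLaw s σ) (fun y => (∑ j, w j * ((y j - s j) ^ 2 - σ j)) ^ 2)
      (64 * ((γ * τ) ^ 2 * (2 ^ (K - m.1))⁻¹)) :=
    (IntegralLE.quadratic_sq hσ0 _).weaken (mul_le_mul_of_nonneg_left
      (sum_blockWeight_sq_mul_le hk (fun j => pow_le_pow_left₀ (hσ0 j) (hσ' j) 2) i)
      (by norm_num))
  have c5 : IntegralLE (gaussLaw s σ) (fun y => ∑ j, w j *
      blockAvg K (m.1 + m.2) (fun l => y l - s l) j ^ 4)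
      (64 * (γ * τ * (2 ^ (K - (m.1 + m.2)))⁻¹) ^ 2) := by
    have h : ∀ j ∈ Finset.univ, IntegralLE (gaussLaw s σ) (fun y => w j *
      blockAvg K (m.1 + m.2) (fun l => y l - s l) j ^ 4)
      (w j * (64 * (γ * τ * (2 ^ (K - (m.1 + m.2)))⁻¹) ^ 2)) := by
      intro j _
      refine IntegralLE.const_mul ?_ (blockWeight_nonneg i j)
      simp only [blockAvg_eq_sum]
      exact IntegralLE.linear_pow_four hσ0 _ (by positivity)
        (sum_blockWeight_sq_mul_le hm hσ' j)
    refine (IntegralLE.sum h).weaken (le_of_eq ?_)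
    rw [← blockAvg_eq_sum, blockAvg_const hk]
  -- The error has five parts: oscillation of `σ`, squared bias, linear noise, centered quadratic
  -- noise, projected noise. The 5 is Cauchy–Schwarz, and the 4 is the square of the factor 2 of the
  -- linear part.
  have key := ((((IntegralLE.const (μ := gaussLaw s σ) (B ^ 2 + A ^ 4)).add
    (c3.const_mul (c := 4) (by norm_num))).add c4).add c5).const_mul (c := 5) (by norm_num)
  refine (key.mono ?_ (Filter.Eventually.of_forall fun y => sq_nonneg _)
    (Filter.Eventually.of_forall fun y => ?_))
  · have := measurable_varEst (K := K) m
    exact (((measurable_pi_apply i).comp this).sub_const _).pow_const 2 |>.aestronglyMeasurable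
  · have h6 : blockAvg K m.1 (fun j => blockAvg K (m.1 + m.2) (fun l => y l - s l) j ^ 2) i ^ 2 ≤
        ∑ j, w j * blockAvg K (m.1 + m.2) (fun l => y l - s l) j ^ 4 := by
      refine (blockAvg_sq_le hk _ i).trans (le_of_eq ?_)
      rw [blockAvg_eq_sum]
      exact Finset.sum_congr rfl fun j _ => by rw [← pow_mul]
    have h7 : ∑ j, w j * ((y j - s j) ^ 2 - σ j) =
        blockAvg K m.1 (fun j => (y j - s j) ^ 2) i - blockAvg K m.1 σ i := by
      simp only [blockAvg_eq_sum, mul_sub, Finset.sum_sub_distrib, hw]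
    rw [varEst_eq_sum m hm s y i]
    change (blockAvg K m.1 (fun j => b j ^ 2) i + 2 * ∑ j, w j * b j * (y j - s j) + _ - _ - _) ^ 2
      ≤ _
    rw [h7]
    set x1 := blockAvg K m.1 (fun j => (y j - s j) ^ 2) i
    set x2 := blockAvg K m.1 σ i
    set x3 := blockAvg K m.1 (fun j => b j ^ 2) i
    set x4 := ∑ j, w j * b j * (y j - s j)
    set x5 := blockAvg K m.1 (fun j => blockAvg K (m.1 + m.2) (fun l => y l - s l) j ^ 2) i
    have five : ∀ p q r t u : ℝ, (p + q + r + t + u) ^ 2 ≤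
        5 * (p ^ 2 + q ^ 2 + r ^ 2 + t ^ 2 + u ^ 2) := by
      intro p q r t u
      nlinarith [sq_nonneg (p - q), sq_nonneg (p - r), sq_nonneg (p - t), sq_nonneg (p - u),
        sq_nonneg (q - r), sq_nonneg (q - t), sq_nonneg (q - u), sq_nonneg (r - t),
        sq_nonneg (r - u), sq_nonneg (t - u)]
    have h8 := five (x2 - σ i) x3 (2 * x4) (x1 - x2) (-x5)
    have h9 : x3 + 2 * x4 + x1 - x5 - σ i = x2 - σ i + x3 + 2 * x4 + (x1 - x2) + -x5 := by ring
    rw [h9]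
    refine h8.trans ?_
    nlinarith

lemma measure_varEst_lt_le (m : ℕ × ℕ) (hm : m.1 + m.2 < K) (hτ : 0 < τ) (hσ : ∀ i, τ ≤ σ i)
    {c : ℝ} (hc : 0 < c) (i : Fin (2 ^ K)) :
    gaussLaw s σ {y | varEst K m y i < c * τ} ≤
      ENNReal.ofReal ((Real.exp 1 * √(Real.pi * (4 * c))) ^ 2 ^ (K - m.1 - 1)) := by
  refine le_trans (measure_mono fun y hy => ?_) (measure_sum_pair_sq_lt_le hτ hσ
    (pairElt_injective (k := m.1) (by omega) i) (x := 4 * c) (by positivity))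
  have h := (sum_pair_sq_le_varEst m hm y i).trans_lt hy
  rw [inv_mul_lt_iff₀ (by positivity)] at h
  rw [Set.mem_ofPred_eq]
  push_cast
  linarith

lemma lintegral_varEst_rpow_le (m : ℕ × ℕ) (hm : m.1 + m.2 < K) (hm' : m.1 + 3 ≤ K) (hτ : 0 < τ)
    (hσ : ∀ i, τ ≤ σ i) (i : Fin (2 ^ K)) :
    ∫⁻ y, ENNReal.ofReal (varEst K m y i / τ) ^ (-(3 / 2) : ℝ) ∂(gaussLaw s σ) ≤
      ENNReal.ofReal (2 * 2 ^ K) ^ (3 / 2 : ℝ) * invRootBound ^ 4 := by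
  have hM : 4 ≤ 2 ^ (K - m.1 - 1) := by
    calc 4 = 2 ^ 2 := by norm_num
      _ ≤ _ := Nat.pow_le_pow_right (by norm_num) (by omega)
  have h := lintegral_sum_pair_sq_rpow_le (s := s) hM hτ hσ
    (pairElt_injective (k := m.1) (by omega) i)
  refine le_trans ?_ (mul_le_mul_right h _)
  rw [← lintegral_const_mul _ (by fun_prop)]
  refine lintegral_mono fun y => ?_
  set S := ∑ u : Fin (2 ^ (K - m.1 - 1)), (y (pairElt (k := m.1) (by omega) i (Sum.inl u)) -
        y (pairElt (k := m.1) (by omega) i (Sum.inr u))) ^ 2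
  -- Normalizing by the whole sample instead of the block costs a power of `n`, which the small
  -- probability of the bad event will absorb.
  have h1 : (2 * 2 ^ K)⁻¹ * (τ⁻¹ * S) ≤ varEst K m y i / τ := by
    have h2 := sum_pair_sq_le_varEst m hm y i
    have h3 : (4 * 2 ^ (K - m.1 - 1) : ℝ) ≤ 2 * 2 ^ K := by
      have : (2 : ℝ) * 2 ^ (K - m.1 - 1) ≤ 2 ^ K := by
        rw [← pow_succ']
        exact pow_le_pow_right₀ (by norm_num) (by omega)
      linarith
    rw [div_eq_inv_mul, mul_left_comm]
    refine mul_le_mul_of_nonneg_left (le_trans ?_ h2) (by positivity)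
    gcongr
  have h4 : ENNReal.ofReal (2 * 2 ^ K) ^ (3 / 2 : ℝ) = 
      ENNReal.ofReal ((2 * 2 ^ K)⁻¹) ^ (-(3 / 2) : ℝ) := by
    rw [ENNReal.ofReal_inv_of_pos (by positivity), ENNReal.inv_rpow, ENNReal.rpow_neg, inv_inv]
  rw [h4, ← ENNReal.mul_rpow_of_ne_top ENNReal.ofReal_ne_top ENNReal.ofReal_ne_top, ← ENNReal.ofReal_mul (by positivity), ENNReal.rpow_neg,
    ENNReal.rpow_neg, ENNReal.inv_le_inv]
  exact ENNReal.rpow_le_rpow (ENNReal.ofReal_le_ofReal h1) (by norm_num)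

/-- In `ENNReal`, `0 ^ (-3/2) = ∞`, so a finite negative moment excludes the value 0 almost surely.
-/
lemma ae_varEst_pos (m : ℕ × ℕ) (hm : m.1 + m.2 < K) (hm' : m.1 + 3 ≤ K) (hτ : 0 < τ)
    (hσ : ∀ i, τ ≤ σ i) (i : Fin (2 ^ K)) : ∀ᵐ y ∂(gaussLaw s σ), 0 < varEst K m y i := by
  have h := lintegral_varEst_rpow_le (s := s) m hm hm' hτ hσ i
  have hfin := h.trans_lt (ENNReal.mul_lt_top
    (ENNReal.rpow_lt_top_of_nonneg (by norm_num) ENNReal.ofReal_ne_top)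
    (ENNReal.pow_lt_top invRootBound_lt_top))
  have hmeas := measurable_varEst (K := K) m
  filter_upwards [ae_lt_top (by fun_prop) hfin.ne] with y hy
  refine (varEst_nonneg m y i).lt_of_ne fun h0 => ?_
  rw [← h0, zero_div, ENNReal.ofReal_zero, ENNReal.zero_rpow_of_neg (by norm_num)] at hy
  exact lt_irrefl _ hy

/-- The moment of order `-3/2` of the variance estimators. -/
lemma IntegralLE.div_varEst_rpow (m : ℕ × ℕ) (hm : m.1 + m.2 < K) (hm' : m.1 + 3 ≤ K)
    (hτ : 0 < τ) (hσ : ∀ i, τ ≤ σ i) (i : Fin (2 ^ K)) :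
    IntegralLE (gaussLaw s σ) (fun y => (τ / varEst K m y i) ^ (3 / 2 : ℝ))
      ((2 * 2 ^ K) ^ (3 / 2 : ℝ) * (invRootBound ^ 4).toReal) := by
  have h := lintegral_varEst_rpow_le (s := s) m hm hm' hτ hσ i
  have hfin := ENNReal.mul_lt_top (a := ENNReal.ofReal (2 * 2 ^ K) ^ (3 / 2 : ℝ))
    (ENNReal.rpow_lt_top_of_nonneg (by norm_num) ENNReal.ofReal_ne_top)
    (ENNReal.pow_lt_top (n := 4) invRootBound_lt_top)
  have hmeas := measurable_varEst (K := K) m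
  have e : ∀ᵐ y ∂(gaussLaw s σ), (τ / varEst K m y i) ^ (3 / 2 : ℝ) =
      (ENNReal.ofReal (varEst K m y i / τ) ^ (-(3 / 2) : ℝ)).toReal := by
    filter_upwards [ae_varEst_pos m hm hm' hτ hσ i] with y hy
    have hp : 0 < varEst K m y i / τ := div_pos hy hτ
    rw [ENNReal.ofReal_rpow_of_pos hp, ENNReal.toReal_ofReal (by positivity),
      Real.rpow_neg hp.le, ← Real.inv_rpow hp.le, inv_div]
  have hi : Integrable (fun y => (ENNReal.ofReal (varEst K m y i / τ) ^ (-(3 / 2) : ℝ)).toReal)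
      (gaussLaw s σ) := integrable_toReal_of_lintegral_ne_top (by fun_prop) (h.trans_lt hfin).ne
  refine ⟨hi.congr (e.mono fun y hy => hy.symm), ?_⟩
  rw [integral_congr_ae e, integral_toReal (by fun_prop)
    (ae_lt_top (by fun_prop) (h.trans_lt hfin).ne)]
  refine (ENNReal.toReal_mono hfin.ne h).trans (le_of_eq ?_)
  rw [ENNReal.toReal_mul, ← ENNReal.toReal_rpow, ENNReal.toReal_ofReal (by positivity)]

end VarEst

/-! ### Comparison of `phi` with squares. -/

section Phi

lemma phi_div_eq {a v : ℝ} (ha : 0 < a) (hv : 0 < v) :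
    phi (v / a) = Real.log v - Real.log a + a / v - 1 := by
  rw [phi, Real.log_div hv.ne' ha.ne', one_div_div]

/-- With `r = √(a / v)`, `log r ≤ r - 1` gives `phi (v / a) ≥ (r - 1) ^ 2`, while `(r + 1) ^ 2 ≤ 2
(V + 1)`. It bounds the variance of the quadratic noise by the loss. -/
lemma sq_le_mul_phi {a v V : ℝ} (ha : 0 < a) (hv : 0 < v) (h : a / v ≤ V) :
    (a / v - 1) ^ 2 ≤ 2 * (V + 1) * phi (v / a) := by
  set u := a / v with hu
  have hu0 : 0 < u := div_pos ha hv
  have e : phi (v / a) = u - 1 - Real.log u := by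
    rw [phi_div_eq ha hv, hu, Real.log_div ha.ne' hv.ne']; ring
  set r := √u
  have hr : 0 < r := Real.sqrt_pos.2 hu0
  have hru : u = r ^ 2 := (Real.sq_sqrt hu0.le).symm
  have hl : Real.log u ≤ 2 * (r - 1) := by
    rw [hru, Real.log_pow]
    have := Real.log_le_sub_one_of_pos hr
    push_cast
    linarith
  have h1 : (r - 1) ^ 2 ≤ phi (v / a) := by rw [e]; nlinarith
  have h2 : (r + 1) ^ 2 ≤ 2 * (V + 1) := by nlinarith [sq_nonneg (r - 1)]
  calc (u - 1) ^ 2 = (r + 1) ^ 2 * (r - 1) ^ 2 := by rw [hru]; ring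
    _ ≤ 2 * (V + 1) * phi (v / a) := mul_le_mul h2 h1 (sq_nonneg _) ((sq_nonneg _).trans h2)

lemma phi_div_nonneg {a v : ℝ} (ha : 0 < a) (hv : 0 < v) : 0 ≤ phi (v / a) := by
  have := Real.log_le_sub_one_of_pos (div_pos ha hv)
  rw [Real.log_div ha.ne' hv.ne'] at this
  rw [phi_div_eq ha hv]
  linarith

/-- From `log x ≤ x - 1` at `x = v / a`; it turns the quadratic risk of the variance estimators into
a bound on the loss. -/
lemma phi_div_le_sq {a v : ℝ} (ha : 0 < a) (hv : 0 < v) :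
    phi (v / a) ≤ (v - a) ^ 2 / (v * a) := by
  have := Real.log_le_sub_one_of_pos (div_pos hv ha)
  have h2 : phi (v / a) ≤ v / a - 1 + a / v - 1 := by
    rw [phi, one_div_div]; linarith
  refine h2.trans (le_of_eq ?_)
  field_simp
  ring

end Phi

/-! ### Decomposition of the loss and of the criterion for fixed variances `v`. -/

section Decomposition

variable {K : ℕ}

/-- The error `s - π_m s` of the approximation of the mean in the model `m`. -/
def bias (K : ℕ) (m : ℕ × ℕ) (s : Fin (2 ^ K) → ℝ) (i : Fin (2 ^ K)) : ℝ :=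
  s i - blockAvg K (m.1 + m.2) s i

/-- The part of the loss that does not depend on the noise of the first observation. -/
def biasLoss (K : ℕ) (m : ℕ × ℕ) (s σ v : Fin (2 ^ K) → ℝ) : ℝ :=
  (1 / 2) * ∑ i, (bias K m s i ^ 2 / v i + phi (v i / σ i))

/-- The weighted squared norm of the projection of the noise. -/
def noiseProj (K : ℕ) (m : ℕ × ℕ) (s v y : Fin (2 ^ K) → ℝ) : ℝ :=
  ∑ i, blockAvg K (m.1 + m.2) (fun j => y j - s j) i ^ 2 / v i

/-- The linear term of the noise in the decomposition of the likelihood. -/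
def noiseLin (K : ℕ) (m : ℕ × ℕ) (s v y : Fin (2 ^ K) → ℝ) : ℝ :=
  ∑ i, bias K m s i / v i * (y i - s i)

/-- The centered quadratic term of the noise in the decomposition of the likelihood. -/
def noiseQuad {n : ℕ} (s σ v y : Fin n → ℝ) : ℝ :=
  ∑ i, (1 / 2) * (1 / v i - 1 / σ i) * ((y i - s i) ^ 2 - σ i)

variable {m : ℕ × ℕ} {s σ v : Fin (2 ^ K) → ℝ}

lemma noiseProj_nonneg (hv : ∀ i, 0 < v i) (y : Fin (2 ^ K) → ℝ) : 0 ≤ noiseProj K m s v y :=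
  Finset.sum_nonneg fun i _ => div_nonneg (sq_nonneg _) (hv i).le

lemma biasLoss_nonneg (hσ : ∀ i, 0 < σ i) (hv : ∀ i, 0 < v i) : 0 ≤ biasLoss K m s σ v :=
  mul_nonneg (by norm_num) (Finset.sum_nonneg fun i _ =>
    add_nonneg (div_nonneg (sq_nonneg _) (hv i).le) (phi_div_nonneg (hσ i) (hv i)))

lemma sum_bias_mul_blockAvg (hm : m.1 + m.2 ≤ K)
    (hvc : ∀ i j, blockIndex K (m.1 + m.2) j = blockIndex K (m.1 + m.2) i → v j = v i)
    (z : Fin (2 ^ K) → ℝ) :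
    ∑ i, (v i)⁻¹ * (bias K m s i * blockAvg K (m.1 + m.2) z i) = 0 := by
  rw [sum_mul_mul_blockAvg hm (w := fun i => (v i)⁻¹) (fun i j h => by rw [hvc i j h])]
  refine Finset.sum_eq_zero fun i _ => ?_
  have := blockAvg_sub_blockAvg hm s i
  change blockAvg K (m.1 + m.2) (bias K m s) i = 0 at this
  rw [this]
  ring

lemma meanEst_eq (hm : m.1 + m.2 ≤ K) (s y : Fin (2 ^ K) → ℝ) (i : Fin (2 ^ K)) :
    meanEst K m y i = blockAvg K (m.1 + m.2) s i +
      blockAvg K (m.1 + m.2) (fun j => y j - s j) i := by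
  rw [meanEst, proj_eq_blockAvg m hm, blockAvg_sub]
  ring

/-- Pythagoras: the bias is orthogonal to the projected noise for weights that are constant on the
fine blocks. -/
lemma kullback_meanEst_eq (hm : m.1 + m.2 ≤ K)
    (hvc : ∀ i j, blockIndex K (m.1 + m.2) j = blockIndex K (m.1 + m.2) i → v j = v i)
    (y : Fin (2 ^ K) → ℝ) :
    kullback s σ (meanEst K m y) v = biasLoss K m s σ v + (1 / 2) * noiseProj K m s v y := by
  have h := sum_bias_mul_blockAvg (s := s) hm hvc (fun j => y j - s j)
  rw [kullback, biasLoss, noiseProj, ← mul_add, ← Finset.sum_add_distrib]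
  congr 1
  rw [← sub_eq_zero, ← Finset.sum_sub_distrib, ← mul_zero (-2), ← h, Finset.mul_sum]
  refine Finset.sum_congr rfl fun i _ => ?_
  rw [meanEst_eq hm s, bias]
  ring

/-- The second term on the right does not depend on the model, so it cancels when two criteria are
compared. -/
lemma likelihood_meanEst_eq (hm : m.1 + m.2 ≤ K) (hσ : ∀ i, 0 < σ i) (hv : ∀ i, 0 < v i)
    (hvc : ∀ i j, blockIndex K (m.1 + m.2) j = blockIndex K (m.1 + m.2) i → v j = v i)
    (y : Fin (2 ^ K) → ℝ) :
    likelihood y (meanEst K m y) v = kullback s σ (meanEst K m y) v +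
      (1 / 2) * ∑ i, (Real.log (σ i) + (y i - s i) ^ 2 / σ i) - noiseProj K m s v y +
      noiseLin K m s v y + noiseQuad s σ v y := by
  have h := sum_bias_mul_blockAvg (s := s) hm hvc (fun j => y j - s j)
  have h' := sum_mul_mul_blockAvg hm (w := fun i => (v i)⁻¹) (fun i j h => by rw [hvc i j h])
    (fun j => y j - s j) (fun j => y j - s j)
  rw [kullback_meanEst_eq hm hvc, likelihood, biasLoss, noiseProj, noiseLin, noiseQuad]
  simp only [Finset.mul_sum, ← Finset.sum_add_distrib, ← Finset.sum_sub_distrib]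
  rw [← sub_eq_zero, ← Finset.sum_sub_distrib] at h' ⊢
  have : (0 : ℝ) = -(∑ i, (v i)⁻¹ * (bias K m s i * blockAvg K (m.1 + m.2)
      (fun j => y j - s j) i)) - ∑ i, ((v i)⁻¹ * ((y i - s i) * blockAvg K (m.1 + m.2)
      (fun j => y j - s j) i) - (v i)⁻¹ * (blockAvg K (m.1 + m.2) (fun j => y j - s j) i *
      blockAvg K (m.1 + m.2) (fun j => y j - s j) i)) := by
    rw [h, h']; ring
  rw [this, ← Finset.sum_neg_distrib, ← Finset.sum_sub_distrib]
  refine Finset.sum_congr rfl fun i _ => ?_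
  rw [meanEst_eq hm s, phi_div_eq (hσ i) (hv i)]
  have hs := (hσ i).ne'
  have hv0 := (hv i).ne'
  have hb : s i = bias K m s i + blockAvg K (m.1 + m.2) s i := by rw [bias]; ring
  set p := blockAvg K (m.1 + m.2) (fun j => y j - s j) i
  set P := blockAvg K (m.1 + m.2) s i
  set B := bias K m s i
  have h1 : y i - (P + p) = (y i - s i) + B - p := by rw [hb]; ring
  rw [h1]
  set e := y i - s i
  field_simp
  ring

/-- A bound of the noise terms that are controlled by their variance. -/
def noiseTerm (K : ℕ) (m : ℕ × ℕ) (s σ v y : Fin (2 ^ K) → ℝ) : ℝ :=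
  (noiseLin K m s v y ^ 2 + noiseQuad s σ v y ^ 2) / (biasLoss K m s σ v + 1)

/-- `|t| ≤ x / 4 + t ^ 2 / x` for each of the two forms, with `x = biasLoss + 1`; the `+ 1` keeps
the denominator away from 0. -/
lemma abs_noise_add_le (hσ : ∀ i, 0 < σ i) (hv : ∀ i, 0 < v i) (y : Fin (2 ^ K) → ℝ) :
    |noiseLin K m s v y + noiseQuad s σ v y| ≤
      (biasLoss K m s σ v + 1) / 2 + noiseTerm K m s σ v y := by
  have hb := biasLoss_nonneg (m := m) (s := s) hσ hv
  have key : ∀ t x : ℝ, 0 < x → |t| ≤ x / 4 + t ^ 2 / x := by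
    intro t x hx
    have : x / 4 + t ^ 2 / x - |t| = (x / 2 - |t|) ^ 2 / x := by
      rw [← sq_abs t]; field_simp; ring
    have : 0 ≤ (x / 2 - |t|) ^ 2 / x := by positivity
    linarith
  have h1 := key (noiseLin K m s v y) _ (show 0 < biasLoss K m s σ v + 1 by linarith)
  have h2 := key (noiseQuad s σ v y) _ (show 0 < biasLoss K m s σ v + 1 by linarith)
  rw [noiseTerm, add_div (noiseLin K m s v y ^ 2)]
  refine (abs_add_le _ _).trans ((add_le_add h1 h2).trans (le_of_eq ?_))
  ring

lemma noiseTerm_nonneg (hσ : ∀ i, 0 < σ i) (hv : ∀ i, 0 < v i) (y : Fin (2 ^ K) → ℝ) :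
    0 ≤ noiseTerm K m s σ v y := by
  have hb := biasLoss_nonneg (m := m) (s := s) hσ hv
  exact div_nonneg (by positivity) (by linarith)

/-- The comparison of the loss of a model of smaller criterion with that of another one. -/
lemma kullback_le_of_crit_le {m m₀ : ℕ × ℕ} {v v₀ y : Fin (2 ^ K) → ℝ} {p p₀ : ℝ}
    (hm : m.1 + m.2 ≤ K) (hm₀ : m₀.1 + m₀.2 ≤ K)
    (hσ : ∀ i, 0 < σ i) (hv : ∀ i, 0 < v i) (hv₀ : ∀ i, 0 < v₀ i)
    (hvc : ∀ i j, blockIndex K (m.1 + m.2) j = blockIndex K (m.1 + m.2) i → v j = v i)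
    (hvc₀ : ∀ i j, blockIndex K (m₀.1 + m₀.2) j = blockIndex K (m₀.1 + m₀.2) i → v₀ j = v₀ i)
    (h : likelihood y (meanEst K m y) v + p ≤ likelihood y (meanEst K m₀ y) v₀ + p₀) :
    kullback s σ (meanEst K m y) v ≤ 3 * biasLoss K m₀ s σ v₀ + 2 * p₀ + 2 +
      2 * (noiseTerm K m s σ v y + max (noiseProj K m s v y - p) 0) +
      2 * noiseTerm K m₀ s σ v₀ y := by
  rw [likelihood_meanEst_eq hm hσ hv hvc, likelihood_meanEst_eq hm₀ hσ hv₀ hvc₀] at h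
  have h1 := abs_le.1 (abs_noise_add_le (m := m) (s := s) hσ hv y)
  have h2 := abs_le.1 (abs_noise_add_le (m := m₀) (s := s) hσ hv₀ y)
  have h3 := le_max_left (noiseProj K m s v y - p) 0
  have h4 := kullback_meanEst_eq (s := s) (σ := σ) hm hvc y
  have h5 := kullback_meanEst_eq (s := s) (σ := σ) hm₀ hvc₀ y
  have h6 := noiseProj_nonneg (m := m) (s := s) hv y
  have h7 := noiseProj_nonneg (m := m₀) (s := s) hv₀ y
  -- Half of the `biasLoss` of `m` survives on the left. After doubling, the projected noise enters
  -- as `(3/2) noiseProj - 2 p`, at most `2 max (noiseProj - p) 0`.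
  linarith [h1.1, h2.2]

end Decomposition

/-! ### Expected size of the noise terms for fixed variances `v`. -/

section NoiseMoments

variable {K : ℕ} {m : ℕ × ℕ} {s σ v : Fin (2 ^ K) → ℝ}

lemma measurable_noiseProj (m : ℕ × ℕ) (s v : Fin (2 ^ K) → ℝ) :
    Measurable (noiseProj K m s v) := by
  unfold noiseProj
  refine Finset.measurable_fun_sum _ fun i _ => ?_
  exact (((measurable_blockAvg_apply i).comp (g := fun y => blockAvg K (m.1 + m.2) y i)
    (f := fun (y : Fin (2 ^ K) → ℝ) j => y j - s j) (by fun_prop)).pow_const 2).div_const _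

/-- The linear form has variance at most `2 V * biasLoss` and the quadratic one at most `64 (V + 1)
* biasLoss`; dividing by `biasLoss + 1` leaves a bound free of the bias. -/
lemma IntegralLE.noiseTerm (hσ : ∀ i, 0 < σ i) (hv : ∀ i, 0 < v i) {V : ℝ}
    (hV : ∀ i, σ i / v i ≤ V) :
    IntegralLE (gaussLaw s σ) (noiseTerm K m s σ v) (66 * (V + 1)) := by
  have hσ0 : ∀ i, 0 ≤ σ i := fun i => (hσ i).le
  have hb := biasLoss_nonneg (m := m) (s := s) hσ hv
  have hV0 : 0 ≤ V := (div_pos (hσ ⟨0, by positivity⟩) (hv ⟨0, by positivity⟩)).le.trans (hV _)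
  have h1 : IntegralLE (gaussLaw s σ) (fun y => noiseLin K m s v y ^ 2)
      (2 * V * biasLoss K m s σ v) := by
    refine (IntegralLE.linear_sq hσ0 _).weaken ?_
    rw [biasLoss, ← mul_assoc, Finset.mul_sum]
    refine Finset.sum_le_sum fun i _ => ?_
    have : (bias K m s i / v i) ^ 2 * σ i = bias K m s i ^ 2 / v i * (σ i / v i) := by
      field_simp
    rw [this]
    have h2 : 0 ≤ bias K m s i ^ 2 / v i := div_nonneg (sq_nonneg _) (hv i).le
    nlinarith [hV i, phi_div_nonneg (hσ i) (hv i),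
      mul_nonneg hV0 (phi_div_nonneg (hσ i) (hv i))]
  have h2 : IntegralLE (gaussLaw s σ) (fun y => noiseQuad s σ v y ^ 2)
      (64 * (V + 1) * biasLoss K m s σ v) := by
    refine (IntegralLE.quadratic_sq hσ0 _).weaken ?_
    rw [biasLoss, ← mul_assoc, Finset.mul_sum, Finset.mul_sum]
    refine Finset.sum_le_sum fun i _ => ?_
    have : (1 / 2 * (1 / v i - 1 / σ i)) ^ 2 * σ i ^ 2 = (1 / 4) * (σ i / v i - 1) ^ 2 := by
      have := (hσ i).ne'
      have := (hv i).ne'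
      field_simp
      ring
    rw [this]
    have h2 : 0 ≤ bias K m s i ^ 2 / v i := div_nonneg (sq_nonneg _) (hv i).le
    nlinarith [sq_le_mul_phi (hσ i) (hv i) (hV i), mul_nonneg hV0 h2]
  have h3 := (h1.add h2).const_mul (c := (biasLoss K m s σ v + 1)⁻¹) (by positivity)
  have e : HeteroReg.noiseTerm K m s σ v = fun y => (biasLoss K m s σ v + 1)⁻¹ *
      (noiseLin K m s v y ^ 2 + noiseQuad s σ v y ^ 2) := by
    ext y; rw [HeteroReg.noiseTerm, div_eq_inv_mul]
  rw [e]
  refine h3.weaken ?_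
  rw [inv_mul_le_iff₀ (by positivity)]
  nlinarith [mul_nonneg hV0 hb]

/-- With `x = log D`, either `x ≤ κ ^ (1 / ε)`, or `x ^ ε ≥ κ` and the total exponent is
nonpositive. This is where the power `1 + ε > 1` of the logarithm in the penalty matters. -/
lemma mul_exp_neg_log_rpow_le {D κ ε : ℝ} (hD : 1 ≤ D) (hκ : 0 < κ) (hε : 0 < ε) :
    D * Real.exp (-(Real.log D ^ (1 + ε) / κ)) ≤ Real.exp (κ ^ (1 / ε)) := by
  have hD0 : 0 < D := by linarith
  have hx : 0 ≤ Real.log D := Real.log_nonneg hD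
  conv_lhs => rw [← Real.exp_log hD0, Real.log_exp]
  rw [← Real.exp_add, Real.exp_le_exp]
  set x := Real.log D
  rcases le_or_gt x (κ ^ (1 / ε)) with h | h
  · have : 0 ≤ x ^ (1 + ε) / κ := by positivity
    linarith
  · have hx0 : 0 < x := lt_trans (by positivity) h
    have h1 : κ ≤ x ^ ε := by
      calc κ = (κ ^ (1 / ε)) ^ ε := by
            rw [← Real.rpow_mul hκ.le, one_div_mul_cancel hε.ne', Real.rpow_one]
        _ ≤ x ^ ε := Real.rpow_le_rpow (by positivity) h.le hε.le
    have h2 : x ≤ x ^ (1 + ε) / κ := by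
      rw [Real.rpow_add hx0, Real.rpow_one, le_div_iff₀ hκ]
      gcongr
    have : 0 ≤ κ ^ (1 / ε) := by positivity
    linarith

lemma one_le_modelDim (m : ℕ × ℕ) : (1 : ℝ) ≤ modelDim m := by
  have : 0 < modelDim m := by unfold modelDim; positivity
  exact_mod_cast this

lemma two_pow_le_modelDim (m : ℕ × ℕ) : (2 : ℝ) ^ (m.1 + m.2) ≤ modelDim m := by
  unfold modelDim
  push_cast
  rw [pow_add]
  gcongr
  linarith

/-- The expected excess of the projected noise over the penalty. -/
lemma IntegralLE.noiseProj_sub_pen {τ γ θ ε c : ℝ} (hm : m.1 + m.2 ≤ K) (hτ : 0 < τ) (hγ : 1 ≤ γ)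
    (hθ : 1 < θ) (hε : 0 < ε) (hc : 0 < c) (hσ : ∀ i, τ ≤ σ i) (hσ' : ∀ i, σ i ≤ γ * τ)
    (hv : ∀ i, c * τ ≤ v i) :
    IntegralLE (gaussLaw s σ) (fun y => max (noiseProj K m s v y - pen θ γ ε m) 0)
      (2 * (4 * γ / c) * Real.exp ((4 * γ / c) ^ (1 / ε))) := by
  have hσ0 : ∀ i, 0 ≤ σ i := fun i => hτ.le.trans (hσ i)
  set κ := 4 * γ / c with hκdef
  have hκ : 0 < κ := by positivity
  set q : ℝ := 2 ^ (K - (m.1 + m.2)) with hq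
  have hq0 : 0 < q := by positivity
  set D : ℝ := (modelDim m : ℝ)
  have hD := one_le_modelDim m
  set ℓ := Real.log D ^ (1 + ε) with hℓ
  have hℓ0 : 0 ≤ ℓ := Real.rpow_nonneg (Real.log_nonneg hD) _
  have hqn : (2 : ℝ) ^ K = 2 ^ (m.1 + m.2) * q := by rw [hq, ← pow_add]; congr 1; omega
  set w := γ * τ * q⁻¹
  have hw : 0 < w := by positivity
  have hi : ∀ i ∈ Finset.univ, IntegralLE (gaussLaw s σ) (fun y => (κ * q⁻¹ * Real.exp (-(ℓ / κ))) *
      Real.exp (blockAvg K (m.1 + m.2) (fun j => y j - s j) i ^ 2 / (4 * w)))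
      ((κ * q⁻¹ * Real.exp (-(ℓ / κ))) * 2) := by
    intro i _
    refine IntegralLE.const_mul ?_ (by positivity)
    simp only [blockAvg_eq_sum]
    exact IntegralLE.linear_exp_sq hσ0 _ (sum_blockWeight_sq_mul_le hm hσ' i)
  refine ((IntegralLE.sum hi).mono ?_ (Filter.Eventually.of_forall fun y => le_max_right _ _)
    (Filter.Eventually.of_forall fun y => ?_)).weaken ?_
  · exact (((measurable_noiseProj m s v).sub_const _).max measurable_const).aestronglyMeasurable
  · refine max_le ?_ (Finset.sum_nonneg fun i _ => by positivity)
    have h1 : noiseProj K m s v y ≤ ∑ i, q⁻¹ * (κ *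
        (blockAvg K (m.1 + m.2) (fun j => y j - s j) i ^ 2 / (4 * w))) := by
      refine Finset.sum_le_sum fun i _ => ?_
      have : q⁻¹ * (κ * (blockAvg K (m.1 + m.2) (fun j => y j - s j) i ^ 2 / (4 * w))) =
          blockAvg K (m.1 + m.2) (fun j => y j - s j) i ^ 2 / (c * τ) := by
        simp only [hκdef, w]
        field_simp
      rw [this]
      exact div_le_div_of_nonneg_left (sq_nonneg _) (by positivity) (hv i)
    -- The logarithmic part of the penalty is spread evenly over the indices, in order to compare it
    -- with the noise term by term.
    have h2 : ∑ _i : Fin (2 ^ K), q⁻¹ * ℓ ≤ pen θ γ ε m := by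
      rw [Finset.sum_const, Finset.card_univ, Fintype.card_fin, nsmul_eq_mul, pen]
      push_cast
      rw [hqn]
      have h3 := two_pow_le_modelDim m
      calc _ = ℓ * 2 ^ (m.1 + m.2) := by field_simp
        _ ≤ ℓ * D := by gcongr
        _ ≤ _ := by
          gcongr
          have : 0 ≤ γ * θ := by positivity
          linarith
    calc _ ≤ ∑ i, q⁻¹ * (κ * (blockAvg K (m.1 + m.2) (fun j => y j - s j) i ^ 2 / (4 * w))) -
        ∑ _i : Fin (2 ^ K), q⁻¹ * ℓ := sub_le_sub h1 h2
      _ ≤ _ := by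
        rw [← Finset.sum_sub_distrib]
        refine Finset.sum_le_sum fun i _ => ?_
        set z := blockAvg K (m.1 + m.2) (fun j => y j - s j) i ^ 2 / (4 * w)
        -- `z - ℓ / κ ≤ exp (z - ℓ / κ)`, and `exp z` has mean at most 2.
        have h4 := Real.add_one_le_exp (z - ℓ / κ)
        have h5 : q⁻¹ * (κ * z) - q⁻¹ * ℓ = κ * q⁻¹ * (z - ℓ / κ) := by field_simp
        rw [h5, mul_assoc (κ * q⁻¹) (Real.exp _), ← Real.exp_add]
        refine mul_le_mul_of_nonneg_left ?_ (by positivity)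
        rw [neg_add_eq_sub]
        linarith
  · rw [Finset.sum_const, Finset.card_univ, Fintype.card_fin, nsmul_eq_mul]
    push_cast
    rw [hqn]
    have h6 := mul_exp_neg_log_rpow_le hD hκ hε
    calc _ = 2 * κ * (2 ^ (m.1 + m.2) * Real.exp (-(ℓ / κ))) := by field_simp
      _ ≤ 2 * κ * (D * Real.exp (-(ℓ / κ))) := by
        gcongr
        exact two_pow_le_modelDim m
      _ ≤ _ := by gcongr

end NoiseMoments

/-! ### Consequences of the dimension constraints. -/

section Models

variable {K : ℕ} {θ γ δ ε : ℝ} {m : ℕ × ℕ}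

lemma two_mul_two_pow_le_modelDim (m : ℕ × ℕ) : 2 * (2 : ℝ) ^ m.1 ≤ modelDim m := by
  unfold modelDim
  push_cast
  have : (1 : ℝ) ≤ 2 ^ m.2 := one_le_pow₀ (by norm_num)
  have : (0 : ℝ) < 2 ^ m.1 := by positivity
  nlinarith

lemma three_mul_modelDim_le (hθ : 1 < θ) (hγ : 1 ≤ γ) (hm : m ∈ models K θ γ δ ε) :
    3 * (modelDim m : ℝ) ≤ 2 ^ K := by
  have h := hm.2.1
  unfold HTheta at h
  refine le_trans ?_ h
  have h1 : 1 ≤ θ / (θ - 1) := by rw [one_le_div (by linarith)]; linarith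
  have h2 : (0 : ℝ) ≤ modelDim m := by positivity
  have : 3 ≤ θ / (θ - 1) * (γ + 2) := by nlinarith
  gcongr

lemma add_lt_of_mem_models (hθ : 1 < θ) (hγ : 1 ≤ γ) (hm : m ∈ models K θ γ δ ε) :
    m.1 + m.2 < K := by
  have h1 := three_mul_modelDim_le hθ hγ hm
  have h2 := two_pow_le_modelDim m
  have h3 : (2 : ℝ) ^ (m.1 + m.2) < 2 ^ K := by
    have : (0 : ℝ) < 2 ^ (m.1 + m.2) := by positivity
    linarith
  exact (pow_lt_pow_iff_right₀ (by norm_num)).1 h3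

/-- Each coarse block then has at least eight indices, hence the four couples that the negative
moment requires. -/
lemma add_three_le_of_mem_models (hθ : 1 < θ) (hγ : 1 ≤ γ) (hm : m ∈ models K θ γ δ ε) :
    m.1 + 3 ≤ K := by
  have h1 := three_mul_modelDim_le hθ hγ hm
  have h2 := two_mul_two_pow_le_modelDim m
  have h3 : (2 : ℝ) ^ (m.1 + 2) < 2 ^ K := by
    have : (0 : ℝ) < 2 ^ m.1 := by positivity
    rw [pow_add]
    linarith
  have := (pow_lt_pow_iff_right₀ (a := (2 : ℝ)) (by norm_num)).1 h3
  omega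

/-- Each coarse block contains at least `log n / (5 δ γ)` couples, enough for the Chernoff bound to
be a power of `1 / n`. -/
lemma log_le_of_mem_models (hε : 0 < ε)
    (hK : 1 ≤ Real.log ((2 : ℝ) ^ K)) (hmK : m.1 < K) (hm : m ∈ models K θ γ δ ε) :
    Real.log ((2 : ℝ) ^ K) ≤ 5 * δ * γ * 2 ^ (K - m.1 - 1) := by
  have h := hm.2.2
  unfold DimBound at h
  set L := Real.log ((2 : ℝ) ^ K)
  have hL : L ≤ L ^ (1 + ε) := by
    conv_lhs => rw [← Real.rpow_one L]
    exact Real.rpow_le_rpow_of_exponent_le hK (by linarith)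
  rw [le_div_iff₀ (by linarith)] at h
  have h2 := two_mul_two_pow_le_modelDim m
  have h3 : 2 * (2 : ℝ) ^ m.1 * L ≤ 5 * δ * γ * 2 ^ K := by
    refine le_trans ?_ h
    gcongr
  have h4 : (2 : ℝ) ^ K = 2 * 2 ^ m.1 * 2 ^ (K - m.1 - 1) := by
    rw [← pow_succ', ← pow_add]; congr 1; omega
  rw [h4] at h3
  have : (0 : ℝ) < 2 * 2 ^ m.1 := by positivity
  refine le_of_mul_le_mul_left ?_ this
  linarith

open Classical in
/-- The collection of the models, as a finite set. -/
def modelFinset (K : ℕ) (θ γ δ ε : ℝ) : Finset (ℕ × ℕ) :=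
  (Finset.range (K + 1) ×ˢ Finset.range (K + 1)).filter fun m => m ∈ models K θ γ δ ε

lemma mem_modelFinset : m ∈ modelFinset K θ γ δ ε ↔ m ∈ models K θ γ δ ε := by
  classical
  rw [modelFinset, Finset.mem_filter, Finset.mem_product, Finset.mem_range, Finset.mem_range]
  refine ⟨fun h => h.2, fun h => ⟨?_, h⟩⟩
  have := h.1
  omega

lemma card_modelFinset_le : ((modelFinset K θ γ δ ε).card : ℝ) ≤ ((K : ℝ) + 1) ^ 2 := by
  have h : (modelFinset K θ γ δ ε).card ≤ (K + 1) * (K + 1) := by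
    classical
    refine (Finset.card_filter_le _ _).trans ?_
    simp
  calc ((modelFinset K θ γ δ ε).card : ℝ) ≤ ((K + 1) * (K + 1) : ℕ) := by exact_mod_cast h
    _ = _ := by push_cast; ring

end Models

/-! ### The event that no variance estimator is too small. -/

section GoodEvent

variable {K : ℕ} {θ γ δ ε τ : ℝ} {s σ : Fin (2 ^ K) → ℝ}

/-- The level, relative to the variances, that the variance estimators exceed with a large
probability. -/
def lowerLevel (δ γ : ℝ) : ℝ := Real.exp (-2 - 100 * δ * γ) / (4 * Real.pi)

lemma lowerLevel_pos (δ γ : ℝ) : 0 < lowerLevel δ γ := by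
  have := Real.pi_pos
  unfold lowerLevel; positivity

/-- The event that all the variance estimators exceed the level `c`. -/
def goodEvent (K : ℕ) (θ γ δ ε c : ℝ) : Set (Fin (2 ^ K) → ℝ) :=
  {y | ∀ m ∈ models K θ γ δ ε, ∀ i, c ≤ varEst K m y i}

lemma compl_goodEvent (c : ℝ) : (goodEvent K θ γ δ ε c)ᶜ =
    ⋃ m ∈ modelFinset K θ γ δ ε, ⋃ i, {y | varEst K m y i < c} := by
  ext y
  simp only [goodEvent, Set.mem_compl_iff, Set.mem_ofPred_eq, Set.mem_iUnion, mem_modelFinset]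
  push Not
  simp

lemma measurableSet_goodEvent (c : ℝ) : MeasurableSet (goodEvent K θ γ δ ε c) := by
  rw [← compl_compl (goodEvent K θ γ δ ε c), compl_goodEvent]
  refine (Finset.measurableSet_biUnion _ fun m _ => MeasurableSet.iUnion fun i => ?_).compl
  exact measurableSet_lt ((measurable_pi_apply i).comp (measurable_varEst m)) measurable_const

lemma measure_compl_goodEvent_le (hθ : 1 < θ) (hγ : 1 ≤ γ) (hε : 0 < ε)
    (hK : 1 ≤ Real.log ((2 : ℝ) ^ K)) (hτ : 0 < τ) (hσ : ∀ i, τ ≤ σ i) :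
    gaussLaw s σ (goodEvent K θ γ δ ε (lowerLevel δ γ * τ))ᶜ ≤
      ENNReal.ofReal (((2 : ℝ) ^ K) ^ 7)⁻¹ := by
  set N : ℝ := 2 ^ K with hN
  have hN0 : 0 < N := by positivity
  have h1 : ∀ m ∈ modelFinset K θ γ δ ε, ∀ i,
      gaussLaw s σ {y | varEst K m y i < lowerLevel δ γ * τ} ≤ ENNReal.ofReal (N ^ 10)⁻¹ := by
    intro m hm i
    rw [mem_modelFinset] at hm
    have hmK := add_lt_of_mem_models hθ hγ hm
    refine (measure_varEst_lt_le m hmK hτ hσ (lowerLevel_pos δ γ) i).trans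
      (ENNReal.ofReal_le_ofReal ?_)
    -- `lowerLevel` makes the base of the Chernoff bound equal to `exp (-50 δ γ)`; its power at
    -- least `log n / (5 δ γ)` is at most `n ^ (-10)`.
    have e1 : Real.pi * (4 * lowerLevel δ γ) = Real.exp (-1 - 50 * δ * γ) ^ 2 := by
      have := Real.pi_ne_zero
      rw [lowerLevel, ← Real.exp_nat_mul]
      field_simp
      congr 1
      push_cast
      ring
    rw [e1, Real.sqrt_sq (Real.exp_pos _).le, ← Real.exp_add, ← Real.exp_nat_mul,
      ← Real.exp_log hN0, ← Real.exp_nat_mul, ← Real.exp_neg, Real.exp_le_exp]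
    have h2 := log_le_of_mem_models hε hK (by omega) hm
    push_cast
    nlinarith
  rw [compl_goodEvent]
  calc _ ≤ ∑ m ∈ modelFinset K θ γ δ ε, gaussLaw s σ
        (⋃ i, {y | varEst K m y i < lowerLevel δ γ * τ}) := measure_biUnion_finset_le _ _
    _ ≤ ∑ _m ∈ modelFinset K θ γ δ ε, ENNReal.ofReal (N * (N ^ 10)⁻¹) := by
      refine Finset.sum_le_sum fun m hm => (measure_iUnion_fintype_le _ _).trans ?_
      refine (Finset.sum_le_sum fun i _ => h1 m hm i).trans (le_of_eq ?_)
      rw [Finset.sum_const, Finset.card_univ, Fintype.card_fin, nsmul_eq_mul,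
        ENNReal.ofReal_mul hN0.le, hN, ENNReal.ofReal_pow (by norm_num)]
      push_cast
      simp
    _ = ENNReal.ofReal ((modelFinset K θ γ δ ε).card * (N * (N ^ 10)⁻¹)) := by
      rw [Finset.sum_const, nsmul_eq_mul, ENNReal.ofReal_mul (p := ((modelFinset K θ γ δ ε).card : ℝ))
        (by positivity), ENNReal.ofReal_natCast]
    _ ≤ _ := by
      refine ENNReal.ofReal_le_ofReal ?_
      have h2 : ((K : ℝ) + 1) ≤ N := by
        have : K + 1 ≤ 2 ^ K := Nat.lt_two_pow_self
        rw [hN]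
        exact_mod_cast this
      have h3 : ((modelFinset K θ γ δ ε).card : ℝ) ≤ N ^ 2 :=
        card_modelFinset_le.trans (pow_le_pow_left₀ (by positivity) h2 2)
      -- Union bound over at most `n ^ 2` models and `n` coordinates.
      calc _ ≤ N ^ 2 * (N * (N ^ 10)⁻¹) := by gcongr
        _ = _ := by field_simp

/-- The indicator function of the event that some variance estimator is too small. -/
def badIndicator (K : ℕ) (θ γ δ ε c : ℝ) : (Fin (2 ^ K) → ℝ) → ℝ :=
  (goodEvent K θ γ δ ε c)ᶜ.indicator 1

lemma IntegralLE.badIndicator (hθ : 1 < θ) (hγ : 1 ≤ γ) (hε : 0 < ε)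
    (hK : 1 ≤ Real.log ((2 : ℝ) ^ K)) (hτ : 0 < τ) (hσ : ∀ i, τ ≤ σ i) :
    IntegralLE (gaussLaw s σ) (badIndicator K θ γ δ ε (lowerLevel δ γ * τ))
      (((2 : ℝ) ^ K) ^ 7)⁻¹ := by
  have hm := (measurableSet_goodEvent (K := K) (θ := θ) (γ := γ) (δ := δ) (ε := ε)
    (lowerLevel δ γ * τ)).compl
  refine ⟨(integrable_const (1 : ℝ)).indicator hm, ?_⟩
  rw [HeteroReg.badIndicator, integral_indicator_one hm]
  exact ENNReal.toReal_le_of_le_ofReal (by positivity)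
    (measure_compl_goodEvent_le hθ hγ hε hK hτ hσ)

end GoodEvent

/-! ### Conditional bounds for the selected model, on and off the good event. -/

section Selected

variable {K : ℕ} {θ γ δ ε τ : ℝ} {s σ : Fin (2 ^ K) → ℝ}
  {mhat : (Fin (2 ^ K) → ℝ) × (Fin (2 ^ K) → ℝ) → ℕ × ℕ}

/-- The Kullback-Leibler loss of the estimators of the model `m`. -/
def modelLoss (K : ℕ) (s σ : Fin (2 ^ K) → ℝ) (m : ℕ × ℕ)
    (y : (Fin (2 ^ K) → ℝ) × (Fin (2 ^ K) → ℝ)) : ℝ :=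
  kullback s σ (meanEst K m y.1) (varEst K m y.2)

lemma selectedLoss_eq (y : (Fin (2 ^ K) → ℝ) × (Fin (2 ^ K) → ℝ)) :
    selectedLoss K mhat s σ y = (1 / (2 : ℝ) ^ K) * modelLoss K s σ (mhat y) y := by
  simp [selectedLoss, kullbackN, modelLoss]

lemma measurable_modelLoss (m : ℕ × ℕ) : Measurable (modelLoss K s σ m) := by
  unfold modelLoss kullback phi meanEst
  have h1 : ∀ i, Measurable fun y : Fin (2 ^ K) → ℝ => proj K m y i :=
    fun i => (measurable_pi_apply i).comp (measurable_proj m)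
  have h2 : ∀ i, Measurable fun y : Fin (2 ^ K) → ℝ => varEst K m y i :=
    fun i => (measurable_pi_apply i).comp (measurable_varEst m)
  fun_prop

lemma measurable_apply_of_countable {Ω ι β : Type*} [MeasurableSpace Ω] [MeasurableSpace ι]
    [MeasurableSpace β] [Countable ι] [MeasurableSingletonClass ι] {F : ι → Ω → β}
    (hF : ∀ m, Measurable (F m)) {g : Ω → ι} (hg : Measurable g) :
    Measurable fun y => F (g y) y :=
  (measurable_from_prod_countable_left (f := fun p : Ω × ι => F p.2 p.1) hF).comp
    (measurable_id.prodMk hg)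

lemma measurable_modelLoss_selected (hm : Measurable mhat) :
    Measurable fun y => modelLoss K s σ (mhat y) y :=
  measurable_apply_of_countable measurable_modelLoss hm

lemma varEst_fine_congr {m : ℕ × ℕ} (hm : m.1 + m.2 ≤ K) (y : Fin (2 ^ K) → ℝ)
    (i j : Fin (2 ^ K)) (h : blockIndex K (m.1 + m.2) j = blockIndex K (m.1 + m.2) i) :
    varEst K m y j = varEst K m y i :=
  varEst_congr (blockIndex_eq_of_le (Nat.le_add_right m.1 m.2) hm h) y

lemma ae_forall_varEst_pos (hθ : 1 < θ) (hγ : 1 ≤ γ) (hτ : 0 < τ) (hσ : ∀ i, τ ≤ σ i) :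
    ∀ᵐ y ∂(gaussLaw s σ), ∀ m ∈ models K θ γ δ ε, ∀ i, 0 < varEst K m y i := by
  rw [ae_all_iff]
  intro m
  by_cases hm : m ∈ models K θ γ δ ε
  · have h := fun i => ae_varEst_pos (s := s) m (add_lt_of_mem_models hθ hγ hm)
      (add_three_le_of_mem_models hθ hγ hm) hτ hσ i
    rw [← ae_all_iff] at h
    exact h.mono fun y hy _ => hy
  · exact Filter.Eventually.of_forall fun y h => absurd h hm

lemma modelLoss_nonneg {m : ℕ × ℕ} (hσ : ∀ i, 0 < σ i)
    {y : (Fin (2 ^ K) → ℝ) × (Fin (2 ^ K) → ℝ)} (hv : ∀ i, 0 < varEst K m y.2 i) :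
    0 ≤ modelLoss K s σ m y :=
  mul_nonneg (by norm_num) (Finset.sum_nonneg fun i _ =>
    add_nonneg (div_nonneg (sq_nonneg _) (hv i).le) (phi_div_nonneg (hσ i) (hv i)))

/-- A bound of the total contribution of the noise of the first observation. -/
def noiseBound (γ c ε : ℝ) : ℝ :=
  2 + 4 * (66 * (γ / c + 1)) + 2 * (2 * (4 * γ / c) * Real.exp ((4 * γ / c) ^ (1 / ε)))

/-- The oracle inequality, conditionally on the second observation. -/
lemma IntegralLE.modelLoss_selected_of_good (hθ : 1 < θ) (hγ : 1 ≤ γ) (hε : 0 < ε) (hτ : 0 < τ)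
    (hσ : ∀ i, τ ≤ σ i) (hσ' : ∀ i, σ i ≤ γ * τ) {c : ℝ} (hc : 0 < c)
    (hsel : IsSelector K θ γ δ ε mhat) {y₂ : Fin (2 ^ K) → ℝ}
    (hy : y₂ ∈ goodEvent K θ γ δ ε (c * τ)) {m₀ : ℕ × ℕ} (hm₀ : m₀ ∈ models K θ γ δ ε) :
    IntegralLE (gaussLaw s σ) (fun y₁ => modelLoss K s σ (mhat (y₁, y₂)) (y₁, y₂))
      (3 * biasLoss K m₀ s σ (varEst K m₀ y₂) + 2 * pen θ γ ε m₀ +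
        noiseBound γ c ε * ((K : ℝ) + 1) ^ 2) := by
  have hσ0 : ∀ i, 0 < σ i := fun i => hτ.trans_le (hσ i)
  have hpos : ∀ m ∈ models K θ γ δ ε, ∀ i, 0 < varEst K m y₂ i := fun m hm i =>
    lt_of_lt_of_le (by positivity) (hy m hm i)
  have hV : ∀ m ∈ models K θ γ δ ε, ∀ i, σ i / varEst K m y₂ i ≤ γ / c := by
    intro m hm i
    rw [div_le_div_iff₀ (hpos m hm i) hc]
    calc σ i * c ≤ γ * τ * c := by gcongr; exact hσ' i
      _ = γ * (c * τ) := by ring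
      _ ≤ _ := by gcongr; exact hy m hm i
  set N₁ := 66 * (γ / c + 1) with hN₁
  set N₂ := 2 * (4 * γ / c) * Real.exp ((4 * γ / c) ^ (1 / ε)) with hN₂
  have hN₁0 : 0 ≤ N₁ := by positivity
  have hN₂0 : 0 ≤ N₂ := by positivity
  have hterm : ∀ m ∈ modelFinset K θ γ δ ε, IntegralLE (gaussLaw s σ) (fun y₁ =>
      HeteroReg.noiseTerm K m s σ (varEst K m y₂) y₁ +
        max (noiseProj K m s (varEst K m y₂) y₁ - pen θ γ ε m) 0) (N₁ + N₂) := by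
    intro m hm
    rw [mem_modelFinset] at hm
    exact (IntegralLE.noiseTerm hσ0 (hpos m hm) (hV m hm)).add
      (IntegralLE.noiseProj_sub_pen hm.1 hτ hγ hθ hε hc hσ hσ' (hy m hm))
  have key := ((IntegralLE.const (μ := gaussLaw s σ)
    (3 * biasLoss K m₀ s σ (varEst K m₀ y₂) + 2 * pen θ γ ε m₀ + 2)).add
    ((IntegralLE.sum hterm).const_mul (c := 2) (by norm_num))).add
    ((IntegralLE.noiseTerm (m := m₀) hσ0 (hpos m₀ hm₀) (hV m₀ hm₀)).const_mul (c := 2)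
      (by norm_num))
  refine (key.mono ?_ (Filter.Eventually.of_forall fun y₁ => ?_)
    (Filter.Eventually.of_forall fun y₁ => ?_)).weaken ?_
  · exact ((measurable_modelLoss_selected hsel.measurable).comp
      measurable_prodMk_right).aestronglyMeasurable
  · exact modelLoss_nonneg hσ0 (hpos _ (hsel.mem _))
  · have hm := hsel.mem (y₁, y₂)
    have h1 := hsel.minimal (y₁, y₂) hpos m₀ hm₀
    refine (kullback_le_of_crit_le (s := s) (σ := σ) hm.1 hm₀.1 hσ0 (hpos _ hm) (hpos _ hm₀)
      (varEst_fine_congr hm.1 y₂) (varEst_fine_congr hm₀.1 y₂) h1).trans ?_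
    -- The selected model depends on the noise, so its noise terms are replaced by the sum over the
    -- whole collection.
    have h2 := Finset.single_le_sum (f := fun m =>
      HeteroReg.noiseTerm K m s σ (varEst K m y₂) y₁ +
        max (noiseProj K m s (varEst K m y₂) y₁ - pen θ γ ε m) 0)
      (fun m hm' => add_nonneg (noiseTerm_nonneg hσ0 (hpos m (mem_modelFinset.1 hm')) y₁)
        (le_max_right _ _)) (mem_modelFinset.2 hm)
    linarith
  · rw [Finset.sum_const, nsmul_eq_mul]
    have h1 := card_modelFinset_le (K := K) (θ := θ) (γ := γ) (δ := δ) (ε := ε)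
    have h2 : (1 : ℝ) ≤ ((K : ℝ) + 1) ^ 2 := by
      have : (0 : ℝ) ≤ K := by positivity
      nlinarith
    have h3 : noiseBound γ c ε = 2 + 4 * N₁ + 2 * N₂ := rfl
    rw [h3]
    have h4 := mul_le_mul_of_nonneg_right h1 (add_nonneg hN₁0 hN₂0)
    nlinarith

lemma bias_sq_le {m : ℕ × ℕ} (hm : m.1 + m.2 ≤ K) {A : ℝ}
    (hA : ∀ i j, blockIndex K m.1 j = blockIndex K m.1 i → |s i - s j| ≤ A) (i : Fin (2 ^ K)) :
    bias K m s i ^ 2 ≤ A ^ 2 := by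
  have h := abs_sub_blockAvg_le (y := s) (A := A) (i := i) hm fun l hl =>
    hA i l (blockIndex_eq_of_le (Nat.le_add_right m.1 m.2) hm hl)
  rw [← sq_abs]
  exact pow_le_pow_left₀ (abs_nonneg _) h 2

lemma biasLoss_le {m : ℕ × ℕ} (hm : m.1 + m.2 ≤ K) (hτ : 0 < τ) (hσ : ∀ i, τ ≤ σ i) {A c : ℝ}
    (hA : ∀ i j, blockIndex K m.1 j = blockIndex K m.1 i → |s i - s j| ≤ A) (hc : 0 < c)
    {v : Fin (2 ^ K) → ℝ} (hv : ∀ i, c * τ ≤ v i) :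
    biasLoss K m s σ v ≤ ∑ i, (A ^ 2 / (c * τ) + (c * τ ^ 2)⁻¹ * (v i - σ i) ^ 2) := by
  have hct : 0 < c * τ := by positivity
  have h0 : ∀ i, 0 ≤ A ^ 2 / (c * τ) + (c * τ ^ 2)⁻¹ * (v i - σ i) ^ 2 := fun i => by positivity
  have h1 : ∑ i, (bias K m s i ^ 2 / v i + phi (v i / σ i)) ≤
      ∑ i, (A ^ 2 / (c * τ) + (c * τ ^ 2)⁻¹ * (v i - σ i) ^ 2) := by
    refine Finset.sum_le_sum fun i _ => add_le_add ?_ ?_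
    · exact div_le_div₀ (sq_nonneg _) (bias_sq_le hm hA i) hct (hv i)
    · have hvi := hct.trans_le (hv i)
      refine (phi_div_le_sq (hτ.trans_le (hσ i)) hvi).trans ?_
      rw [inv_mul_eq_div]
      refine div_le_div_of_nonneg_left (sq_nonneg _) (by positivity) ?_
      calc c * τ ^ 2 = c * τ * τ := by ring
        _ ≤ _ := mul_le_mul (hv i) (hσ i) hτ.le hvi.le
  have h2 := Finset.sum_nonneg fun i (_ : i ∈ Finset.univ) => h0 i
  unfold biasLoss
  linarith

/-- A crude bound, meant for the bad event: it requires only positive variance estimators and is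
linear in `τ / v` and `v / τ`. -/
lemma IntegralLE.modelLoss {m : ℕ × ℕ} (hm : m.1 + m.2 ≤ K) (hγ : 1 ≤ γ) (hτ : 0 < τ)
    (hσ : ∀ i, τ ≤ σ i) (hσ' : ∀ i, σ i ≤ γ * τ) {A : ℝ} (hA : ∀ i j, |s i - s j| ≤ A)
    {y₂ : Fin (2 ^ K) → ℝ} (hv : ∀ i, 0 < varEst K m y₂ i) :
    IntegralLE (gaussLaw s σ) (fun y₁ => modelLoss K s σ m (y₁, y₂))
      (∑ i, ((A ^ 2 / τ + 2 * γ) * (τ / varEst K m y₂ i) + varEst K m y₂ i / τ)) := by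
  have hσ0 : ∀ i, 0 ≤ σ i := fun i => hτ.le.trans (hσ i)
  set v := varEst K m y₂
  have h1 : IntegralLE (gaussLaw s σ) (noiseProj K m s v) (∑ i, (v i)⁻¹ * (γ * τ)) := by
    have h : ∀ i ∈ Finset.univ, IntegralLE (gaussLaw s σ) (fun y => (v i)⁻¹ *
        blockAvg K (m.1 + m.2) (fun j => y j - s j) i ^ 2) ((v i)⁻¹ * (γ * τ)) := by
      intro i _
      refine IntegralLE.const_mul ?_ (inv_nonneg.2 (hv i).le)
      simp only [blockAvg_eq_sum]
      refine (IntegralLE.linear_sq hσ0 _).weaken ((sum_blockWeight_sq_mul_le hm hσ' i).trans ?_)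
      exact mul_le_of_le_one_right (by positivity) (inv_le_one_of_one_le₀
        (one_le_pow₀ (by norm_num)))
    refine (IntegralLE.sum h).mono (measurable_noiseProj m s v).aestronglyMeasurable
      (Filter.Eventually.of_forall fun y => noiseProj_nonneg hv y)
      (Filter.Eventually.of_forall fun y => le_of_eq ?_)
    exact Finset.sum_congr rfl fun i _ => div_eq_inv_mul _ _
  have e : (fun y₁ => HeteroReg.modelLoss K s σ m (y₁, y₂)) =
      fun y => biasLoss K m s σ v + (1 / 2) * noiseProj K m s v y := by
    ext y
    exact kullback_meanEst_eq hm (varEst_fine_congr hm y₂) y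
  rw [e]
  refine ((IntegralLE.const _).add (h1.const_mul (by norm_num))).weaken ?_
  rw [biasLoss, ← mul_add, ← Finset.sum_add_distrib, Finset.mul_sum]
  refine Finset.sum_le_sum fun i _ => ?_
  have hvi := hv i
  have hsi := hτ.trans_le (hσ i)
  have h2 : bias K m s i ^ 2 / v i ≤ A ^ 2 / τ * (τ / v i) := by
    rw [div_mul_div_cancel₀ hτ.ne']
    exact div_le_div_of_nonneg_right (bias_sq_le hm (fun i j _ => hA i j) i) hvi.le
  have h3 : phi (v i / σ i) ≤ v i / τ + γ * (τ / v i) := by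
    have h4 := Real.log_le_sub_one_of_pos (div_pos hvi hsi)
    have h5 : v i / σ i ≤ v i / τ := div_le_div_of_nonneg_left hvi.le hτ (hσ i)
    have h6 : σ i / v i ≤ γ * (τ / v i) := by
      rw [← mul_div_assoc]
      exact div_le_div_of_nonneg_right (hσ' i) hvi.le
    rw [phi, one_div_div]
    linarith
  have h7 : (v i)⁻¹ * (γ * τ) = γ * (τ / v i) := by ring
  have h8 : 0 < τ / v i := by positivity
  have h9 : 0 < v i / τ := by positivity
  have h10 : 0 ≤ A ^ 2 / τ * (τ / v i) := by positivity
  rw [h7]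
  nlinarith

lemma IntegralLE.modelLoss_selected_of_pos (hγ : 1 ≤ γ) (hτ : 0 < τ)
    (hσ : ∀ i, τ ≤ σ i) (hσ' : ∀ i, σ i ≤ γ * τ) {A : ℝ} (hA : ∀ i j, |s i - s j| ≤ A)
    (hsel : IsSelector K θ γ δ ε mhat)
    {y₂ : Fin (2 ^ K) → ℝ} (hv : ∀ m ∈ models K θ γ δ ε, ∀ i, 0 < varEst K m y₂ i) :
    IntegralLE (gaussLaw s σ) (fun y₁ => HeteroReg.modelLoss K s σ (mhat (y₁, y₂)) (y₁, y₂))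
      (∑ m ∈ modelFinset K θ γ δ ε,
        ∑ i, ((A ^ 2 / τ + 2 * γ) * (τ / varEst K m y₂ i) + varEst K m y₂ i / τ)) := by
  have hσ0 : ∀ i, 0 < σ i := fun i => hτ.trans_le (hσ i)
  refine (IntegralLE.sum (F := fun m y₁ => HeteroReg.modelLoss K s σ m (y₁, y₂))
    fun m hm => IntegralLE.modelLoss (mem_modelFinset.1 hm).1 hγ hτ hσ hσ' hA
      (hv m (mem_modelFinset.1 hm))).mono ?_ (Filter.Eventually.of_forall fun y₁ => ?_)
    (Filter.Eventually.of_forall fun y₁ => ?_)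
  · exact ((measurable_modelLoss_selected hsel.measurable).comp
      measurable_prodMk_right).aestronglyMeasurable
  · exact modelLoss_nonneg hσ0 (hv _ (hsel.mem _))
  · exact Finset.single_le_sum (f := fun m => HeteroReg.modelLoss K s σ m (y₁, y₂))
      (fun m hm => modelLoss_nonneg hσ0 (hv m (mem_modelFinset.1 hm)))
      (mem_modelFinset.2 (hsel.mem _))

end Selected

/-! ### The oracle inequality. -/

section Oracle

variable {K : ℕ} {θ γ δ ε τ σmin L₁ L₂ h : ℝ} {s σ : Fin (2 ^ K) → ℝ}
  {mhat : (Fin (2 ^ K) → ℝ) × (Fin (2 ^ K) → ℝ) → ℕ × ℕ}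

/-- The constant of the quadratic risk of the variance estimators. -/
def riskConst (L₁ L₂ γ σmin : ℝ) : ℝ :=
  5 * (L₂ ^ 2 / σmin ^ 2 + L₁ ^ 4 / σmin ^ 2 + 4 * (L₁ ^ 2 * γ / σmin) + 128 * γ ^ 2)

lemma riskConst_nonneg (hγ : 1 ≤ γ) (hσmin : 0 < σmin) : 0 ≤ riskConst L₁ L₂ γ σmin := by
  unfold riskConst; positivity

/-- Factors `τ / σmin ≥ 1` are inserted to make every term homogeneous in `τ`; `h ≤ 1` reduces the
powers of `h` to the square. -/
lemma IntegralLE.varEst_sub_sq_of_holder (m : ℕ × ℕ) (hm : m.1 + m.2 ≤ K) (hσmin : 0 < σmin)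
    (hτ : σmin ≤ τ) (hγ : 1 ≤ γ) (hσ : ∀ i, τ ≤ σ i) (hσ' : ∀ i, σ i ≤ γ * τ)
    (h0 : 0 ≤ h) (h1 : h ≤ 1)
    (hA : ∀ i j, blockIndex K m.1 j = blockIndex K m.1 i → |s i - s j| ≤ L₁ * h)
    (hB : ∀ i j, blockIndex K m.1 j = blockIndex K m.1 i → |σ i - σ j| ≤ L₂ * h)
    (i : Fin (2 ^ K)) :
    IntegralLE (gaussLaw s σ) (fun y => (varEst K m y i - σ i) ^ 2)
      (riskConst L₁ L₂ γ σmin * τ ^ 2 * (h ^ 2 + (2 ^ (K - (m.1 + m.2)))⁻¹)) := by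
  have hτ0 : 0 < τ := hσmin.trans_le hτ
  refine (IntegralLE.varEst_sub_sq m hm hτ0 hγ hσ hσ' hA hB i).weaken ?_
  set Q : ℝ := (2 ^ (K - m.1))⁻¹ with hQ
  set q : ℝ := (2 ^ (K - (m.1 + m.2)))⁻¹ with hq
  have hQ0 : 0 ≤ Q := by positivity
  have hq0 : 0 ≤ q := by positivity
  have hq1 : q ≤ 1 := inv_le_one_of_one_le₀ (one_le_pow₀ (by norm_num))
  have hQq : Q ≤ q := inv_anti₀ (by positivity) (pow_le_pow_right₀ (by norm_num) (by omega))
  have hr : 1 ≤ τ / σmin := (one_le_div hσmin).2 hτ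
  have e : riskConst L₁ L₂ γ σmin * τ ^ 2 * (h ^ 2 + q) =
      5 * ((L₂ * h) ^ 2 * (τ / σmin) ^ 2 + L₁ ^ 4 * h ^ 2 * (τ / σmin) ^ 2 +
        4 * (L₁ ^ 2 * h ^ 2 * (γ * τ) * (τ / σmin)) + 128 * (γ ^ 2 * τ ^ 2 * q) +
        (L₂ ^ 2 * (τ / σmin) ^ 2 * q + L₁ ^ 4 * (τ / σmin) ^ 2 * q +
          4 * (L₁ ^ 2 * (γ * τ) * (τ / σmin) * q) + 128 * (γ ^ 2 * τ ^ 2 * h ^ 2))) := by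
    unfold riskConst
    field_simp
    ring
  rw [e]
  have hr2 : 1 ≤ (τ / σmin) ^ 2 := one_le_pow₀ hr
  have hh : h ^ 4 ≤ h ^ 2 := pow_le_pow_of_le_one h0 h1 (by norm_num)
  have t1 : (L₂ * h) ^ 2 ≤ (L₂ * h) ^ 2 * (τ / σmin) ^ 2 := le_mul_of_one_le_right (sq_nonneg _) hr2
  have t2 : (L₁ * h) ^ 4 ≤ L₁ ^ 4 * h ^ 2 * (τ / σmin) ^ 2 := by
    rw [mul_pow]
    calc _ ≤ L₁ ^ 4 * h ^ 2 := by gcongr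
      _ ≤ _ := le_mul_of_one_le_right (by positivity) hr2
  have t3 : (L₁ * h) ^ 2 * (γ * τ) * Q ≤ L₁ ^ 2 * h ^ 2 * (γ * τ) * (τ / σmin) := by
    rw [mul_pow]
    gcongr
    linarith
  have t4 : (γ * τ) ^ 2 * Q ≤ γ ^ 2 * τ ^ 2 * q := by rw [mul_pow]; gcongr
  have t5 : (γ * τ * q) ^ 2 ≤ γ ^ 2 * τ ^ 2 * q := by
    rw [mul_pow, mul_pow]
    gcongr
    nlinarith
  have t6 : 0 ≤ L₂ ^ 2 * (τ / σmin) ^ 2 * q + L₁ ^ 4 * (τ / σmin) ^ 2 * q +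
          4 * (L₁ ^ 2 * (γ * τ) * (τ / σmin) * q) + 128 * (γ ^ 2 * τ ^ 2 * h ^ 2) := by
    positivity
  linarith

/-- The constant of the contribution to the risk of the small variance estimators. -/
def badConst (L₁ L₂ γ σmin : ℝ) : ℝ :=
  (L₁ ^ 2 / σmin + 2 * γ) * (1 + 4 * (invRootBound ^ 4).toReal) +
    (1 + (4 * riskConst L₁ L₂ γ σmin + 2 * γ ^ 2))

lemma IntegralLE.badIndicator_mul (hθ : 1 < θ) (hγ : 1 ≤ γ) (hε : 0 < ε)
    (hK : 1 ≤ Real.log ((2 : ℝ) ^ K)) (hσmin : 0 < σmin)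
    (hτ : σmin ≤ τ) (hσ : ∀ i, τ ≤ σ i) (hσ' : ∀ i, σ i ≤ γ * τ)
    (hA : ∀ i j, |s i - s j| ≤ L₁) (hB : ∀ i j, |σ i - σ j| ≤ L₂)
    {m : ℕ × ℕ} (hm : m ∈ models K θ γ δ ε) (i : Fin (2 ^ K)) :
    IntegralLE (gaussLaw s σ) (fun y => HeteroReg.badIndicator K θ γ δ ε (lowerLevel δ γ * τ) y *
      ((L₁ ^ 2 / τ + 2 * γ) * (τ / varEst K m y i) + varEst K m y i / τ))
      (badConst L₁ L₂ γ σmin * (2 ^ K)⁻¹) := by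
  have hτ0 : 0 < τ := hσmin.trans_le hτ
  set N : ℝ := 2 ^ K with hN
  have hN1 : 1 ≤ N := one_le_pow₀ (by norm_num)
  have hN0 : 0 < N := by positivity
  have hrc := riskConst_nonneg (L₁ := L₁) (L₂ := L₂) hγ hσmin
  set rc := riskConst L₁ L₂ γ σmin with hrcdef
  set B : ℝ := (invRootBound ^ 4).toReal with hBdef
  have hB0 : 0 ≤ B := ENNReal.toReal_nonneg
  have hbad := IntegralLE.badIndicator (s := s) (δ := δ) hθ hγ hε hK hτ0 hσ
  have hinv := IntegralLE.div_varEst_rpow (s := s) m (add_lt_of_mem_models hθ hγ hm)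
    (add_three_le_of_mem_models hθ hγ hm) hτ0 hσ i
  have hsq := IntegralLE.varEst_sub_sq_of_holder (h := 1) (s := s) (L₁ := L₁) (L₂ := L₂) m hm.1 hσmin hτ hγ hσ hσ' zero_le_one
    le_rfl (fun i j _ => by rw [mul_one]; exact hA i j)
    (fun i j _ => by rw [mul_one]; exact hB i j) i
  set a := L₁ ^ 2 / τ + 2 * γ with ha
  have ha0 : 0 ≤ a := by positivity
  -- Truncation at `N ^ 6`: `x ≤ N ^ 6 + N ^ (-3) x ^ (3/2)` for `x = τ / v`, and `z ≤ N ^ 6 + N ^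
  -- (-6) z ^ 2` for `z = v / τ`. The constants are kept on the bad event only, of probability at
  -- most `N ^ (-7)`, so all contributions are of order at most `1 / N`.
  have key := (((hbad.const_mul (c := N ^ 6) (by positivity)).add
    (hinv.const_mul (c := (N ^ 3)⁻¹) (by positivity))).const_mul ha0).add
    ((hbad.const_mul (c := N ^ 6) (by positivity)).add
    (((hsq.const_mul (c := 2 / τ ^ 2) (by positivity)).add
      (IntegralLE.const (2 * γ ^ 2))).const_mul (c := (N ^ 6)⁻¹) (by positivity)))
  refine (key.mono ?_ (Filter.Eventually.of_forall fun y => ?_)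
    (Filter.Eventually.of_forall fun y => ?_)).weaken ?_
  · have h1 : Measurable fun y : Fin (2 ^ K) → ℝ => varEst K m y i :=
      (measurable_pi_apply i).comp (measurable_varEst m)
    have h2 : Measurable (HeteroReg.badIndicator K θ γ δ ε (lowerLevel δ γ * τ)) :=
      measurable_one.indicator (measurableSet_goodEvent _).compl
    exact (h2.mul (by fun_prop)).aestronglyMeasurable
  · have hv := varEst_nonneg m y i
    refine mul_nonneg (Set.indicator_nonneg (fun _ _ => zero_le_one) y) (by positivity)
  · have hv := varEst_nonneg m y i
    have hx : 0 ≤ τ / varEst K m y i := by positivity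
    have hz : 0 ≤ varEst K m y i / τ := by positivity
    have hzsq : (varEst K m y i / τ) ^ 2 ≤
        2 / τ ^ 2 * (varEst K m y i - σ i) ^ 2 + 2 * γ ^ 2 := by
      have h3 : σ i ^ 2 ≤ γ ^ 2 * τ ^ 2 := by
        rw [← mul_pow]; exact pow_le_pow_left₀ (hτ0.le.trans (hσ i)) (hσ' i) 2
      have h4 : 2 * γ ^ 2 = 2 / τ ^ 2 * (γ ^ 2 * τ ^ 2) := by field_simp
      rw [h4, ← mul_add, div_pow, div_eq_mul_inv, div_eq_mul_inv, mul_comm 2, mul_assoc,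
        mul_comm]
      refine mul_le_mul_of_nonneg_left ?_ (by positivity)
      nlinarith [sq_nonneg (varEst K m y i - 2 * σ i)]
    have hxr : 0 ≤ (τ / varEst K m y i) ^ (3 / 2 : ℝ) := Real.rpow_nonneg hx _
    by_cases hy : y ∈ (goodEvent K θ γ δ ε (lowerLevel δ γ * τ))ᶜ
    · rw [HeteroReg.badIndicator, Set.indicator_of_mem hy, Pi.one_apply, one_mul, mul_one]
      refine add_le_add (mul_le_mul_of_nonneg_left ?_ ha0) ?_
      · set x := τ / varEst K m y i
        rcases le_or_gt x (N ^ 6) with h5 | h5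
        · have : 0 ≤ (N ^ 3)⁻¹ * x ^ (3 / 2 : ℝ) := by positivity
          linarith
        · have hxp : 0 < x := lt_trans (by positivity) h5
          have h6 : N ^ 3 ≤ x ^ (1 / 2 : ℝ) := by
            rw [← Real.sqrt_eq_rpow]
            refine Real.le_sqrt_of_sq_le ?_
            rw [← pow_mul]
            exact h5.le
          have h7 : x ^ (3 / 2 : ℝ) = x * x ^ (1 / 2 : ℝ) := by
            rw [← Real.rpow_one_add' hx (by norm_num)]; norm_num
          have h8 : x ≤ (N ^ 3)⁻¹ * x ^ (3 / 2 : ℝ) := by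
            rw [h7, le_inv_mul_iff₀ (by positivity), mul_comm]
            exact mul_le_mul_of_nonneg_left h6 hx
          have : 0 < N ^ 6 := by positivity
          linarith
      · set z := varEst K m y i / τ
        rcases le_or_gt z (N ^ 6) with h5 | h5
        · have : 0 ≤ (N ^ 6)⁻¹ * (2 / τ ^ 2 * (varEst K m y i - σ i) ^ 2 + 2 * γ ^ 2) := by
            positivity
          linarith
        · have h8 : z ≤ (N ^ 6)⁻¹ * z ^ 2 := by
            rw [le_inv_mul_iff₀ (by positivity), pow_two]
            exact mul_le_mul_of_nonneg_right h5.le hz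
          have h9 : (N ^ 6)⁻¹ * z ^ 2 ≤
              (N ^ 6)⁻¹ * (2 / τ ^ 2 * (varEst K m y i - σ i) ^ 2 + 2 * γ ^ 2) := by gcongr
          have : 0 < N ^ 6 := by positivity
          linarith
    · rw [HeteroReg.badIndicator, Set.indicator_of_notMem hy, zero_mul, mul_zero]
      positivity
  · have haM : a ≤ L₁ ^ 2 / σmin + 2 * γ := by
      rw [ha]; gcongr
    have h6 : N ^ 6 * (N ^ 7)⁻¹ = N⁻¹ := by field_simp
    have h7 : (N ^ 3)⁻¹ * ((2 * N) ^ (3 / 2 : ℝ) * B) ≤ 4 * B * N⁻¹ := by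
      have h8 : (2 * N) ^ (3 / 2 : ℝ) ≤ (2 * N) ^ 2 := by
        rw [← Real.rpow_natCast]
        exact Real.rpow_le_rpow_of_exponent_le (by linarith) (by norm_num)
      calc _ ≤ (N ^ 3)⁻¹ * ((2 * N) ^ 2 * B) := by gcongr
        _ = _ := by field_simp; ring
    have h9 : (N ^ 6)⁻¹ ≤ N⁻¹ := by
      refine inv_anti₀ hN0 ?_
      calc N = N ^ 1 := (pow_one N).symm
        _ ≤ N ^ 6 := pow_le_pow_right₀ hN1 (by norm_num)
    have hq1 : ((2 : ℝ) ^ (K - (m.1 + m.2)))⁻¹ ≤ 1 :=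
      inv_le_one_of_one_le₀ (one_le_pow₀ (by norm_num))
    have h10 : 2 / τ ^ 2 * (rc * τ ^ 2 * (1 ^ 2 + (2 ^ (K - (m.1 + m.2)))⁻¹)) ≤ 4 * rc := by
      calc _ = 2 * rc * (1 ^ 2 + (2 ^ (K - (m.1 + m.2)))⁻¹) := by field_simp
        _ ≤ 2 * rc * (1 ^ 2 + 1) := by gcongr
        _ = _ := by ring
    rw [h6]
    have hNi : 0 ≤ N⁻¹ := by positivity
    calc _ ≤ (L₁ ^ 2 / σmin + 2 * γ) * (N⁻¹ + 4 * B * N⁻¹) +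
          (N⁻¹ + N⁻¹ * (4 * rc + 2 * γ ^ 2)) := by
          refine add_le_add (mul_le_mul haM (by linarith) (by positivity) (by positivity))
            (add_le_add le_rfl (mul_le_mul h9 (by linarith) (by positivity) hNi))
      _ = _ := by unfold badConst; ring

lemma pen_nonneg (hγ : 1 ≤ γ) (hθ : 1 < θ) (m : ℕ × ℕ) : 0 ≤ pen θ γ ε m := by
  have h1 : 0 ≤ Real.log (modelDim m : ℝ) ^ (1 + ε) :=
    Real.rpow_nonneg (Real.log_nonneg (one_le_modelDim m)) _
  unfold pen
  positivity

/-- The oracle inequality. -/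
theorem IntegralLE.selectedLoss (hθ : 1 < θ) (hγ : 1 ≤ γ) (hε : 0 < ε)
    (hK : 1 ≤ Real.log ((2 : ℝ) ^ K)) (hσmin : 0 < σmin)
    (hτ : σmin ≤ τ) (hσ : ∀ i, τ ≤ σ i) (hσ' : ∀ i, σ i ≤ γ * τ)
    (hA : ∀ i j, |s i - s j| ≤ L₁) (hB : ∀ i j, |σ i - σ j| ≤ L₂)
    (hsel : IsSelector K θ γ δ ε mhat)
    {m₀ : ℕ × ℕ} (hm₀ : m₀ ∈ models K θ γ δ ε) (h0 : 0 ≤ h) (h1 : h ≤ 1)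
    (hA₀ : ∀ i j, blockIndex K m₀.1 j = blockIndex K m₀.1 i → |s i - s j| ≤ L₁ * h)
    (hB₀ : ∀ i j, blockIndex K m₀.1 j = blockIndex K m₀.1 i → |σ i - σ j| ≤ L₂ * h) :
    IntegralLE ((gaussLaw s σ).prod (gaussLaw s σ)) (selectedLoss K mhat s σ)
      (3 * (L₁ ^ 2 / (lowerLevel δ γ * σmin) * h ^ 2 +
        riskConst L₁ L₂ γ σmin / lowerLevel δ γ * (h ^ 2 + (2 ^ (K - (m₀.1 + m₀.2)))⁻¹)) +
        2 * pen θ γ ε m₀ / 2 ^ K +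
        (noiseBound γ (lowerLevel δ γ) ε + badConst L₁ L₂ γ σmin) * ((K + 1) ^ 2 / 2 ^ K)) := by
  have hτ0 : 0 < τ := hσmin.trans_le hτ
  have hσ0 : ∀ i, 0 < σ i := fun i => hτ0.trans_le (hσ i)
  have hc := lowerLevel_pos δ γ
  set c := lowerLevel δ γ
  set N : ℝ := 2 ^ K with hN
  have hN0 : 0 < N := by positivity
  set A : ℝ := L₁ * h
  set nb := noiseBound γ c ε
  have hpen := pen_nonneg (ε := ε) hγ hθ m₀
  have hrc := riskConst_nonneg (L₁ := L₁) (L₂ := L₂) hγ hσmin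
  have hnb : 0 ≤ nb := by simp only [nb, noiseBound]; positivity
  have hbc : 0 ≤ badConst L₁ L₂ γ σmin := by
    unfold badConst; positivity
  set F : (Fin (2 ^ K) → ℝ) → ℝ := fun y =>
    ∑ m ∈ modelFinset K θ γ δ ε, ∑ i, HeteroReg.badIndicator K θ γ δ ε (c * τ) y *
      ((L₁ ^ 2 / τ + 2 * γ) * (τ / varEst K m y i) + varEst K m y i / τ) with hF
  have hFint : IntegralLE (gaussLaw s σ) F
      (∑ _m ∈ modelFinset K θ γ δ ε, ∑ _i : Fin (2 ^ K), badConst L₁ L₂ γ σmin * N⁻¹) :=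
    IntegralLE.sum fun m hm => IntegralLE.sum fun i _ =>
      IntegralLE.badIndicator_mul hθ hγ hε hK hσmin hτ hσ hσ' hA hB (mem_modelFinset.1 hm) i
  have hF0 : ∀ y, 0 ≤ F y := fun y => Finset.sum_nonneg fun m _ => Finset.sum_nonneg fun i _ => by
    have hv := varEst_nonneg m y i
    exact mul_nonneg (Set.indicator_nonneg (fun _ _ => zero_le_one) y) (by positivity)
  set G : (Fin (2 ^ K) → ℝ) → ℝ := fun y =>
    ∑ i, (A ^ 2 / (c * τ) + (c * τ ^ 2)⁻¹ * (varEst K m₀ y i - σ i) ^ 2) with hG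
  have hG0 : ∀ y, 0 ≤ G y := fun y => Finset.sum_nonneg fun i _ => by positivity
  have hGint : IntegralLE (gaussLaw s σ) G (∑ _i : Fin (2 ^ K), (A ^ 2 / (c * τ) + (c * τ ^ 2)⁻¹ *
      (riskConst L₁ L₂ γ σmin * τ ^ 2 * (h ^ 2 + (2 ^ (K - (m₀.1 + m₀.2)))⁻¹)))) :=
    IntegralLE.sum fun i _ => (IntegralLE.const _).add
      ((IntegralLE.varEst_sub_sq_of_holder m₀ hm₀.1 hσmin hτ hγ hσ hσ' h0 h1 hA₀ hB₀ i).const_mul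
        (by positivity))
  have hH := (((hGint.const_mul (c := 3) (by norm_num)).add (IntegralLE.const
    (2 * pen θ γ ε m₀ + nb * ((K : ℝ) + 1) ^ 2))).add hFint)
  -- `G` bounds the deterministic loss of the oracle model on the good event, and `F` the loss off
  -- it; both are nonnegative, so their sum serves in both cases.
  have hinner : ∀ᵐ y₂ ∂(gaussLaw s σ), IntegralLE (gaussLaw s σ)
      (fun y₁ => HeteroReg.modelLoss K s σ (mhat (y₁, y₂)) (y₁, y₂))
      (3 * G y₂ + (2 * pen θ γ ε m₀ + nb * ((K : ℝ) + 1) ^ 2) + F y₂) := by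
    filter_upwards [ae_forall_varEst_pos hθ hγ hτ0 hσ] with y₂ hy₂
    by_cases hy : y₂ ∈ goodEvent K θ γ δ ε (c * τ)
    · refine (IntegralLE.modelLoss_selected_of_good hθ hγ hε hτ0 hσ hσ' hc hsel hy hm₀).weaken ?_
      have := biasLoss_le hm₀.1 hτ0 hσ hA₀ hc (hy m₀ hm₀)
      linarith [hF0 y₂]
    · refine (IntegralLE.modelLoss_selected_of_pos hγ hτ0 hσ hσ' hA hsel hy₂).weaken ?_
      have e : F y₂ = ∑ m ∈ modelFinset K θ γ δ ε, ∑ i,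
          ((L₁ ^ 2 / τ + 2 * γ) * (τ / varEst K m y₂ i) + varEst K m y₂ i / τ) := by
        simp only [hF, HeteroReg.badIndicator]
        rw [Set.indicator_of_mem (Set.mem_compl hy)]
        simp only [Pi.one_apply, one_mul]
      have : 0 ≤ nb * ((K : ℝ) + 1) ^ 2 := by positivity
      linarith [hG0 y₂]
  have hprod := IntegralLE.prod (μ := gaussLaw s σ) (ν := gaussLaw s σ)
    (F := fun y => HeteroReg.modelLoss K s σ (mhat y) y)
    (measurable_modelLoss_selected hsel.measurable)
    (by
      filter_upwards [ae_forall_varEst_pos hθ hγ hτ0 hσ] with y₂ hy₂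
      exact Filter.Eventually.of_forall fun y₁ =>
        modelLoss_nonneg hσ0 (hy₂ _ (hsel.mem (y₁, y₂)))) hinner hH
  have e : HeteroReg.selectedLoss K mhat s σ =
      fun y => (1 / N) * HeteroReg.modelLoss K s σ (mhat y) y := funext selectedLoss_eq
  rw [e]
  refine (hprod.const_mul (by positivity)).weaken ?_
  simp only [Finset.sum_const, Finset.card_univ, Fintype.card_fin, nsmul_eq_mul]
  push_cast
  have hcard := card_modelFinset_le (K := K) (θ := θ) (γ := γ) (δ := δ) (ε := ε)
  have e1 : (c * τ ^ 2)⁻¹ * (riskConst L₁ L₂ γ σmin * τ ^ 2 *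
      (h ^ 2 + (2 ^ (K - (m₀.1 + m₀.2)))⁻¹)) =
      riskConst L₁ L₂ γ σmin / c * (h ^ 2 + (2 ^ (K - (m₀.1 + m₀.2)))⁻¹) := by
    field_simp
  have e2 : A ^ 2 / (c * τ) ≤ L₁ ^ 2 / (c * σmin) * h ^ 2 := by
    rw [div_mul_eq_mul_div, ← mul_pow]
    gcongr
  rw [e1]
  set W := riskConst L₁ L₂ γ σmin / c * (h ^ 2 + (2 ^ (K - (m₀.1 + m₀.2)))⁻¹)
  calc _ = 3 * (A ^ 2 / (c * τ) + W) + 2 * pen θ γ ε m₀ / N + nb * (((K : ℝ) + 1) ^ 2 / N) +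
        (modelFinset K θ γ δ ε).card * (badConst L₁ L₂ γ σmin / N) := by
        rw [← hN]; field_simp; ring
    _ ≤ 3 * (L₁ ^ 2 / (c * σmin) * h ^ 2 + W) + 2 * pen θ γ ε m₀ / N +
        nb * (((K : ℝ) + 1) ^ 2 / N) + ((K : ℝ) + 1) ^ 2 * (badConst L₁ L₂ γ σmin / N) := by
        gcongr
    _ = _ := by ring

end Oracle

/-! ### Hölder bias, admissible resolutions and remainders. -/

section Rate

variable {K k : ℕ} {θ γ δ ε : ℝ}

/-- The length of a block is at most 1, so an exponent `α' ≤ α` is allowed; the smaller of the two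
exponents then serves both functions. -/
lemma abs_design_sub_le {f : ℝ → ℝ} {α α' L : ℝ} (hf : f ∈ holderBall α L) (hL : 0 ≤ L)
    (hα' : 0 < α') (hα : α' ≤ α) (hk : k ≤ K) {i j : Fin (2 ^ K)}
    (h : blockIndex K k j = blockIndex K k i) :
    |design (2 ^ K) f i - design (2 ^ K) f j| ≤ L * (((2 : ℝ) ^ k)⁻¹) ^ α' := by
  have hN : (0 : ℝ) < 2 ^ K := by positivity
  have hmem : ∀ i : Fin (2 ^ K), (((i : ℕ) + 1 : ℝ) / ((2 ^ K : ℕ) : ℝ)) ∈ Set.Icc (0 : ℝ) 1 := by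
    intro i
    refine ⟨by positivity, ?_⟩
    rw [div_le_one (by positivity)]
    exact_mod_cast i.2
  refine (hf _ (hmem i) _ (hmem j)).trans (mul_le_mul_of_nonneg_left ?_ hL)
  have hd : |((i : ℕ) + 1 : ℝ) / ((2 ^ K : ℕ) : ℝ) - ((j : ℕ) + 1 : ℝ) / ((2 ^ K : ℕ) : ℝ)| ≤
      ((2 : ℝ) ^ k)⁻¹ := by
    rw [← sub_div, abs_div]
    push_cast
    rw [abs_of_pos hN, div_le_iff₀ hN]
    have e : ((2 : ℝ) ^ k)⁻¹ * 2 ^ K = 2 ^ (K - k) := by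
      rw [inv_mul_eq_iff_eq_mul₀ (by positivity), ← pow_add]; congr 1; omega
    rw [e]
    unfold blockIndex at h
    have hi := Nat.div_add_mod (i : ℕ) (2 ^ (K - k))
    have hj := Nat.div_add_mod (j : ℕ) (2 ^ (K - k))
    rw [h] at hj
    have hi' := Nat.mod_lt (i : ℕ) (show 0 < 2 ^ (K - k) by positivity)
    have hj' := Nat.mod_lt (j : ℕ) (show 0 < 2 ^ (K - k) by positivity)
    have h1 : (i : ℕ) ≤ j + 2 ^ (K - k) := by omega
    have h2 : (j : ℕ) ≤ i + 2 ^ (K - k) := by omega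
    have h1' : ((i : ℕ) : ℝ) ≤ (j : ℕ) + 2 ^ (K - k) := by exact_mod_cast h1
    have h2' : ((j : ℕ) : ℝ) ≤ (i : ℕ) + 2 ^ (K - k) := by exact_mod_cast h2
    rw [abs_le]
    constructor <;> linarith
  calc _ ≤ (((2 : ℝ) ^ k)⁻¹) ^ α := Real.rpow_le_rpow (abs_nonneg _) hd (by linarith)
    _ ≤ _ := Real.rpow_le_rpow_of_exponent_ge (by positivity)
      (inv_le_one_of_one_le₀ (one_le_pow₀ (by norm_num))) hα

lemma modelDim_zero_right (k : ℕ) : (modelDim (k, 0) : ℝ) = 2 * 2 ^ k := by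
  simp [modelDim]; ring

/-- `(0, 0)` has the smallest dimension, hence belongs to every nonempty collection. -/
lemma zero_mem_models {m : ℕ × ℕ} (hθ : 1 < θ) (hγ : 1 ≤ γ) (hm : m ∈ models K θ γ δ ε) :
    ((0, 0) : ℕ × ℕ) ∈ models K θ γ δ ε := by
  have hD : (modelDim (0, 0) : ℝ) ≤ modelDim m := by
    refine le_trans ?_ (two_mul_two_pow_le_modelDim m)
    rw [modelDim_zero_right]
    gcongr
    · norm_num
    · omega
  refine ⟨by simp, ?_, hD.trans hm.2.2⟩
  refine le_trans ?_ hm.2.1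
  have : 0 < θ / (θ - 1) := div_pos (by linarith) (by linarith)
  gcongr

lemma le_log_of_exp_le {x : ℝ} (h : Real.exp (4 * (1 + ε) ^ 2) ≤ x) :
    4 * (1 + ε) ^ 2 ≤ Real.log x := by
  rw [← Real.log_exp (4 * (1 + ε) ^ 2)]
  exact Real.log_le_log (Real.exp_pos _) h

/-- For `l = log N`, `log l ≤ 2 √l` and `2 (1 + ε) ≤ √l` give `(1 + ε) log l ≤ l`. It ensures that
the effective sample size `X` is at least 1. -/
lemma log_rpow_le {N : ℝ} (hε : 0 < ε) (hN : 0 < N) (h : 4 * (1 + ε) ^ 2 ≤ Real.log N) :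
    Real.log N ^ (1 + ε) ≤ N := by
  set l := Real.log N
  have hl : 0 < l := lt_of_lt_of_le (by positivity) h
  have hr : 0 < √l := Real.sqrt_pos.2 hl
  have h1 : 2 * (1 + ε) ≤ √l := Real.le_sqrt_of_sq_le (by nlinarith)
  have h2 : Real.log l ≤ 2 * √l := by
    have h3 := Real.log_le_sub_one_of_pos hr
    have h4 : Real.log l = 2 * Real.log (√l) := by rw [Real.log_sqrt hl.le]; ring
    linarith
  rw [Real.rpow_def_of_pos hl]
  conv_rhs => rw [← Real.exp_log hN]
  rw [Real.exp_le_exp]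
  calc Real.log l * (1 + ε) ≤ 2 * √l * (1 + ε) := by gcongr
    _ ≤ √l * √l := by nlinarith
    _ = l := Real.mul_self_sqrt hl.le

lemma exists_two_pow_near (x : ℝ) : ∃ k : ℕ, (2 : ℝ) ^ k ≤ max 1 x ∧ x < 2 * 2 ^ k := by
  obtain ⟨k, h1, h2⟩ := exists_nat_pow_near (le_max_left 1 x) (one_lt_two)
  exact ⟨k, h1, by rw [← pow_succ']; exact (le_max_right 1 x).trans_lt h2⟩

lemma succ_sq_div_le (hK : 1 ≤ Real.log ((2 : ℝ) ^ K)) :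
    ((K : ℝ) + 1) ^ 2 / 2 ^ K ≤ 162 * ((2 : ℝ) ^ K) ^ (-(2 / 3) : ℝ) := by
  have hN : (0 : ℝ) < 2 ^ K := by positivity
  set N : ℝ := 2 ^ K with hNdef
  set l := Real.log N with hl
  have h1 : (K : ℝ) ≤ 2 * l := by
    rw [hl, hNdef, Real.log_pow]
    have := Real.log_two_gt_d9
    have : (0 : ℝ) ≤ K := by positivity
    nlinarith
  have h2 := sq_le_two_mul_exp (z := l / 3) (by positivity)
  have h3 : ((K : ℝ) + 1) ^ 2 ≤ 162 * Real.exp (l / 3) := by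
    -- `(3 l) ^ 2 = 81 (l / 3) ^ 2 ≤ 162 exp (l / 3)`.
    have : ((K : ℝ) + 1) ^ 2 ≤ (3 * l) ^ 2 := pow_le_pow_left₀ (by positivity) (by linarith) 2
    nlinarith
  have h4 : Real.exp (l / 3) = N ^ (-(2 / 3) : ℝ) * N := by
    rw [Real.rpow_def_of_pos hN]
    conv_rhs => rw [← Real.exp_log hN, Real.log_exp]
    rw [← Real.exp_add]
    congr 1
    ring
  rw [div_le_iff₀ hN, mul_assoc, ← h4]
  exact h3

/-- The level of the resolution of the oracle model, relative to the optimal one. -/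
def resolutionConst (θ γ δ : ℝ) : ℝ :=
  min (2 * (θ / (θ - 1) * (γ + 2)))⁻¹ (5 * δ * γ / 2)

lemma resolutionConst_pos (hθ : 1 < θ) (hγ : 1 ≤ γ) (hδ : 0 < δ) :
    0 < resolutionConst θ γ δ := by
  have : 0 < θ / (θ - 1) := div_pos (by linarith) (by linarith)
  unfold resolutionConst
  positivity

lemma mem_models_of_le {X : ℝ} (hθ : 1 < θ) (hγ : 1 ≤ γ)
    (hX : X = 2 ^ K / Real.log ((2 : ℝ) ^ K) ^ (1 + ε)) (hX0 : 0 < X) (hXN : X ≤ 2 ^ K)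
    (hk : (2 : ℝ) ^ k ≤ resolutionConst θ γ δ * X) : (k, 0) ∈ models K θ γ δ ε := by
  have hθ' : 1 ≤ θ / (θ - 1) := by rw [one_le_div (by linarith)]; linarith
  have hc : 3 ≤ θ / (θ - 1) * (γ + 2) := by nlinarith
  set c := θ / (θ - 1) * (γ + 2) with hcdef
  have h1 : 2 * c * 2 ^ k ≤ 2 ^ K := by
    have h2 : (2 : ℝ) ^ k ≤ (2 * c)⁻¹ * 2 ^ K := by
      refine hk.trans (mul_le_mul (min_le_left _ _) hXN hX0.le (by positivity))
    rwa [le_inv_mul_iff₀ (by positivity)] at h2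
  refine ⟨?_, ?_, ?_⟩
  · have : (2 : ℝ) ^ k ≤ 2 ^ K := by
      have : (0 : ℝ) < 2 ^ k := by positivity
      nlinarith
    simpa using (pow_le_pow_iff_right₀ (a := (2 : ℝ)) (by norm_num)).1 this
  · rw [HTheta, modelDim_zero_right, ← hcdef]
    linarith
  · rw [DimBound, modelDim_zero_right, mul_div_assoc, ← hX]
    have : (2 : ℝ) ^ k ≤ 5 * δ * γ / 2 * X :=
      hk.trans (mul_le_mul_of_nonneg_right (min_le_right _ _) hX0.le)
    linarith

/-- As `D ≤ n` and `log n ≥ 1`, both `γ θ` and `log ^ (1 + ε) D` are at most constants times `log ^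
(1 + ε) n`. -/
lemma pen_div_le (hθ : 1 < θ) (hγ : 1 ≤ γ) (hε : 0 < ε)
    (hK : 1 ≤ Real.log ((2 : ℝ) ^ K)) (hm : (k, 0) ∈ models K θ γ δ ε) :
    2 * pen θ γ ε (k, 0) / 2 ^ K ≤
      4 * (γ * θ + 1) * (2 ^ k / (2 ^ K / Real.log ((2 : ℝ) ^ K) ^ (1 + ε))) := by
  have hN : (0 : ℝ) < 2 ^ K := by positivity
  have h3 := three_mul_modelDim_le hθ hγ hm
  have h1 := one_le_modelDim (k, 0)
  set l := Real.log ((2 : ℝ) ^ K) with hl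
  have hD : Real.log (modelDim (k, 0) : ℝ) ^ (1 + ε) ≤ l ^ (1 + ε) :=
    Real.rpow_le_rpow (Real.log_nonneg h1)
      (Real.log_le_log (by linarith) (by linarith)) (by linarith)
  have hl1 : 1 ≤ l ^ (1 + ε) := Real.one_le_rpow hK (by linarith)
  have hgt : 0 < γ * θ := by positivity
  rw [div_le_iff₀ hN, pen, modelDim_zero_right] at *
  calc 2 * ((γ * θ + Real.log (2 * 2 ^ k) ^ (1 + ε)) * (2 * 2 ^ k)) ≤
      2 * ((γ * θ * l ^ (1 + ε) + l ^ (1 + ε)) * (2 * 2 ^ k)) := by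
        refine mul_le_mul_of_nonneg_left (mul_le_mul_of_nonneg_right (add_le_add ?_ hD)
          (by positivity)) (by norm_num)
        exact le_mul_of_one_le_right hgt.le hl1
    _ = _ := by field_simp; ring

end Rate

end HeteroReg

end

/-! ### Choice of the resolution and the final rate. -/

theorem proposition3
    (α₁ α₂ L₁ L₂ θ γ σmin δ ε : ℝ)
    (hα₁ : 0 < α₁) (hα₁' : α₁ ≤ 1) (hα₂ : 0 < α₂) (hα₂' : α₂ ≤ 1)
    (hL₁ : 0 < L₁) (hL₂ : 0 < L₂) (hθ : 1 < θ) (hγ : 1 ≤ γ) (hσmin : 0 < σmin)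
    (hδ : 0 < δ) (hε : 0 < ε) :
    ∃ C : ℝ, 0 < C ∧ ∀ K : ℕ,
      max ((2 * σmin ^ 2 / (L₁ ^ 2 * σmin + L₂ ^ 2)) ^ 2) (Real.exp (4 * (1 + ε) ^ 2))
        ≤ (2 : ℝ) ^ K →
      ∀ mhat : (Fin (2 ^ K) → ℝ) × (Fin (2 ^ K) → ℝ) → ℕ × ℕ,
        HeteroReg.IsSelector K θ γ δ ε mhat →
      ∀ sr ∈ HeteroReg.holderBall α₁ L₁, ∀ σr ∈ HeteroReg.holderBall α₂ L₂,
      ∀ s σ : Fin (2 ^ K) → ℝ, s = HeteroReg.design (2 ^ K) sr → σ = HeteroReg.design (2 ^ K) σr →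
        (∀ i, σmin ≤ σ i) → (∀ i j, σ i ≤ γ * σ j) →
        MeasureTheory.Integrable (HeteroReg.selectedLoss K mhat s σ)
          ((HeteroReg.gaussLaw s σ).prod (HeteroReg.gaussLaw s σ)) ∧
        ∫ y, HeteroReg.selectedLoss K mhat s σ y
            ∂((HeteroReg.gaussLaw s σ).prod (HeteroReg.gaussLaw s σ))
          ≤ C * ((2 : ℝ) ^ K / Real.log ((2 : ℝ) ^ K) ^ (1 + ε)) ^
              (-2 * min α₁ α₂ / (2 * min α₁ α₂ + 1)) := by
  open HeteroReg in
  set α := min α₁ α₂ with hα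
  have hα0 : 0 < α := lt_min hα₁ hα₂
  have hα1 : α ≤ 1 := (min_le_left _ _).trans hα₁'
  set κ := resolutionConst θ γ δ
  have hκ : 0 < κ := resolutionConst_pos hθ hγ hδ
  have hc := lowerLevel_pos δ γ
  set c := lowerLevel δ γ
  set rc := riskConst L₁ L₂ γ σmin with hrcdef
  have hrc : 0 ≤ rc := riskConst_nonneg hγ hσmin
  set nb := noiseBound γ c ε
  set bc := badConst L₁ L₂ γ σmin with hbcdef
  have hnb : 0 ≤ nb := by simp only [nb, noiseBound]; positivity
  have hbc : 0 ≤ bc := by rw [hbcdef, badConst, ← hrcdef]; positivity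
  set A := (κ / 2) ^ (-2 * α)
  have hA : 0 < A := by positivity
  refine ⟨3 * (L₁ ^ 2 / (c * σmin) * A + rc / c * (A + (1 + κ))) +
    4 * (γ * θ + 1) * (1 + κ) + (nb + bc) * 162, by positivity, ?_⟩
  rintro K hKmax mhat hsel sr hsr σr hσr s σ rfl rfl hσ hσγ
  -- The smallest variance plays the part of `τ`, so that every variance lies in `[τ, γ τ]`.
  obtain ⟨i₀, hi₀⟩ := Finite.exists_min (design (2 ^ K) σr)
  have hlog := le_log_of_exp_le ((le_max_right _ _).trans hKmax)
  have hN : (0 : ℝ) < 2 ^ K := by positivity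
  have hK : 1 ≤ Real.log ((2 : ℝ) ^ K) := by nlinarith
  have hl1 : 1 ≤ Real.log ((2 : ℝ) ^ K) ^ (1 + ε) := Real.one_le_rpow hK (by linarith)
  set X : ℝ := 2 ^ K / Real.log ((2 : ℝ) ^ K) ^ (1 + ε) with hX
  have hX1 : 1 ≤ X := (one_le_div (by linarith)).2 (log_rpow_le hε hN hlog)
  have hXN : X ≤ 2 ^ K := div_le_self hN.le hl1
  have hX0 : 0 < X := by linarith
  set a := 1 / (2 * α + 1) with ha
  have ha0 : 0 < a := by positivity
  have ha1 : a ≤ 1 := by rw [ha, div_le_one (by positivity)]; linarith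
  set r := X ^ (-2 * α / (2 * α + 1)) with hr
  have hXa : 1 ≤ X ^ a := Real.one_le_rpow hX1 ha0.le
  -- This resolution balances the squared bias `2 ^ (-2 k α)` and the variance term `2 ^ k / X`; `κ`
  -- keeps the model within the dimension constraints.
  obtain ⟨k, hk1, hk2⟩ := exists_two_pow_near (κ * X ^ a)
  have hm : (k, 0) ∈ models K θ γ δ ε := by
    rcases le_or_gt 1 (κ * X ^ a) with h1 | h1
    · rw [max_eq_right h1] at hk1
      refine mem_models_of_le hθ hγ hX hX0 hXN (hk1.trans ?_)
      have : X ^ a ≤ X := by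
        conv_rhs => rw [← Real.rpow_one X]
        exact Real.rpow_le_rpow_of_exponent_le hX1 ha1
      gcongr
    -- If the target is below 1, then `k = 0`; the value of the selector at any data shows that the
    -- collection is nonempty.
    · rw [max_eq_left h1.le] at hk1
      have : k = 0 := by
        by_contra h
        exact absurd hk1 (not_le.2 (one_lt_pow₀ (by norm_num) h))
      rw [this]
      exact zero_mem_models hθ hγ (hsel.mem 0)
  have hkK : k ≤ K := by simpa using hm.1
  have hpow : (0 : ℝ) < 2 ^ k := by positivity
  have hinv1 : ((2 : ℝ) ^ k)⁻¹ ≤ 1 := inv_le_one_of_one_le₀ (one_le_pow₀ (by norm_num))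
  have hzero : ∀ i j : Fin (2 ^ K), blockIndex K 0 j = blockIndex K 0 i := fun i j => by
    simp [blockIndex, Nat.div_eq_of_lt i.2, Nat.div_eq_of_lt j.2]
  have hA₁ : ∀ i j, |design (2 ^ K) sr i - design (2 ^ K) sr j| ≤ L₁ := fun i j => by
    simpa using abs_design_sub_le hsr hL₁.le hα0 (min_le_left _ _) (Nat.zero_le K) (hzero i j)
  have hB₁ : ∀ i j, |design (2 ^ K) σr i - design (2 ^ K) σr j| ≤ L₂ := fun i j => by
    simpa using abs_design_sub_le hσr hL₂.le hα0 (min_le_right _ _) (Nat.zero_le K) (hzero i j)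
  have horacle := IntegralLE.selectedLoss (σmin := σmin) (L₁ := L₁) (L₂ := L₂)
    (τ := design (2 ^ K) σr i₀) (h := (((2 : ℝ) ^ k)⁻¹) ^ α) (m₀ := (k, 0)) hθ hγ hε hK hσmin
    (hσ i₀) hi₀ (fun i => hσγ i i₀)
    hA₁ hB₁ hsel hm (by positivity) (Real.rpow_le_one (by positivity) hinv1 hα0.le)
    (fun i j => abs_design_sub_le hsr hL₁.le hα0 (min_le_left _ _) hkK)
    (fun i j => abs_design_sub_le hσr hL₂.le hα0 (min_le_right _ _) hkK)
  have b1 : ((((2 : ℝ) ^ k)⁻¹) ^ α) ^ 2 ≤ A * r := by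
    have e1 : ((((2 : ℝ) ^ k)⁻¹) ^ α) ^ 2 = ((2 : ℝ) ^ k) ^ (-2 * α) := by
      rw [← Real.rpow_natCast, ← Real.rpow_mul (by positivity), Real.inv_rpow hpow.le,
        ← Real.rpow_neg hpow.le]
      congr 1
      push_cast
      ring
    have e2 : A * r = (κ / 2 * X ^ a) ^ (-2 * α) := by
      rw [Real.mul_rpow (by positivity) (by positivity), ← Real.rpow_mul hX0.le]
      rw [hr]
      congr 2
      rw [ha]
      ring
    rw [e1, e2]
    exact Real.rpow_le_rpow_of_nonpos (by positivity) (by linarith) (by linarith)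
  have b2 : (2 : ℝ) ^ k / X ≤ (1 + κ) * r := by
    have e : r = X ^ a / X := by
      conv_rhs => rw [← Real.rpow_one X, ← Real.rpow_mul hX0.le, ← Real.rpow_sub hX0]
      rw [hr]
      congr 1
      rw [ha]
      field_simp
      ring
    rw [e, ← mul_div_assoc]
    refine div_le_div_of_nonneg_right (hk1.trans (max_le ?_ ?_)) hX0.le
    · nlinarith
    · nlinarith
  -- Here `d_m = 1`, so fine and coarse blocks coincide and the inverse block size is `2 ^ k / n ≤ 2
  -- ^ k / X`.
  have b3 : ((2 : ℝ) ^ (K - ((k, 0) : ℕ × ℕ).1.add 0))⁻¹ ≤ (1 + κ) * r := by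
    refine le_trans ?_ b2
    have e : (2 : ℝ) ^ K = 2 ^ k * 2 ^ (K - k) := by rw [← pow_add]; congr 1; omega
    change ((2 : ℝ) ^ (K - k))⁻¹ ≤ _
    rw [inv_le_iff_one_le_mul₀ (by positivity), div_mul_eq_mul_div, ← e, one_le_div hX0]
    exact hXN
  have b4 := pen_div_le hθ hγ hε hK hm
  have b5 : ((K : ℝ) + 1) ^ 2 / 2 ^ K ≤ 162 * r := by
    refine (succ_sq_div_le hK).trans ?_
    gcongr
    calc ((2 : ℝ) ^ K) ^ (-(2 / 3) : ℝ) ≤ X ^ (-(2 / 3) : ℝ) :=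
          Real.rpow_le_rpow_of_nonpos hX0 hXN (by norm_num)
      _ ≤ r := by
          -- `α ≤ 1` gives `2 α / (2 α + 1) ≤ 2 / 3`.
          refine Real.rpow_le_rpow_of_exponent_le hX1 ?_
          rw [le_div_iff₀ (by positivity)]
          linarith
  refine ⟨horacle.1, horacle.2.trans ?_⟩
  calc _ ≤ 3 * (L₁ ^ 2 / (c * σmin) * (A * r) + rc / c * (A * r + (1 + κ) * r)) +
        4 * (γ * θ + 1) * ((1 + κ) * r) + (nb + bc) * (162 * r) := by
        refine add_le_add (add_le_add ?_ (b4.trans ?_)) ?_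
        · refine mul_le_mul_of_nonneg_left (add_le_add ?_ ?_) (by norm_num)
          · exact mul_le_mul_of_nonneg_left b1 (by positivity)
          · exact mul_le_mul_of_nonneg_left (add_le_add b1 b3) (by positivity)
        · exact mul_le_mul_of_nonneg_left b2 (by positivity)
        · exact mul_le_mul_of_nonneg_left b5 (by positivity)
    _ = _ := by ring
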